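/- Let $m_1>m_2\ge 2$ and $q\ge 2$ be integers, $\gamma=\log m_2/\log m_1$, and let $j\ge 0$ be the unique integer with $q^j\le 1/\gamma<q^{j+1}$. Put $\Sigma=(\{0,\dots,m_1-1\}\times\{0,\dots,m_2-1\})^{\mathbb N^*}$, with the product topology and the metric (which induces it) $$d\big((x_k,y_k)_k,(u_k,v_k)_k\big)=\max\big(m_1^{-\min\{k\ge 0:(x_{k+1},y_{k+1})\ne(u_{k+1},v_{k+1})\}},\ m_1^{-\gamma\min\{k\ge 0:y_{k+1}\ne v_{k+1}\}}\big),\qquad m_1^{-\infty}=0,$$ and let $\dim_H$ be the Hausdorff dimension for $d$. For a Borel probability measure $\nu$ on $\Sigma$ let $\underline{\dim}_H\nu=\inf\{\dim_H(A): A\text{ Borel},\ \nu(A)>0\}$ and $\overline{\dim}_H\nu=\inf\{\dim_H(A):A\text{ Borel},\ \nu(A)=1\}$. Let $\Omega\subset\Sigma$ be closed and non-empty, and let $$X_\Omega=\{(x_k,y_k)_{k\ge1}\in\Sigma:(x_{iq^\ell},y_{iq^\ell})_{\ell\ge0}\in\Omega\text{ for all }i\text{ with }q\nmid i\}.$$ For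 a Borel probability measure $\mu$ on $\Omega$ let $\mathbb P_\mu$ be the Borel probability measure on $\Sigma$ under which the subsequences $(x_{iq^\ell},y_{iq^\ell})_{\ell\ge0}$, $q\nmid i$, are independent with law $\mu$; equivalently, $\mathbb P_\mu([(x_1,y_1)\cdots(x_n,y_n)])=\prod_{i\le n,\,q\nmid i}\mu([(x_i,y_i)(x_{qi},y_{qi})\cdots(x_{q^ri},y_{q^ri})])$, where $q^ri\le n<q^{r+1}i$. For a word $u=(x_1,y_1)\cdots(x_p,y_p)\,y_{p+1}\cdots y_{p+\ell}$ let $[u]$ be the set of sequences in $\Sigma$ whose first $p$ letters are $(x_1,y_1),\dots,(x_p,y_p)$ and whose next $\ell$ second coordinates are $y_{p+1},\dots,y_{p+\ell}$, and let $\mathrm{Pref}_{p,\ell}(\Omega)$ be the set of such words with $\Omega\cap[u]\ne\varnothing$. Consider the directed graph on $\bigcup_{k\ge1}\mathrm{Pref}_{k,j}(\Omega)$ with an edge from $(x_1,y_1)\cdots(x_k,y_k)y_{k+1}\cdots y_{k+j}$ to each of its followers $(x_1,y_1)\cdots(x_{k+1},y_{k+1})y_{k+2}\cdots y_{k+j+1}$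 in $\mathrm{Pref}_{k+1,j}(\Omega)$. For $u\in\mathrm{Pref}_{1,j}(\Omega)$ let $V_u$ be the set of vertices that can be reached from $u$ (including $u$). All sums below are over the letters for which the words occurring as indices belong to $\mathrm{Pref}_{k,j}(\Omega)$ for the appropriate $k$. Then the following hold. 1. For every $u\in\mathrm{Pref}_{1,j}(\Omega)$ there is a unique vector $t\in\big[1,m_2^{2/(\gamma(q-1))}\big]^{V_u}$ such that, for all $(x_1,y_1)\cdots(x_k,y_k)y_{k+1}\cdots y_{k+j}\in V_u$, $$t_{(x_1,y_1)\cdots(x_k,y_k)y_{k+1}\cdots y_{k+j}}^{\,q^{j+1}\gamma}=\sum_{y'_{k+j+1}}\Big(\sum_{x'_{k+1}}t_{(x_1,y_1)\cdots(x_k,y_k)(x'_{k+1},y_{k+1})y_{k+2}\cdots y_{k+j}y'_{k+j+1}}\Big)^{q^j\gamma}$$ (for $j=0$, $y_{k+1}$ is here the summation variable $y'_{k+1}$). These vectors together define $t$ on $\bigcup_{k\ge1}\mathrm{Pref}_{k,j}(\Omega)$. 2. Define recursively $N_j(y_1\cdots y_j)=\sum_{y_{j+1}}\big(\sum_{x_1}t_{(x_1,y_1)y_2\cdots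 y_{j+1}}\big)^{q^j\gamma}$ and $N_{i}(y_1\cdots y_{i})=\sum_{y_{i+1}}N_{i+1}(y_1\cdots y_{i+1})^{1/q}$ for $0\le i<j$, and let $t_\varnothing=N_0$. Then there is a unique Borel probability measure $\mu$ on $\Omega$ such that, for all $k\ge1$ and $u=(x_1,y_1)\cdots(x_k,y_k)y_{k+1}\cdots y_{k+j}\in\mathrm{Pref}_{k,j}(\Omega)$, $$\mu([u])=\frac{t_{(x_1,y_1)y_2\cdots y_{j+1}}\big(\sum_{x'_1}t_{(x'_1,y_1)y_2\cdots y_{j+1}}\big)^{q^j\gamma-1}}{t_\varnothing}\ \prod_{i=1}^{j}N_i(y_1\cdots y_i)^{\frac{1-q}{q}}\ \prod_{p=2}^k\frac{t_{(x_1,y_1)\cdots(x_p,y_p)y_{p+1}\cdots y_{p+j}}\big(\sum_{x'_p}t_{(x_1,y_1)\cdots(x'_p,y_p)y_{p+1}\cdots y_{p+j}}\big)^{q^j\gamma-1}}{t_{(x_1,y_1)\cdots(x_{p-1},y_{p-1})y_p\cdots y_{p-1+j}}^{\,q^{j+1}\gamma}}.$$ 3. $\underline{\dim}_H(\mathbb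 P_\mu)=\overline{\dim}_H(\mathbb P_\mu)=\frac{q-1}{q}\log_{m_2}(t_\varnothing)$, a non-negative number. 4. $\mu$ is the unique maximizer: for every Borel probability measure $\nu\ne\mu$ on $\Omega$ one has $\underline{\dim}_H(\mathbb P_\nu)<\underline{\dim}_H(\mathbb P_\mu)$ and $\overline{\dim}_H(\mathbb P_\nu)<\overline{\dim}_H(\mathbb P_\mu)$. 5. $\dim_H(X_\Omega)\ge\frac{q-1}{q}\log_{m_2}(t_\varnothing)$. -/

import Mathlib

open MeasureTheory Set
open scoped ENNReal

namespace MultCarpet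

noncomputable section

/-- The symbolic space of sequences of letters of `{0,…,m₁-1} × {0,…,m₂-1}`, with its product
topology and product (= Borel) σ-algebra. The entry with (one-based) number `k` of the usual
notation is `z (k - 1)`. -/
abbrev Symb (m₁ m₂ : ℕ) : Type := ℕ → Fin m₁ × Fin m₂

/-- The exponent `γ = log m₂ / log m₁`. -/
def gam (m₁ m₂ : ℕ) : ℝ := Real.log m₂ / Real.log m₁

/-! ### The metric and Hausdorff dimensions -/

/-- `c ^ (-min {k ≥ 0 : u_{k+1} ≠ v_{k+1}})`, with value `0` for `u = v`. -/
def seqDist {α : Type} (c : ℝ) (u v : ℕ → α) : ℝ :=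
  open Classical in if u = v then 0 else c ^ (-(PiNat.firstDiff u v : ℝ))

/-- The distance `d`: the maximum of `m₁ ^ (-min {k : (x_{k+1},y_{k+1}) ≠ (u_{k+1},v_{k+1})})` and
`m₁ ^ (-γ min {k : y_{k+1} ≠ v_{k+1}})`. -/
def carpetDist (m₁ m₂ : ℕ) (z w : Symb m₁ m₂) : ℝ :=
  max (seqDist (m₁ : ℝ) z w)
    (seqDist ((m₁ : ℝ) ^ gam m₁ m₂) (fun k => (z k).2) (fun k => (w k).2))

theorem gam_nonneg (m₁ m₂ : ℕ) : 0 ≤ gam m₁ m₂ :=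
  div_nonneg (Real.log_natCast_nonneg _) (Real.log_natCast_nonneg _)

theorem seqDist_self {α : Type} (c : ℝ) (u : ℕ → α) : seqDist c u u = 0 := by
  simp [seqDist]

theorem seqDist_comm {α : Type} (c : ℝ) (u v : ℕ → α) : seqDist c u v = seqDist c v u := by
  by_cases h : u = v
  · rw [h]
  · simp only [seqDist, h, Ne.symm h, if_false, PiNat.firstDiff_comm u v]

theorem seqDist_nonneg {α : Type} {c : ℝ} (hc : 1 ≤ c) (u v : ℕ → α) : 0 ≤ seqDist c u v := by
  unfold seqDist
  split_ifs
  · exact le_rfl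
  · positivity

theorem seqDist_triangle {α : Type} {c : ℝ} (hc : 1 ≤ c) (u v w : ℕ → α) :
    seqDist c u w ≤ seqDist c u v + seqDist c v w := by
  by_cases huw : u = w
  · subst huw
    rw [seqDist_self]
    exact add_nonneg (seqDist_nonneg hc _ _) (seqDist_nonneg hc _ _)
  by_cases huv : u = v
  · subst huv
    simp [seqDist_self]
  by_cases hvw : v = w
  · subst hvw
    simp [seqDist_self]
  have h := PiNat.min_firstDiff_le u v w huw
  rcases min_le_iff.1 h with h | h
  · have : seqDist c u w ≤ seqDist c u v := by
      simp only [seqDist, huw, huv, if_false]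
      exact Real.rpow_le_rpow_of_exponent_le hc (by simpa using h)
    linarith [seqDist_nonneg hc v w]
  · have : seqDist c u w ≤ seqDist c v w := by
      simp only [seqDist, huw, hvw, if_false]
      exact Real.rpow_le_rpow_of_exponent_le hc (by simpa using h)
    linarith [seqDist_nonneg hc u v]

theorem one_le_base {m₁ m₂ : ℕ} (z : Symb m₁ m₂) : (1 : ℝ) ≤ m₁ := by
  have h : 0 < m₁ := lt_of_le_of_lt (Nat.zero_le _) (z 0).1.isLt
  exact_mod_cast h

theorem one_le_base_rpow {m₁ m₂ : ℕ} (z : Symb m₁ m₂) : (1 : ℝ) ≤ (m₁ : ℝ) ^ gam m₁ m₂ :=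
  Real.one_le_rpow (one_le_base z) (gam_nonneg _ _)

/-- The metric space structure given by the distance `d`. -/
@[reducible] def carpetMetric (m₁ m₂ : ℕ) : MetricSpace (Symb m₁ m₂) where
  dist := carpetDist m₁ m₂
  dist_self z := by simp [carpetDist, seqDist_self]
  dist_comm z w := by
    unfold carpetDist
    rw [seqDist_comm _ z w, seqDist_comm _ (fun k => (z k).2)]
  dist_triangle z w v := by
    unfold carpetDist
    refine max_le ?_ ?_
    · exact (seqDist_triangle (one_le_base z) z w v).trans
        (add_le_add (le_max_left _ _) (le_max_left _ _))
    · exact (seqDist_triangle (one_le_base_rpow z) _ _ _).trans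
        (add_le_add (le_max_right _ _) (le_max_right _ _))
  eq_of_dist_eq_zero {z w} h := by
    change carpetDist m₁ m₂ z w = 0 at h
    by_contra hne
    have h1 : seqDist (m₁ : ℝ) z w ≤ 0 := h ▸ le_max_left _ _
    have h0 : (0 : ℝ) < m₁ := lt_of_lt_of_le one_pos (one_le_base z)
    simp only [seqDist, hne, if_false] at h1
    exact absurd h1 (not_le.2 (Real.rpow_pos_of_pos h0 _))

/-- Hausdorff dimension of a subset of the symbolic space for the metric `d`. -/
def hdim {m₁ m₂ : ℕ} (s : Set (Symb m₁ m₂)) : ℝ≥0∞ :=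
  letI : MetricSpace (Symb m₁ m₂) := carpetMetric m₁ m₂
  dimH s

/-- Lower Hausdorff dimension of a measure: infimum of the dimensions of the Borel sets of
positive mass. -/
def lowerHdim {m₁ m₂ : ℕ} (ν : Measure (Symb m₁ m₂)) : ℝ≥0∞ :=
  ⨅ (s : Set (Symb m₁ m₂)) (_ : MeasurableSet s) (_ : 0 < ν s), hdim s

/-- Upper Hausdorff dimension of a measure: infimum of the dimensions of the Borel sets of
full mass. -/
def upperHdim {m₁ m₂ : ℕ} (ν : Measure (Symb m₁ m₂)) : ℝ≥0∞ :=
  ⨅ (s : Set (Symb m₁ m₂)) (_ : MeasurableSet s) (_ : ν sᶜ = 0), hdim s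

/-! ### The set `X_Ω` and the measures `ℙ_μ` -/

/-- `X_Ω`: all `(z_k)_{k ≥ 1}` with `(z_{i q^ℓ})_{ℓ ≥ 0} ∈ Ω` for all `i` with `q ∤ i`. -/
def multSet {m₁ m₂ : ℕ} (q : ℕ) (Ω : Set (Symb m₁ m₂)) : Set (Symb m₁ m₂) :=
  {z | ∀ i : ℕ, ¬ q ∣ i → (fun l : ℕ => z (i * q ^ l - 1)) ∈ Ω}

/-- Puts together sequences `w i` (only those with `q ∤ i` matter): the entry with number
`k = i q^r`, `q ∤ i`, of the result is the entry with number `r + 1` of `w i`. -/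
def interleave {m₁ m₂ : ℕ} (q : ℕ) (w : ℕ → Symb m₁ m₂) : Symb m₁ m₂ :=
  fun n => w ((n + 1) / q ^ multiplicity q (n + 1)) (multiplicity q (n + 1))

/-- `ℙ_μ`: the law of a random sequence `z` whose subsequences `(z_{i q^ℓ})_{ℓ ≥ 0}`, `q ∤ i`, are
independent with law `μ`. Its values on cylinders are given by `prodMeasure_cylinder`. -/
def prodMeasure {m₁ m₂ : ℕ} (q : ℕ) (μ : Measure (Symb m₁ m₂)) : Measure (Symb m₁ m₂) :=
  (Measure.infinitePi (fun _ : ℕ => μ)).map (interleave q)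

theorem measurable_interleave {m₁ m₂ : ℕ} (q : ℕ) :
    Measurable (interleave (m₁ := m₁) (m₂ := m₂) q) := by
  refine measurable_pi_iff.2 fun n => ?_
  exact (measurable_pi_apply _).comp (measurable_pi_apply _)

theorem interleave_apply {m₁ m₂ q : ℕ} (hq : 2 ≤ q) (w : ℕ → Symb m₁ m₂) {i : ℕ}
    (hi : ¬ q ∣ i) (r : ℕ) : interleave q w (i * q ^ r - 1) = w i r := by
  have hi0 : 0 < i := Nat.pos_of_ne_zero fun h => hi (h ▸ dvd_zero q)
  have hqr : 0 < q ^ r := Nat.pow_pos (by omega)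
  have hpos : 0 < i * q ^ r := Nat.mul_pos hi0 hqr
  have hk : i * q ^ r - 1 + 1 = i * q ^ r := by omega
  have hm : multiplicity q (i * q ^ r) = r := by
    refine multiplicity_eq_of_dvd_of_not_dvd (dvd_mul_left _ _) ?_
    rw [pow_succ', Nat.mul_dvd_mul_iff_right hqr]
    exact hi
  simp only [interleave, hk, hm, Nat.mul_div_cancel _ hqr]

/-- `ℙ_μ([z_1 ⋯ z_n])` is the product over `i ≤ n`, `q ∤ i`, of the `μ`-masses of the cylinders
`[z_i z_{qi} ⋯ z_{q^r i}]`, where `q^r i ≤ n < q^{r+1} i`. -/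
theorem prodMeasure_cylinder {m₁ m₂ q : ℕ} (hq : 2 ≤ q) (μ : Measure (Symb m₁ m₂))
    [IsProbabilityMeasure μ] (z : Symb m₁ m₂) (n : ℕ) :
    prodMeasure q μ {w | ∀ k < n, w k = z k} =
      ∏ i ∈ (Finset.Icc 1 n).filter (fun i => ¬ q ∣ i),
        μ {w | ∀ r : ℕ, i * q ^ r ≤ n → w r = z (i * q ^ r - 1)} := by
  have hmeas : ∀ P : ℕ → Prop, ∀ a : ℕ → Fin m₁ × Fin m₂,
      MeasurableSet {w : Symb m₁ m₂ | ∀ r, P r → w r = a r} := by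
    intro P a
    simp only [Set.ofPred_forall]
    refine MeasurableSet.iInter fun r => MeasurableSet.iInter fun _ => ?_
    have h1 : Measurable fun w : Symb m₁ m₂ => w r := measurable_pi_apply r
    exact h1 (measurableSet_singleton (a r))
  rw [prodMeasure, Measure.map_apply (measurable_interleave q) (hmeas (fun k => k < n) z),
    ← Measure.infinitePi_pi (fun _ : ℕ => μ)
      (t := fun i => {w | ∀ r : ℕ, i * q ^ r ≤ n → w r = z (i * q ^ r - 1)})
      (fun i _ => hmeas (fun r => i * q ^ r ≤ n) (fun r => z (i * q ^ r - 1)))]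
  congr 1
  ext w
  simp only [Set.mem_preimage, Set.mem_ofPred_eq, Set.mem_pi, Finset.coe_filter, Finset.mem_Icc]
  constructor
  · rintro h i ⟨⟨hi1, _⟩, hi⟩ r hr
    have hpos : 0 < i * q ^ r := Nat.mul_pos hi1 (Nat.pow_pos (by omega))
    rw [← interleave_apply hq w hi r]
    exact h _ (by omega)
  · intro h k hk
    have hfin : FiniteMultiplicity q (k + 1) :=
      Nat.finiteMultiplicity_iff.2 ⟨by omega, by omega⟩
    obtain ⟨i, hki, hi⟩ := hfin.exists_eq_pow_mul_and_not_dvd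
    have hi0 : 0 < i := Nat.pos_of_ne_zero fun h0 => hi (h0 ▸ dvd_zero q)
    set r := multiplicity q (k + 1)
    have hk1 : i * q ^ r = k + 1 := by rw [hki]; ring
    have hin : i ≤ n := by
      have : i ≤ i * q ^ r := Nat.le_mul_of_pos_right _ (Nat.pow_pos (by omega))
      omega
    have h2 := h i ⟨⟨hi0, hin⟩, hi⟩ r (by omega)
    rw [← interleave_apply hq w hi r, hk1] at h2
    simpa using h2

/-! ### Prefixes and the tree of prefixes -/

/-- A word `(x_1,y_1) ⋯ (x_p,y_p) y_{p+1} ⋯ y_{p+ℓ}`: the list of its `p` full letters and the list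
of its `ℓ` letters of `{0,…,m₂-1}`. -/
abbrev Word (m₁ m₂ : ℕ) : Type := List (Fin m₁ × Fin m₂) × List (Fin m₂)

/-- The generalized cylinder `[u]`. -/
def cyl {m₁ m₂ : ℕ} (u : Word m₁ m₂) : Set (Symb m₁ m₂) :=
  {z | (∀ (i : ℕ) (h : i < u.1.length), z i = u.1[i]) ∧
    ∀ (i : ℕ) (h : i < u.2.length), (z (u.1.length + i)).2 = u.2[i]}

/-- The set `Pref_{p,ℓ}(Ω)`. -/
def Pref {m₁ m₂ : ℕ} (p l : ℕ) (Ω : Set (Symb m₁ m₂)) : Set (Word m₁ m₂) :=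
  {u | u.1.length = p ∧ u.2.length = l ∧ (Ω ∩ cyl u).Nonempty}

/-- Adds the first coordinate `x` to the first letter without first coordinate: sends
`(x_1,y_1) ⋯ (x_p,y_p) y_{p+1} y_{p+2} ⋯` to `(x_1,y_1) ⋯ (x_p,y_p) (x,y_{p+1}) y_{p+2} ⋯`. -/
def fillX {m₁ m₂ : ℕ} (u : Word m₁ m₂) (x : Fin m₁) : Word m₁ m₂ :=
  match u.2 with
  | [] => u
  | y :: ys => (u.1 ++ [(x, y)], ys)

/-- The edges `v → w` of the tree `Γ_j(Ω)` between vertices other than the root. -/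
def Edge {m₁ m₂ : ℕ} (j : ℕ) (Ω : Set (Symb m₁ m₂)) (v w : Word m₁ m₂) : Prop :=
  v ∈ Pref v.1.length j Ω ∧ w ∈ Pref w.1.length j Ω ∧
    ∃ (x : Fin m₁) (y : Fin m₂), w = fillX (v.1, v.2 ++ [y]) x

/-- The set of vertices `V_{u,j}(Ω)` of the tree of followers of `u` in `Γ_j(Ω)`. -/
def treeVertices {m₁ m₂ : ℕ} (j : ℕ) (Ω : Set (Symb m₁ m₂)) (u : Word m₁ m₂) :
    Set (Word m₁ m₂) :=
  {v | Relation.ReflTransGen (Edge j Ω) u v}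

/-- For `c = (x_1,y_1) ⋯ (x_{p-1},y_{p-1}) y_p ⋯ y_{p+j}`, the sum over `x'_p` of the numbers
`t_{(x_1,y_1) ⋯ (x'_p,y_p) y_{p+1} ⋯ y_{p+j}}`, restricted to the indices in `Pref_{p,j}(Ω)`. -/
def xSum {m₁ m₂ : ℕ} (j : ℕ) (Ω : Set (Symb m₁ m₂)) (t : Word m₁ m₂ → ℝ) (c : Word m₁ m₂) : ℝ :=
  open Classical in
  ∑ x : Fin m₁ with fillX c x ∈ Pref (c.1.length + 1) j Ω, t (fillX c x)

/-- `t` restricts on the vertices of the tree of followers of `u` to a solution, with values in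
`[1, m₂^{2/(γ(q-1))}]`, of the system of equations. A letter `y'` that no follower contains
contributes an empty sum, whose power `0 ^ (q^j γ)` is `0`. The values of `t` at other words are
irrelevant. -/
structure IsTreeVector {m₁ m₂ : ℕ} (q j : ℕ) (Ω : Set (Symb m₁ m₂)) (u : Word m₁ m₂)
    (t : Word m₁ m₂ → ℝ) : Prop where
  mem_Icc : ∀ v ∈ treeVertices j Ω u,
    t v ∈ Set.Icc (1 : ℝ) ((m₂ : ℝ) ^ (2 / (gam m₁ m₂ * ((q : ℝ) - 1))))
  eqn : ∀ v ∈ treeVertices j Ω u,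
    t v ^ ((q : ℝ) ^ (j + 1) * gam m₁ m₂) =
      ∑ y : Fin m₂, xSum j Ω t (v.1, v.2 ++ [y]) ^ ((q : ℝ) ^ j * gam m₁ m₂)

/-! ### The number `t_∅` and the weights -/

/-- For `ys = y_1 ⋯ y_{j-p}`, the nested sum
`∑_{y'_{j+1-p}} (∑_{y'_{j+2-p}} (⋯ (∑_{y'_{j+1}} (∑_{x'_1} t_{(x'_1,y_1) y_2 ⋯ y_{j-p} y'_{j+1-p} ⋯
y'_{j+1}})^{q^j γ})^{1/q} ⋯)^{1/q})^{1/q}` with `p + 2` sums and `p` exponents `1/q`. -/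
def nested {m₁ m₂ : ℕ} (q j : ℕ) (Ω : Set (Symb m₁ m₂)) (t : Word m₁ m₂ → ℝ) :
    ℕ → List (Fin m₂) → ℝ
  | 0, ys => ∑ y : Fin m₂, xSum j Ω t ([], ys ++ [y]) ^ ((q : ℝ) ^ j * gam m₁ m₂)
  | p + 1, ys => ∑ y : Fin m₂, nested q j Ω t p (ys ++ [y]) ^ (1 / (q : ℝ))

/-- The number `t_∅`. -/
def tRoot {m₁ m₂ : ℕ} (q j : ℕ) (Ω : Set (Symb m₁ m₂)) (t : Word m₁ m₂ → ℝ) : ℝ :=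
  nested q j Ω t j []

/-- The letters `y_1 ⋯ y_{p+ℓ}` of a word. -/
def ys {m₁ m₂ : ℕ} (u : Word m₁ m₂) : List (Fin m₂) := u.1.map Prod.snd ++ u.2

/-- For a word `u` as above, `(x_1,y_1) ⋯ (x_p,y_p) y_{p+1} ⋯ y_{p+l}`. -/
def trunc {m₁ m₂ : ℕ} (p l : ℕ) (u : Word m₁ m₂) : Word m₁ m₂ :=
  (u.1.take p, ((ys u).drop p).take l)

/-- The mass given to `[u]`, for `u = (x_1,y_1) ⋯ (x_k,y_k) y_{k+1} ⋯ y_{k+j}` with `k ≥ 1`. -/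
def weight {m₁ m₂ : ℕ} (q j : ℕ) (Ω : Set (Symb m₁ m₂)) (t : Word m₁ m₂ → ℝ)
    (u : Word m₁ m₂) : ℝ :=
  t (trunc 1 j u) * xSum j Ω t (trunc 0 (j + 1) u) ^ ((q : ℝ) ^ j * gam m₁ m₂ - 1)
      / tRoot q j Ω t *
    (∏ p ∈ Finset.range j, nested q j Ω t p ((ys u).take (j - p)) ^ ((1 - (q : ℝ)) / q)) *
    ∏ p ∈ Finset.Icc 2 u.1.length,
      t (trunc p j u) * xSum j Ω t (trunc (p - 1) (j + 1) u) ^ ((q : ℝ) ^ j * gam m₁ m₂ - 1)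
        / t (trunc (p - 1) j u) ^ ((q : ℝ) ^ (j + 1) * gam m₁ m₂)

/-- `μ` is a Borel probability measure on `Ω`. -/
def IsProbOn {m₁ m₂ : ℕ} (Ω : Set (Symb m₁ m₂)) (μ : Measure (Symb m₁ m₂)) : Prop :=
  IsProbabilityMeasure μ ∧ μ Ωᶜ = 0

/-- `μ` is a Borel probability measure on `Ω` with the prescribed masses of the generalized
cylinders `[u]`, `u ∈ Pref_{k,j}(Ω)`, `k ≥ 1`. -/
def HasWeights {m₁ m₂ : ℕ} (q j : ℕ) (Ω : Set (Symb m₁ m₂)) (t : Word m₁ m₂ → ℝ)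
    (μ : Measure (Symb m₁ m₂)) : Prop :=
  IsProbOn Ω μ ∧ ∀ k : ℕ, 1 ≤ k → ∀ u ∈ Pref k j Ω, μ.real (cyl u) = weight q j Ω t u

/-- The value `((q-1)/q) log_{m₂} t_∅`. -/
def dimValue {m₁ m₂ : ℕ} (q j : ℕ) (Ω : Set (Symb m₁ m₂)) (t : Word m₁ m₂ → ℝ) : ℝ :=
  ((q : ℝ) - 1) / q * Real.logb m₂ (tRoot q j Ω t)

end

end MultCarpet

/-! A closed ball of radius m₁^(-n) fixes n letters and L = ⌈n/γ⌉ second coordinates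
(`carpetDist_le_iff`). Under ℙ_ρ its mass is the product, over i ≤ L with q ∤ i, of the ρ-masses of
the cells fixing p letters and s second coordinates of the i-th subsequence, where p and s count the
r with i q^r ≤ n and i q^r ≤ L (`measure_cell_interleave`). Since q^j ≤ 1/γ < q^(j+1), either s is p
+ j or p + j + 1, or p = 0 and s ≤ j (`isLevel_cnt`). Dimensions of ℙ_ρ thus reduce to the
information -log ρ of such cells.

The vector t is the limit of a monotone iteration started at 1. It is unique because the system
contracts ratios: s ≤ C t implies s ≤ C^(1/q) t. The equations for t and the recursion for N_i say
exactly that the prescribed masses are consistent along the tree, so μ exists by choosing letters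
independently at all nodes and following the resulting branch.

The crucial identity is `tsum_info`. Along every ω in Ω the information of μ splits into terms
attached to single coordinates; weighted by the asymptotic number of indices i that reach each
coordinate, these terms telescope to log t_∅ / γ. Hence the μ-information of a ball, divided by n,
has the same limit at every point of Ω, and its mean has this limit under every ν on Ω
(`HasWeights.tendsto_integral_infoSum`). A law of large numbers (`ae_tendsto_log_prodMeasure`) turns
means into almost sure asymptotics, and covering and mass distribution arguments give the dimension
of ℙ_μ.

For ν ≠ μ, the support of ℙ_ν is covered economically by means of ℙ_ρ with ρ = (μ + ν)/2. This ρ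
inherits the lower bound on cell masses from μ, which ν itself may lack. Its mean information under
ν is smaller than that of μ by a nonnegative amount at every level (`levelGap_le`), and by a fixed
positive amount at some level (p, p + j), which occurs for a positive proportion of the indices i.
So the upper dimension of ℙ_ν is strictly smaller. The bound for X_Ω follows since ℙ_μ is carried by
it. -/

open Filter Topology
open scoped NNReal

/-! ### Dimension bounds from masses of cells -/

/-- Upper bound for the Hausdorff dimension by coverings with cells of large mass. -/
theorem dimH_le_of_frequently_cell {X : Type*} [MetricSpace X] {c d : ℝ} (hc : 1 < c)
    {ι : ℕ → Type*} [∀ n, Fintype (ι n)] (C : ∀ n, ι n → Set X)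
    (hC : ∀ n i, Metric.ediam (C n i) ≤ ENNReal.ofReal (c ^ (-(n : ℝ))))
    (m : ∀ n, ι n → ℝ) (hm0 : ∀ n i, 0 ≤ m n i) (hm1 : ∀ n, ∑ i, m n i ≤ 1) {A : Set X}
    (hA : ∀ z ∈ A, ∃ᶠ n in atTop, ∃ i, z ∈ C n i ∧ c ^ (-(n * d)) ≤ m n i) :
    dimH A ≤ ENNReal.ofReal d := by
  classical
  borelize X
  refine dimH_le fun d' hd' => ?_
  by_contra hlt
  rw [not_le, ← ENNReal.ofReal_coe_nnreal, ENNReal.ofReal_lt_ofReal_iff'] at hlt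
  obtain ⟨hdd, hd0⟩ := hlt
  have hc0 : 0 < c := one_pos.trans hc
  set θ : ℝ := c ^ (d - d') with hθ
  have hθ0 : 0 < θ := Real.rpow_pos_of_pos hc0 _
  have hθ1 : θ < 1 := Real.rpow_lt_one_of_one_lt_of_neg hc (by linarith)
  -- Total mass at most 1 leaves room for at most c^(nd) cells of mass at least c^(-nd). Their
  -- diameters to the power d' then sum to at most θ^n, and the covers use the tails of this
  -- geometric series.
  have hcard : ∀ n, ((Finset.univ.filter fun i : ι n => c ^ (-(n * d)) ≤ m n i).card : ℝ)
      * c ^ (-(n * d)) ≤ 1 := by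
    intro n
    calc _ = ∑ i ∈ Finset.univ.filter (fun i : ι n => c ^ (-(n * d)) ≤ m n i),
          c ^ (-(n * d)) := by rw [Finset.sum_const, nsmul_eq_mul]
      _ ≤ ∑ i ∈ Finset.univ.filter (fun i : ι n => c ^ (-(n * d)) ≤ m n i), m n i :=
          Finset.sum_le_sum fun i hi => (Finset.mem_filter.1 hi).2
      _ ≤ ∑ i, m n i := Finset.sum_le_sum_of_subset_of_nonneg (Finset.subset_univ _)
          fun i _ _ => hm0 n i
      _ ≤ 1 := hm1 n
  have hr : Tendsto (fun N : ℕ => ENNReal.ofReal (c ^ (-(N : ℝ)))) atTop (𝓝 0) := by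
    rw [← ENNReal.ofReal_zero]
    refine ENNReal.tendsto_ofReal ?_
    have := tendsto_pow_atTop_nhds_zero_of_lt_one (inv_nonneg.2 hc0.le) (inv_lt_one_of_one_lt₀ hc)
    refine this.congr fun n => ?_
    rw [Real.rpow_neg hc0.le, Real.rpow_natCast, inv_pow]
  have key := Measure.hausdorffMeasure_le_liminf_tsum (d' : ℝ) A
    (ι := fun N : ℕ => Σ k : ℕ, {i : ι (k + N) // c ^ (-(((k + N : ℕ) : ℝ) * d)) ≤ m (k + N) i})
    (l := atTop) (fun N : ℕ => ENNReal.ofReal (c ^ (-(N : ℝ)))) hr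
    (fun N x => C (x.1 + N) x.2.1)
    (Eventually.of_forall fun N x => (hC _ _).trans (ENNReal.ofReal_le_ofReal
      (Real.rpow_le_rpow_of_exponent_le hc.le (by push_cast; linarith [Nat.cast_nonneg (α := ℝ) x.1]))))
    (Eventually.of_forall fun N z hz => by
      obtain ⟨n, hn, i, hi, hmi⟩ := frequently_atTop.1 (hA z hz) N
      obtain ⟨k, rfl⟩ := Nat.exists_eq_add_of_le' hn
      exact mem_iUnion.2 ⟨⟨k, i, hmi⟩, hi⟩)
  have hlim : Tendsto (fun N : ℕ => ∑' k : ℕ, ENNReal.ofReal (θ ^ (k + N))) atTop (𝓝 0) := by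
    refine ENNReal.tendsto_sum_nat_add (fun k => ENNReal.ofReal (θ ^ k)) ?_
    rw [← ENNReal.ofReal_tsum_of_nonneg (fun n => by positivity)
      (summable_geometric_of_lt_one hθ0.le hθ1)]
    exact ENNReal.ofReal_ne_top
  have hle : liminf (fun N : ℕ => ∑' x : (Σ k : ℕ,
      {i : ι (k + N) // c ^ (-(((k + N : ℕ) : ℝ) * d)) ≤ m (k + N) i}),
      Metric.ediam (C (x.1 + N) x.2.1) ^ (d' : ℝ)) atTop ≤ 0 := by
    rw [← hlim.liminf_eq]
    refine liminf_le_liminf (Eventually.of_forall fun N => ?_)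
    rw [ENNReal.tsum_sigma']
    refine ENNReal.tsum_le_tsum fun k => ?_
    rw [tsum_fintype]
    refine (Finset.sum_le_sum fun i _ => ENNReal.rpow_le_rpow (hC _ _) d'.coe_nonneg).trans ?_
    dsimp only
    rw [Finset.sum_const, nsmul_eq_mul, ENNReal.ofReal_rpow_of_pos (Real.rpow_pos_of_pos hc0 _),
      ← ENNReal.ofReal_natCast, ← ENNReal.ofReal_mul (by positivity)]
    refine ENNReal.ofReal_le_ofReal ?_
    have h1 := hcard (k + N)
    rw [Finset.card_univ, Fintype.card_subtype]
    have h2 : (c ^ (-((k + N : ℕ) : ℝ))) ^ (d' : ℝ)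
        = c ^ (-(((k + N : ℕ) : ℝ) * d)) * θ ^ (k + N) := by
      rw [hθ, ← Real.rpow_natCast, ← Real.rpow_mul hc0.le, ← Real.rpow_mul hc0.le,
        ← Real.rpow_add hc0]
      congr 1
      ring
    rw [h2, ← mul_assoc]
    exact mul_le_of_le_one_left (by positivity) h1
  have h0 := key.trans hle
  rw [hd'] at h0
  simp at h0

/-- Mass distribution principle for a metric whose closed balls are contained in given cells. -/
theorem le_dimH_of_eventually_cell {X : Type*} [MetricSpace X] {c d : ℝ} (hc : 1 < c)
    (hd : 0 ≤ d) (C : ℕ → X → Set X)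
    (hC : ∀ (n : ℕ) z w, dist z w ≤ c ^ (-(n : ℝ)) → w ∈ C n z) (ρ : OuterMeasure X) {A : Set X}
    (hρ : ρ A ≠ 0)
    (hA : ∀ z ∈ A, ∀ᶠ n : ℕ in atTop, ρ (C n z) ≤ ENNReal.ofReal (c ^ (-(n * d)))) :
    ENNReal.ofReal d ≤ dimH A := by
  borelize X
  have hc0 : 0 < c := one_pos.trans hc
  rcases hd.eq_or_lt with rfl | hd
  · simp
  -- On `B N` the mass bound is uniform from level N on. Subadditivity of the outer measure selects
  -- one N, so no measurability is needed.
  let B : ℕ → Set X := fun N => {z ∈ A | ∀ n : ℕ, N ≤ n → ρ (C n z) ≤ ENNReal.ofReal (c ^ (-(n * d)))}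
  have hAB : A ⊆ ⋃ N, B N := fun z hz => by
    obtain ⟨N, hN⟩ := eventually_atTop.1 (hA z hz)
    exact mem_iUnion.2 ⟨N, hz, hN⟩
  obtain ⟨N, hN⟩ : ∃ N, ρ (B N) ≠ 0 := by
    by_contra! h
    exact hρ (le_antisymm ((measure_mono hAB).trans ((measure_iUnion_le B).trans (by simp [h])))
      zero_le)
  refine le_trans ?_ (dimH_mono (sep_subset A _ : B N ⊆ A))
  lift d to ℝ≥0 using hd.le
  rw [ENNReal.ofReal_coe_nnreal]
  refine le_dimH_of_hausdorffMeasure_ne_zero (ne_of_gt ?_)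
  -- The factor c^(-d) pays for rounding the diameter of a covering set up to the next power of 1/c.
  refine lt_of_lt_of_le (b := ENNReal.ofReal (c ^ (-(d : ℝ))) * ρ (B N)) ?_ ?_
  · exact ENNReal.mul_pos (by simpa using Real.rpow_pos_of_pos hc0 _) hN
  rw [Measure.hausdorffMeasure_apply]
  refine le_iSup₂_of_le (ENNReal.ofReal (c ^ (-(N : ℝ))))
    (ENNReal.ofReal_pos.2 (Real.rpow_pos_of_pos hc0 _)) ?_
  refine le_iInf₂ fun t ht => le_iInf fun htr => ?_
  have hcov : ρ (B N) ≤ ∑' n, ρ (t n ∩ B N) := by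
    refine (measure_mono ?_).trans (measure_iUnion_le _)
    rw [← iUnion_inter]
    exact subset_inter ht subset_rfl
  refine (mul_le_mul_right hcov _).trans ?_
  rw [← ENNReal.tsum_mul_left]
  refine ENNReal.tsum_le_tsum fun k => ?_
  rcases (t k ∩ B N).eq_empty_or_nonempty with he | ⟨z, hzt, hzA, hz⟩
  · simp [he]
  refine le_trans ?_ (le_iSup_of_le ⟨z, hzt⟩ le_rfl)
  have hne : Metric.ediam (t k) ≠ ⊤ := ne_top_of_le_ne_top ENNReal.ofReal_ne_top (htr k)
  have hsub : ∀ n : ℕ, Metric.ediam (t k) ≤ ENNReal.ofReal (c ^ (-(n : ℝ))) → t k ⊆ C n z := by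
    intro n hn w hw
    refine hC n z w ?_
    have h1 := (Metric.edist_le_ediam_of_mem hzt hw).trans hn
    rw [edist_dist] at h1
    exact (ENNReal.ofReal_le_ofReal_iff (by positivity)).1 h1
  have hlow : ∀ n : ℕ, N ≤ n → Metric.ediam (t k) ≤ ENNReal.ofReal (c ^ (-(n : ℝ))) →
      ρ (t k ∩ B N) ≤ ENNReal.ofReal (c ^ (-(n * (d : ℝ)))) := fun n hNn hn =>
    (measure_mono (inter_subset_left.trans (hsub n hn))).trans (hz n hNn)
  have htend : ∀ e : ℝ, 0 < e →
      Tendsto (fun n : ℕ => ENNReal.ofReal (c ^ (-(n * e)))) atTop (𝓝 0) := by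
    intro e he
    rw [← ENNReal.ofReal_zero]
    refine ENNReal.tendsto_ofReal ?_
    have := tendsto_pow_atTop_nhds_zero_of_lt_one (Real.rpow_pos_of_pos hc0 (-e)).le
      (Real.rpow_lt_one_of_one_lt_of_neg hc (by linarith))
    refine this.congr fun n => ?_
    rw [← Real.rpow_natCast, ← Real.rpow_mul hc0.le]
    congr 1
    ring
  -- A set of diameter 0 lies in the cells of all levels, so its mass vanishes because d > 0.
  -- Otherwise `n` is the first level with c^(-n) below the diameter, and level n - 1 is used.
  rcases eq_or_ne (Metric.ediam (t k)) 0 with h0 | h0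
  · have : ρ (t k ∩ B N) ≤ 0 := by
      refine ge_of_tendsto (htend d hd) (eventually_atTop.2 ⟨N, fun n hn => hlow n hn ?_⟩)
      rw [h0]
      exact zero_le
    rw [nonpos_iff_eq_zero.1 this]
    simp
  · have hex : ∃ n : ℕ, ENNReal.ofReal (c ^ (-(n : ℝ))) < Metric.ediam (t k) := by
      have := (htend 1 one_pos).eventually_lt_const (pos_iff_ne_zero.2 h0)
      obtain ⟨n, hn⟩ := this.exists
      exact ⟨n, by simpa using hn⟩
    classical
    set n := Nat.find hex with hn
    have hn1 := Nat.find_spec hex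
    have hNn : N < n := by
      by_contra hle
      refine absurd ((htr k).trans (ENNReal.ofReal_le_ofReal ?_)) (not_le.2 hn1)
      exact Real.rpow_le_rpow_of_exponent_le hc.le (neg_le_neg (Nat.cast_le.2 (not_lt.1 hle)))
    obtain ⟨n', hn'⟩ : ∃ n', n = n' + 1 := Nat.exists_eq_succ_of_ne_zero (by omega)
    have h2 : Metric.ediam (t k) ≤ ENNReal.ofReal (c ^ (-(n' : ℝ))) :=
      not_lt.1 (Nat.find_min hex (by omega))
    refine (mul_le_mul_right (hlow n' (by omega) h2) _).trans ?_
    rw [← hn, hn'] at hn1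
    refine le_trans (le_of_eq ?_) (ENNReal.rpow_le_rpow hn1.le d.coe_nonneg)
    rw [ENNReal.ofReal_rpow_of_pos (Real.rpow_pos_of_pos hc0 _), ← ENNReal.ofReal_mul (by positivity),
      ← Real.rpow_add hc0, ← Real.rpow_mul hc0.le]
    congr 2
    push_cast
    ring

/-! ### Balls of the metric as cells -/

namespace MultCarpet

variable {m₁ m₂ : ℕ}

/-- The cell of `ω`: sequences with the same first `p` letters and the same first `s` second
coordinates. -/
def cell (p s : ℕ) (ω : Symb m₁ m₂) : Set (Symb m₁ m₂) :=
  {w | (∀ r < p, w r = ω r) ∧ ∀ r < s, (w r).2 = (ω r).2}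

/-- The data that determine the cell of a sequence. -/
def lev (p s : ℕ) (ω : Symb m₁ m₂) : (Fin p → Fin m₁ × Fin m₂) × (Fin s → Fin m₂) :=
  (fun r => ω r, fun r => (ω r).2)

theorem lev_eq_iff {p s : ℕ} {w ω : Symb m₁ m₂} : lev p s w = lev p s ω ↔ w ∈ cell p s ω := by
  simp only [lev, Prod.mk.injEq, funext_iff, cell, Set.mem_ofPred_eq]
  exact and_congr ⟨fun h r hr => h ⟨r, hr⟩, fun h r => h r r.2⟩
    ⟨fun h r hr => h ⟨r, hr⟩, fun h r => h r r.2⟩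

theorem cell_eq (p s : ℕ) (ω : Symb m₁ m₂) : cell p s ω = lev p s ⁻¹' {lev p s ω} := by
  ext w
  rw [mem_preimage, mem_singleton_iff, lev_eq_iff]

theorem measurable_lev (p s : ℕ) : Measurable (lev (m₁ := m₁) (m₂ := m₂) p s) :=
  Measurable.prodMk (measurable_pi_lambda _ fun _ => measurable_pi_apply _)
    (measurable_pi_lambda _ fun _ => measurable_snd.comp (measurable_pi_apply _))

theorem measurableSet_cell (p s : ℕ) (ω : Symb m₁ m₂) : MeasurableSet (cell p s ω) := by
  rw [cell_eq]
  exact measurable_lev p s (measurableSet_singleton _)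

theorem cell_anti {p s p' s' : ℕ} (hp : p ≤ p') (hs : s ≤ s') (ω : Symb m₁ m₂) :
    cell p' s' ω ⊆ cell p s ω :=
  fun _ h => ⟨fun r hr => h.1 r (by omega), fun r hr => h.2 r (by omega)⟩

theorem measurable_measure_cell (ρ : Measure (Symb m₁ m₂)) (p s : ℕ) :
    Measurable fun ω : Symb m₁ m₂ => ρ.real (cell p s ω) := by
  have : (fun ω : Symb m₁ m₂ => ρ.real (cell p s ω))
      = (fun b => ρ.real (lev p s ⁻¹' {b})) ∘ lev p s := by
    funext ω
    rw [cell_eq, Function.comp]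
  rw [this]
  exact (measurable_of_finite _).comp (measurable_lev p s)

/-- The number of second coordinates determined by a ball of radius `m₁ ^ (-n)`. -/
noncomputable def ylen (m₁ m₂ n : ℕ) : ℕ := ⌈(n : ℝ) / gam m₁ m₂⌉₊

theorem gam_pos (hm₂ : 2 ≤ m₂) (hm : m₂ < m₁) : 0 < gam m₁ m₂ :=
  div_pos (Real.log_pos (by exact_mod_cast hm₂)) (Real.log_pos (by norm_cast; omega))

theorem seqDist_le_iff {α : Type} {c : ℝ} (hc : 1 < c) (x : ℝ) (u v : ℕ → α) :
    seqDist c u v ≤ c ^ (-x) ↔ ∀ r < ⌈x⌉₊, v r = u r := by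
  have hc0 : 0 < c := one_pos.trans hc
  by_cases h : u = v
  · subst h
    simp only [seqDist_self, implies_true, iff_true]
    positivity
  · simp only [seqDist, h, if_false]
    rw [Real.rpow_le_rpow_left_iff hc, neg_le_neg_iff, ← Nat.ceil_le,
      ← PiNat.mem_cylinder_iff_le_firstDiff h]
    exact ⟨fun h r hr => (h r hr).symm, fun h r hr => (h r hr).symm⟩

/-- Writing m₁^(-n) as (m₁^γ)^(-n/γ) turns the second coordinate condition into agreement of the
first ⌈n/γ⌉ entries. -/
theorem carpetDist_le_iff (hm₂ : 2 ≤ m₂) (hm : m₂ < m₁) (n : ℕ) (z w : Symb m₁ m₂) :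
    carpetDist m₁ m₂ z w ≤ (m₁ : ℝ) ^ (-(n : ℝ)) ↔ w ∈ cell n (ylen m₁ m₂ n) z := by
  have hg := gam_pos hm₂ hm
  have h1 : (1 : ℝ) < m₁ := by norm_cast; omega
  have h2 : (m₁ : ℝ) ^ (-(n : ℝ)) = ((m₁ : ℝ) ^ gam m₁ m₂) ^ (-((n : ℝ) / gam m₁ m₂)) := by
    rw [← Real.rpow_mul (by positivity)]
    congr 1
    field_simp
  rw [carpetDist, max_le_iff, seqDist_le_iff h1, h2, seqDist_le_iff (Real.one_lt_rpow h1 hg),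
    Nat.ceil_natCast]
  rfl

/-- Nothing relates ρ to A except the masses of cells at points of A. This freedom is used with an
auxiliary ρ for a set of full mass for another measure. -/
theorem hdim_le_of_frequently (hm₂ : 2 ≤ m₂) (hm : m₂ < m₁) (ρ : Measure (Symb m₁ m₂))
    [IsProbabilityMeasure ρ] {d : ℝ} {A : Set (Symb m₁ m₂)}
    (hA : ∀ z ∈ A, ∃ᶠ n : ℕ in atTop,
      (m₁ : ℝ) ^ (-(n * d)) ≤ ρ.real (cell n (ylen m₁ m₂ n) z)) :
    hdim A ≤ ENNReal.ofReal d := by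
  let _ : MetricSpace (Symb m₁ m₂) := carpetMetric m₁ m₂
  refine dimH_le_of_frequently_cell (c := (m₁ : ℝ)) (by norm_cast; omega)
    (ι := fun n => (Fin n → Fin m₁ × Fin m₂) × (Fin (ylen m₁ m₂ n) → Fin m₂))
    (fun n b => lev n (ylen m₁ m₂ n) ⁻¹' {b}) ?_
    (fun n b => ρ.real (lev n (ylen m₁ m₂ n) ⁻¹' {b})) (fun _ _ => measureReal_nonneg) ?_ ?_
  · intro n b
    refine Metric.ediam_le fun z hz w hw => ?_
    rw [edist_dist]
    refine ENNReal.ofReal_le_ofReal ((carpetDist_le_iff hm₂ hm n z w).2 (lev_eq_iff.1 ?_))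
    exact hw.trans hz.symm
  · intro n
    have h := sum_measureReal_preimage_singleton (μ := ρ) (f := lev n (ylen m₁ m₂ n))
      (Finset.univ) (fun b _ => measurable_lev _ _ (measurableSet_singleton b))
    rw [h]
    exact measureReal_le_one
  · intro z hz
    refine (hA z hz).mono fun n hn => ⟨lev n (ylen m₁ m₂ n) z, rfl, ?_⟩
    rwa [← cell_eq]

theorem le_hdim_of_eventually (hm₂ : 2 ≤ m₂) (hm : m₂ < m₁) (ρ : Measure (Symb m₁ m₂))
    [IsProbabilityMeasure ρ] {d : ℝ} (hd : 0 ≤ d) {A : Set (Symb m₁ m₂)} (hρA : ρ A ≠ 0)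
    (hA : ∀ z ∈ A, ∀ᶠ n : ℕ in atTop,
      ρ.real (cell n (ylen m₁ m₂ n) z) ≤ (m₁ : ℝ) ^ (-(n * d))) :
    ENNReal.ofReal d ≤ hdim A := by
  let _ : MetricSpace (Symb m₁ m₂) := carpetMetric m₁ m₂
  refine le_dimH_of_eventually_cell (c := (m₁ : ℝ)) (by norm_cast; omega) hd
    (fun (n : ℕ) z => cell n (ylen m₁ m₂ n) z) (fun n z w => (carpetDist_le_iff hm₂ hm n z w).1)
    ρ.toOuterMeasure hρA ?_
  intro z hz
  refine (hA z hz).mono fun n hn => ?_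
  change ρ _ ≤ _
  rw [← ofReal_measureReal]
  exact ENNReal.ofReal_le_ofReal hn

end MultCarpet

/-! ### Words read off from points of Ω, and the vector t -/

namespace MultCarpet

variable {m₁ m₂ q j : ℕ}

/-- The word formed by the first `p` letters of `ω` and the next `l` second coordinates. -/
def pre (p l : ℕ) (ω : Symb m₁ m₂) : Word m₁ m₂ :=
  ((List.range p).map ω, (List.range l).map fun i => (ω (p + i)).2)

@[simp] theorem length_pre_fst (p l : ℕ) (ω : Symb m₁ m₂) : (pre p l ω).1.length = p := by
  simp [pre]

@[simp] theorem length_pre_snd (p l : ℕ) (ω : Symb m₁ m₂) : (pre p l ω).2.length = l := by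
  simp [pre]

theorem mem_cyl_iff {u : Word m₁ m₂} {ω : Symb m₁ m₂} :
    ω ∈ cyl u ↔ pre u.1.length u.2.length ω = u := by
  rw [Prod.ext_iff]
  constructor
  · rintro ⟨h1, h2⟩
    constructor
    · refine List.ext_getElem (by simp) fun i _ hi => ?_
      simpa [pre] using h1 i hi
    · refine List.ext_getElem (by simp) fun i _ hi => ?_
      simpa [pre] using h2 i hi
  · rintro ⟨h1, h2⟩
    constructor
    · intro i hi
      have := List.getElem_of_eq h1.symm hi
      rw [this]
      simp [pre]
    · intro i hi
      have := List.getElem_of_eq h2.symm hi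
      rw [this]
      simp [pre]

theorem mem_cyl_pre_self (p l : ℕ) (ω : Symb m₁ m₂) : ω ∈ cyl (pre p l ω) := by
  rw [mem_cyl_iff, length_pre_fst, length_pre_snd]

theorem cyl_pre (p l : ℕ) (ω : Symb m₁ m₂) : cyl (pre p l ω) = cell p (p + l) ω := by
  ext w
  simp only [cyl, cell, pre, List.length_map, List.length_range, List.getElem_map,
    List.getElem_range, mem_ofPred_eq]
  refine and_congr_right fun h1 => ⟨fun h r hr => ?_, fun h i hi => h _ (by omega)⟩
  rcases lt_or_ge r p with hp | hp
  · rw [h1 r hp]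
  · obtain ⟨i, rfl⟩ := Nat.exists_eq_add_of_le hp
    exact h i (by omega)

theorem pre_mem_Pref (p l : ℕ) {Ω : Set (Symb m₁ m₂)} {ω : Symb m₁ m₂} (hω : ω ∈ Ω) :
    pre p l ω ∈ Pref p l Ω :=
  ⟨length_pre_fst _ _ _, length_pre_snd _ _ _, ω, hω, mem_cyl_pre_self p l ω⟩

theorem exists_of_mem_Pref {p l : ℕ} {Ω : Set (Symb m₁ m₂)} {u : Word m₁ m₂}
    (hu : u ∈ Pref p l Ω) : ∃ ω ∈ Ω, u = pre p l ω := by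
  obtain ⟨h1, h2, ω, hω, hu⟩ := hu
  refine ⟨ω, hω, ?_⟩
  rw [← h1, ← h2, mem_cyl_iff.1 hu]

theorem fillX_pre (p l : ℕ) (ω : Symb m₁ m₂) :
    fillX (pre p (l + 1) ω) (ω p).1 = pre (p + 1) l ω := by
  have h : (List.range (l + 1)).map (fun i => (ω (p + i)).2)
      = (ω p).2 :: (List.range l).map fun i => (ω (p + 1 + i)).2 := by
    simp [List.range_succ_eq_map, Function.comp_def, Nat.add_assoc, Nat.add_comm 1]
  simp only [fillX, pre, h]
  simp [List.range_succ]

theorem pre_append (p l : ℕ) (ω : Symb m₁ m₂) :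
    ((pre p l ω).1, (pre p l ω).2 ++ [(ω (p + l)).2]) = pre p (l + 1) ω := by
  simp [pre, List.range_succ]

theorem fillX_snoc_length (v : Word m₁ m₂) (x : Fin m₁) (y : Fin m₂) :
    (fillX (v.1, v.2 ++ [y]) x).1.length = v.1.length + 1 ∧
      (fillX (v.1, v.2 ++ [y]) x).2.length = v.2.length := by
  obtain ⟨v1, v2⟩ := v
  cases v2 <;> simp [fillX]

theorem xSum_nonneg {Ω : Set (Symb m₁ m₂)} {t : Word m₁ m₂ → ℝ} (ht : ∀ v, 0 ≤ t v)
    (c : Word m₁ m₂) : 0 ≤ xSum j Ω t c :=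
  Finset.sum_nonneg fun _ _ => ht _

theorem xSum_mono {Ω : Set (Symb m₁ m₂)} {s t : Word m₁ m₂ → ℝ} {c : Word m₁ m₂}
    (h : ∀ x, fillX c x ∈ Pref (c.1.length + 1) j Ω → s (fillX c x) ≤ t (fillX c x)) :
    xSum j Ω s c ≤ xSum j Ω t c := by
  classical
  exact Finset.sum_le_sum fun x hx => h x (Finset.mem_filter.1 hx).2

theorem xSum_le {Ω : Set (Symb m₁ m₂)} {t : Word m₁ m₂ → ℝ} (ht : ∀ v, 0 ≤ t v) {M : ℝ}
    (hM : ∀ v, t v ≤ M) (c : Word m₁ m₂) : xSum j Ω t c ≤ m₁ * M := by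
  classical
  calc xSum j Ω t c ≤ ∑ x : Fin m₁, t (fillX c x) :=
        Finset.sum_le_sum_of_subset_of_nonneg (Finset.subset_univ _) fun _ _ _ => ht _
    _ ≤ ∑ _x : Fin m₁, M := Finset.sum_le_sum fun _ _ => hM _
    _ = m₁ * M := by simp

theorem le_xSum {Ω : Set (Symb m₁ m₂)} {t : Word m₁ m₂ → ℝ} (ht : ∀ v, 0 ≤ t v)
    {c : Word m₁ m₂} {x : Fin m₁} (hx : fillX c x ∈ Pref (c.1.length + 1) j Ω) :
    t (fillX c x) ≤ xSum j Ω t c := by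
  classical
  refine Finset.single_le_sum (f := fun x => t (fillX c x)) (fun _ _ => ht _)
    (Finset.mem_filter.2 ⟨Finset.mem_univ x, hx⟩)

theorem one_le_xSum_pre {Ω : Set (Symb m₁ m₂)} {t : Word m₁ m₂ → ℝ} (ht : ∀ v, 1 ≤ t v)
    {ω : Symb m₁ m₂} (hω : ω ∈ Ω) (p : ℕ) : 1 ≤ xSum j Ω t (pre p (j + 1) ω) := by
  refine (ht (fillX (pre p (j + 1) ω) (ω p).1)).trans
    (le_xSum (fun v => zero_le_one.trans (ht v)) ?_)
  rw [fillX_pre, length_pre_fst]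
  exact pre_mem_Pref _ _ hω

/-- The standing assumptions on the parameters. -/
structure Params (m₁ m₂ q j : ℕ) : Prop where
  two_le : 2 ≤ m₂
  lt : m₂ < m₁
  two_le_q : 2 ≤ q
  pow_le : (q : ℝ) ^ j ≤ 1 / gam m₁ m₂
  lt_pow : 1 / gam m₁ m₂ < (q : ℝ) ^ (j + 1)

namespace Params

theorem gam_pos (H : Params m₁ m₂ q j) : 0 < gam m₁ m₂ := MultCarpet.gam_pos H.two_le H.lt

theorem q_pos (H : Params m₁ m₂ q j) : (0 : ℝ) < q := by
  have := H.two_le_q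
  positivity

theorem one_lt_q (H : Params m₁ m₂ q j) : (1 : ℝ) < q := by
  have := H.two_le_q
  norm_cast

theorem a_pos (H : Params m₁ m₂ q j) : 0 < (q : ℝ) ^ j * gam m₁ m₂ :=
  mul_pos (pow_pos H.q_pos _) H.gam_pos

theorem b_pos (H : Params m₁ m₂ q j) : 0 < (q : ℝ) ^ (j + 1) * gam m₁ m₂ :=
  mul_pos (pow_pos H.q_pos _) H.gam_pos

theorem b_eq (q j m₁ m₂ : ℕ) :
    (q : ℝ) ^ (j + 1) * gam m₁ m₂ = q * ((q : ℝ) ^ j * gam m₁ m₂) := by ring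

theorem log_eq (H : Params m₁ m₂ q j) : Real.log m₂ = gam m₁ m₂ * Real.log m₁ := by
  have h1 : Real.log m₁ ≠ 0 := (Real.log_pos (by have := H.two_le; have := H.lt; norm_cast; omega)).ne'
  rw [gam, div_mul_cancel₀ _ h1]

theorem m₁_eq (H : Params m₁ m₂ q j) : (m₁ : ℝ) = (m₂ : ℝ) ^ (1 / gam m₁ m₂) := by
  have h1 : (0 : ℝ) < m₁ := by have := H.two_le; have := H.lt; norm_cast; omega
  have h2 : (0 : ℝ) < m₂ := by have := H.two_le; norm_cast; omega
  rw [Real.rpow_def_of_pos h2, H.log_eq]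
  have := H.gam_pos.ne'
  rw [show gam m₁ m₂ * Real.log m₁ * (1 / gam m₁ m₂) = Real.log m₁ by field_simp, Real.exp_log h1]

end Params

/-- The upper bound for the entries of the vectors. -/
noncomputable def tBound (m₁ m₂ q : ℕ) : ℝ := (m₂ : ℝ) ^ (2 / (gam m₁ m₂ * ((q : ℝ) - 1)))

theorem one_le_tBound (H : Params m₁ m₂ q j) : 1 ≤ tBound m₁ m₂ q := by
  have h2 : (1 : ℝ) ≤ m₂ := by have := H.two_le; norm_cast; omega
  refine Real.one_le_rpow h2 ?_
  have := H.gam_pos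
  have := H.one_lt_q
  have : 0 < (q : ℝ) - 1 := by linarith
  positivity

/-- This makes the constant vector `tBound` a supersolution. As powers of m₂, the exponents compare
as 1 + q^j ≤ 2 q^j after removing the common term 2 q^j/(q - 1). -/
theorem tBound_ineq (H : Params m₁ m₂ q j) :
    (m₂ : ℝ) * (m₁ * tBound m₁ m₂ q) ^ ((q : ℝ) ^ j * gam m₁ m₂)
      ≤ tBound m₁ m₂ q ^ ((q : ℝ) ^ (j + 1) * gam m₁ m₂) := by
  have h2 : (1 : ℝ) < m₂ := by have := H.two_le; norm_cast
  have h20 : (0 : ℝ) < m₂ := by linarith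
  have hg := H.gam_pos
  have hq := H.one_lt_q
  have hq1 : 0 < (q : ℝ) - 1 := by linarith
  have hqj : 1 ≤ (q : ℝ) ^ j := one_le_pow₀ hq.le
  rw [tBound]
  conv_lhs => rw [H.m₁_eq]
  rw [← Real.rpow_add h20, ← Real.rpow_mul h20.le, ← Real.rpow_mul h20.le]
  nth_rewrite 1 [← Real.rpow_one (m₂ : ℝ)]
  rw [← Real.rpow_add h20]
  refine Real.rpow_le_rpow_of_exponent_le h2.le ?_
  have e1 : (1 : ℝ) + (1 / gam m₁ m₂ + 2 / (gam m₁ m₂ * ((q : ℝ) - 1))) * ((q : ℝ) ^ j * gam m₁ m₂)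
      = 1 + (q : ℝ) ^ j + 2 * (q : ℝ) ^ j / ((q : ℝ) - 1) := by field_simp; ring
  have e2 : 2 / (gam m₁ m₂ * ((q : ℝ) - 1)) * ((q : ℝ) ^ (j + 1) * gam m₁ m₂)
      = 2 * (q : ℝ) ^ j + 2 * (q : ℝ) ^ j / ((q : ℝ) - 1) := by field_simp; ring
  rw [e1, e2]
  linarith

/-- `t` takes values in `[1, m₂ ^ (2 / (γ (q - 1)))]` and solves all equations of the system. -/
structure IsSolution (q j : ℕ) (Ω : Set (Symb m₁ m₂)) (t : Word m₁ m₂ → ℝ) : Prop where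
  one_le : ∀ v, 1 ≤ t v
  le_bound : ∀ v, t v ≤ tBound m₁ m₂ q
  eqn : ∀ k, ∀ v ∈ Pref k j Ω, t v ^ ((q : ℝ) ^ (j + 1) * gam m₁ m₂) =
      ∑ y : Fin m₂, xSum j Ω t (v.1, v.2 ++ [y]) ^ ((q : ℝ) ^ j * gam m₁ m₂)

open Classical in
/-- The monotone operator whose fixed points solve the system. -/
noncomputable def treeOp (q j : ℕ) (Ω : Set (Symb m₁ m₂)) (t : Word m₁ m₂ → ℝ) (v : Word m₁ m₂) :
    ℝ :=
  if v ∈ Pref v.1.length j Ω then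
    (∑ y : Fin m₂, xSum j Ω t (v.1, v.2 ++ [y]) ^ ((q : ℝ) ^ j * gam m₁ m₂))
      ^ (1 / ((q : ℝ) ^ (j + 1) * gam m₁ m₂))
  else 1

theorem treeOp_mono (H : Params m₁ m₂ q j) {Ω : Set (Symb m₁ m₂)} {s t : Word m₁ m₂ → ℝ}
    (hs : ∀ v, 0 ≤ s v) (hst : ∀ v, s v ≤ t v) (v : Word m₁ m₂) :
    treeOp q j Ω s v ≤ treeOp q j Ω t v := by
  unfold treeOp
  split_ifs
  · have h : ∀ c, xSum j Ω s c ≤ xSum j Ω t c := fun c => xSum_mono fun x _ => hst _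
    refine Real.rpow_le_rpow (Finset.sum_nonneg fun y _ => ?_) (Finset.sum_le_sum fun y _ => ?_)
      (one_div_nonneg.2 H.b_pos.le)
    · exact Real.rpow_nonneg (xSum_nonneg hs _) _
    · exact Real.rpow_le_rpow (xSum_nonneg hs _) (h _) H.a_pos.le
  · exact le_rfl

theorem one_le_sum_xSum (H : Params m₁ m₂ q j) {Ω : Set (Symb m₁ m₂)} {t : Word m₁ m₂ → ℝ}
    (ht : ∀ v, 1 ≤ t v) {k : ℕ} {v : Word m₁ m₂} (hv : v ∈ Pref k j Ω) :
    1 ≤ ∑ y : Fin m₂, xSum j Ω t (v.1, v.2 ++ [y]) ^ ((q : ℝ) ^ j * gam m₁ m₂) := by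
  obtain ⟨ω, hω, rfl⟩ := exists_of_mem_Pref hv
  have h0 : ∀ v, 0 ≤ t v := fun v => zero_le_one.trans (ht v)
  refine le_trans ?_ (Finset.single_le_sum (f := fun y : Fin m₂ =>
    xSum j Ω t ((pre k j ω).1, (pre k j ω).2 ++ [y]) ^ ((q : ℝ) ^ j * gam m₁ m₂))
    (fun y _ => Real.rpow_nonneg (xSum_nonneg h0 _) _) (Finset.mem_univ (ω (k + j)).2))
  rw [pre_append]
  exact Real.one_le_rpow (one_le_xSum_pre ht hω k) H.a_pos.le

theorem one_le_treeOp (H : Params m₁ m₂ q j) {Ω : Set (Symb m₁ m₂)} {t : Word m₁ m₂ → ℝ}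
    (ht : ∀ v, 1 ≤ t v) (v : Word m₁ m₂) : 1 ≤ treeOp q j Ω t v := by
  unfold treeOp
  split_ifs with hv
  · exact Real.one_le_rpow (one_le_sum_xSum H ht hv) (one_div_nonneg.2 H.b_pos.le)
  · exact le_rfl

theorem treeOp_le (H : Params m₁ m₂ q j) {Ω : Set (Symb m₁ m₂)} {t : Word m₁ m₂ → ℝ}
    (ht : ∀ v, 1 ≤ t v) (ht' : ∀ v, t v ≤ tBound m₁ m₂ q) (v : Word m₁ m₂) :
    treeOp q j Ω t v ≤ tBound m₁ m₂ q := by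
  unfold treeOp
  have h0 : ∀ v, 0 ≤ t v := fun v => zero_le_one.trans (ht v)
  have hM := one_le_tBound H
  split_ifs with hv
  · have hM0 : 0 ≤ tBound m₁ m₂ q := zero_le_one.trans hM
    have h1 : ∑ y : Fin m₂, xSum j Ω t (v.1, v.2 ++ [y]) ^ ((q : ℝ) ^ j * gam m₁ m₂)
        ≤ tBound m₁ m₂ q ^ ((q : ℝ) ^ (j + 1) * gam m₁ m₂) := by
      refine le_trans ?_ (tBound_ineq H)
      refine (Finset.sum_le_sum fun y _ => Real.rpow_le_rpow (xSum_nonneg h0 _)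
        (xSum_le h0 ht' _) H.a_pos.le).trans ?_
      simp
    refine (Real.rpow_le_rpow (Finset.sum_nonneg fun y _ => Real.rpow_nonneg (xSum_nonneg h0 _) _)
      h1 (one_div_nonneg.2 H.b_pos.le)).trans ?_
    rw [one_div, Real.rpow_rpow_inv hM0 H.b_pos.ne']
  · exact hM

/-- Iterating the monotone operator from the constant 1 gives an increasing sequence below `tBound`.
All sums are finite, so the equations pass to the pointwise limit. -/
theorem exists_isSolution (H : Params m₁ m₂ q j) (Ω : Set (Symb m₁ m₂)) :
    ∃ t, IsSolution q j Ω t := by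
  let T : ℕ → Word m₁ m₂ → ℝ := fun n => (treeOp q j Ω)^[n] fun _ => 1
  have hT : ∀ n, T (n + 1) = treeOp q j Ω (T n) := fun n => Function.iterate_succ_apply' _ _ _
  have h1 : ∀ n v, 1 ≤ T n v := by
    intro n
    induction n with
    | zero => exact fun v => le_rfl
    | succ n ih => rw [hT]; exact one_le_treeOp H ih
  have h2 : ∀ n v, T n v ≤ tBound m₁ m₂ q := by
    intro n
    induction n with
    | zero => exact fun v => one_le_tBound H
    | succ n ih => rw [hT]; exact treeOp_le H (h1 n) ih
  have h3 : ∀ n v, T n v ≤ T (n + 1) v := by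
    intro n
    induction n with
    | zero => exact fun v => h1 1 v
    | succ n ih =>
      intro v
      rw [hT (n + 1)]
      conv_lhs => rw [hT n]
      exact treeOp_mono H (fun v => zero_le_one.trans (h1 n v)) ih v
  have hbdd : ∀ v, BddAbove (range fun n => T n v) := fun v =>
    ⟨tBound m₁ m₂ q, by rintro _ ⟨n, rfl⟩; exact h2 n v⟩
  have hlim : ∀ v, Tendsto (fun n => T n v) atTop (𝓝 (⨆ n, T n v)) := fun v =>
    tendsto_atTop_ciSup (monotone_nat_of_le_succ fun n => h3 n v) (hbdd v)
  refine ⟨fun v => ⨆ n, T n v, ⟨fun v => (h1 0 v).trans (le_ciSup (hbdd v) 0),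
    fun v => ciSup_le fun n => h2 n v, fun k v hv => ?_⟩⟩
  have hb := H.b_pos
  have hsum : Tendsto (fun n => ∑ y : Fin m₂,
      xSum j Ω (T n) (v.1, v.2 ++ [y]) ^ ((q : ℝ) ^ j * gam m₁ m₂)) atTop
      (𝓝 (∑ y : Fin m₂, xSum j Ω (fun v => ⨆ n, T n v) (v.1, v.2 ++ [y])
        ^ ((q : ℝ) ^ j * gam m₁ m₂))) := by
    refine tendsto_finsetSum _ fun y _ => Tendsto.rpow_const ?_ (Or.inr H.a_pos.le)
    unfold xSum
    exact tendsto_finsetSum _ fun x _ => hlim _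
  refine tendsto_nhds_unique (((hlim v).comp (tendsto_add_atTop_nat 1)).rpow_const
    (Or.inr hb.le)) (hsum.congr fun n => ?_)
  have hvk : v ∈ Pref v.1.length j Ω := hv.1.symm ▸ hv
  have h0 : 0 ≤ ∑ y : Fin m₂, xSum j Ω (T n) (v.1, v.2 ++ [y]) ^ ((q : ℝ) ^ j * gam m₁ m₂) :=
    Finset.sum_nonneg fun y _ => Real.rpow_nonneg
      (xSum_nonneg (fun v => zero_le_one.trans (h1 n v)) _) _
  simp only [Function.comp, hT, treeOp, hvk, if_true]
  rw [one_div, Real.rpow_inv_rpow h0 hb.ne']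

theorem mem_Pref_of_mem_treeVertices {Ω : Set (Symb m₁ m₂)} {k : ℕ} {u v : Word m₁ m₂}
    (hu : u ∈ Pref k j Ω) (hv : v ∈ treeVertices j Ω u) : v ∈ Pref v.1.length j Ω := by
  rcases Relation.ReflTransGen.cases_tail hv with h | ⟨w, _, h⟩
  · rw [h, hu.1]
    exact hu
  · exact h.2.1

theorem IsSolution.isTreeVector {Ω : Set (Symb m₁ m₂)} {t : Word m₁ m₂ → ℝ}
    (ht : IsSolution q j Ω t) {u : Word m₁ m₂} (hu : u ∈ Pref 1 j Ω) : IsTreeVector q j Ω u t :=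
  ⟨fun v _ => ⟨ht.one_le v, ht.le_bound v⟩,
    fun v hv => ht.eqn _ v (mem_Pref_of_mem_treeVertices hu hv)⟩

/-- The right side of the system is homogeneous of degree q^j γ and the left side of degree q^(j+1)
γ. A bound on ratios therefore improves by the exponent 1/q. -/
theorem IsTreeVector.le_rpow_mul (H : Params m₁ m₂ q j) {Ω : Set (Symb m₁ m₂)}
    {s t : Word m₁ m₂ → ℝ} {u : Word m₁ m₂} (hu : u ∈ Pref 1 j Ω) (hs : IsTreeVector q j Ω u s)
    (ht : IsTreeVector q j Ω u t) {C : ℝ} (hC : 0 ≤ C)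
    (h : ∀ v ∈ treeVertices j Ω u, s v ≤ C * t v) :
    ∀ v ∈ treeVertices j Ω u, s v ≤ C ^ (1 / (q : ℝ)) * t v := by
  intro v hv
  have hb := H.b_pos
  have hs0 : 0 ≤ s v := zero_le_one.trans (hs.mem_Icc v hv).1
  have ht0 : 0 ≤ t v := zero_le_one.trans (ht.mem_Icc v hv).1
  -- The entries on the right of the equation at v are indexed by followers of v, so comparison on
  -- the tree of u suffices.
  have hmem : ∀ y x, fillX (v.1, v.2 ++ [y]) x ∈ Pref (v.1.length + 1) j Ω →
      fillX (v.1, v.2 ++ [y]) x ∈ treeVertices j Ω u := fun y x hx =>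
    Relation.ReflTransGen.tail hv ⟨mem_Pref_of_mem_treeVertices hu hv,
      (fillX_snoc_length v x y).1.symm ▸ hx, x, y, rfl⟩
  have hxs : ∀ {r : Word m₁ m₂ → ℝ}, IsTreeVector q j Ω u r → ∀ y,
      0 ≤ xSum j Ω r (v.1, v.2 ++ [y]) := by
    classical
    intro r hr y
    exact Finset.sum_nonneg fun x hx =>
      zero_le_one.trans (hr.mem_Icc _ (hmem y x (Finset.mem_filter.1 hx).2)).1
  have hle : ∀ y, xSum j Ω s (v.1, v.2 ++ [y]) ≤ C * xSum j Ω t (v.1, v.2 ++ [y]) := by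
    classical
    intro y
    unfold xSum
    rw [Finset.mul_sum]
    exact Finset.sum_le_sum fun x hx => h _ (hmem y x (Finset.mem_filter.1 hx).2)
  have key : s v ^ ((q : ℝ) ^ (j + 1) * gam m₁ m₂)
      ≤ (C ^ (1 / (q : ℝ)) * t v) ^ ((q : ℝ) ^ (j + 1) * gam m₁ m₂) := by
    rw [hs.eqn v hv, Real.mul_rpow (Real.rpow_nonneg hC _) ht0, ht.eqn v hv, ← Real.rpow_mul hC,
      Params.b_eq, show 1 / (q : ℝ) * (q * ((q : ℝ) ^ j * gam m₁ m₂)) = (q : ℝ) ^ j * gam m₁ m₂ by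
        have := H.q_pos.ne'; field_simp, Finset.mul_sum]
    refine Finset.sum_le_sum fun y _ => ?_
    rw [← Real.mul_rpow hC (hxs ht y)]
    exact Real.rpow_le_rpow (hxs hs y) (hle y) H.a_pos.le
  exact (Real.rpow_le_rpow_iff hs0 (mul_nonneg (Real.rpow_nonneg hC _) ht0) hb).1 key

/-- The ratio is at most `tBound` since all entries lie between 1 and `tBound`; repeated contraction
sends the exponent (1/q)^n to 0. -/
theorem IsTreeVector.le_of_isTreeVector (H : Params m₁ m₂ q j) {Ω : Set (Symb m₁ m₂)}
    {s t : Word m₁ m₂ → ℝ} {u : Word m₁ m₂} (hu : u ∈ Pref 1 j Ω) (hs : IsTreeVector q j Ω u s)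
    (ht : IsTreeVector q j Ω u t) : ∀ v ∈ treeVertices j Ω u, s v ≤ t v := by
  have hM := one_le_tBound H
  have hM0 : 0 < tBound m₁ m₂ q := one_pos.trans_le hM
  have h : ∀ n : ℕ, ∀ v ∈ treeVertices j Ω u,
      s v ≤ tBound m₁ m₂ q ^ ((1 / (q : ℝ)) ^ n) * t v := by
    intro n
    induction n with
    | zero =>
      intro v hv
      rw [pow_zero, Real.rpow_one]
      refine (hs.mem_Icc v hv).2.trans ?_
      exact le_mul_of_one_le_right hM0.le (ht.mem_Icc v hv).1
    | succ n ih =>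
      rw [pow_succ, Real.rpow_mul hM0.le]
      exact IsTreeVector.le_rpow_mul H hu hs ht (Real.rpow_nonneg hM0.le _) ih
  intro v hv
  have hq := H.one_lt_q
  have h1 : Tendsto (fun n : ℕ => (1 / (q : ℝ)) ^ n) atTop (𝓝 0) :=
    tendsto_pow_atTop_nhds_zero_of_lt_one (by positivity)
      (by rw [one_div]; exact inv_lt_one_of_one_lt₀ hq)
  have h2 := ((tendsto_const_nhds (x := tBound m₁ m₂ q)).rpow h1 (Or.inl hM0.ne')).mul_const (t v)
  rw [Real.rpow_zero, one_mul] at h2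
  exact ge_of_tendsto' h2 fun n => h n v hv

theorem nested_nonneg {Ω : Set (Symb m₁ m₂)} {t : Word m₁ m₂ → ℝ} (ht : ∀ v, 0 ≤ t v) (p : ℕ)
    (w : List (Fin m₂)) : 0 ≤ nested q j Ω t p w := by
  induction p generalizing w with
  | zero => exact Finset.sum_nonneg fun y _ => Real.rpow_nonneg (xSum_nonneg ht _) _
  | succ p ih => exact Finset.sum_nonneg fun y _ => Real.rpow_nonneg (ih _) _

/-- At each of the nested sums it is enough to keep the summand belonging to the coordinates of ω.
-/
theorem one_le_nested_pre (H : Params m₁ m₂ q j) {Ω : Set (Symb m₁ m₂)} {t : Word m₁ m₂ → ℝ}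
    (ht : ∀ v, 1 ≤ t v) {ω : Symb m₁ m₂} (hω : ω ∈ Ω) (p s : ℕ) (h : p + s = j) :
    1 ≤ nested q j Ω t p (pre 0 s ω).2 := by
  have h0 : ∀ v, 0 ≤ t v := fun v => zero_le_one.trans (ht v)
  induction p generalizing s with
  | zero =>
    rw [zero_add] at h
    subst h
    exact one_le_sum_xSum H ht (pre_mem_Pref 0 s hω)
  | succ p ih =>
    refine le_trans ?_ (Finset.single_le_sum (f := fun y : Fin m₂ =>
      nested q j Ω t p ((pre 0 s ω).2 ++ [y]) ^ (1 / (q : ℝ)))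
      (fun y _ => Real.rpow_nonneg (nested_nonneg h0 _ _) _) (Finset.mem_univ (ω (0 + s)).2))
    have := congrArg Prod.snd (pre_append 0 s ω)
    rw [show (pre 0 s ω).2 ++ [(ω (0 + s)).2] = (pre 0 (s + 1) ω).2 from this]
    exact Real.one_le_rpow (ih (s + 1) (by omega)) (one_div_nonneg.2 H.q_pos.le)

theorem exists_nested_le (H : Params m₁ m₂ q j) {Ω : Set (Symb m₁ m₂)} {t : Word m₁ m₂ → ℝ}
    (ht : IsSolution q j Ω t) :
    ∃ K : ℝ, ∀ p ≤ j, ∀ w, nested q j Ω t p w ≤ K := by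
  have h0 : ∀ v, 0 ≤ t v := fun v => zero_le_one.trans (ht.one_le v)
  have h : ∀ p, ∃ K : ℝ, ∀ w, nested q j Ω t p w ≤ K := by
    intro p
    induction p with
    | zero =>
      refine ⟨∑ _y : Fin m₂, (m₁ * tBound m₁ m₂ q) ^ ((q : ℝ) ^ j * gam m₁ m₂), fun w => ?_⟩
      exact Finset.sum_le_sum fun y _ => Real.rpow_le_rpow (xSum_nonneg h0 _)
        (xSum_le h0 ht.le_bound _) H.a_pos.le
    | succ p ih =>
      obtain ⟨K, hK⟩ := ih
      refine ⟨∑ _y : Fin m₂, K ^ (1 / (q : ℝ)), fun w => ?_⟩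
      exact Finset.sum_le_sum fun y _ => Real.rpow_le_rpow (nested_nonneg h0 _ _) (hK _)
        (one_div_nonneg.2 H.q_pos.le)
  choose K hK using h
  obtain ⟨B, hB⟩ := ((Finset.range (j + 1)).image K).bddAbove
  refine ⟨B, fun p hp w => (hK p w).trans (hB ?_)⟩
  exact Finset.mem_coe.2 (Finset.mem_image_of_mem K (Finset.mem_range.2 (by omega)))

theorem one_le_tRoot (H : Params m₁ m₂ q j) {Ω : Set (Symb m₁ m₂)} {t : Word m₁ m₂ → ℝ}
    (ht : ∀ v, 1 ≤ t v) (hne : Ω.Nonempty) : 1 ≤ tRoot q j Ω t := by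
  obtain ⟨ω, hω⟩ := hne
  exact one_le_nested_pre H ht hω j 0 (by omega)

end MultCarpet

/-! ### Measures on the boundary of a tree -/

section TreeMeasure

variable {α : Type*}

/-- The list of choices made along the branch given by a choice of a letter at every node. -/
def branch (ω : List α → α) : ℕ → List α
  | 0 => []
  | n + 1 => branch ω n ++ [ω (branch ω n)]

/-- Following l depends only on the choices at the proper prefixes of l, so the event becomes a box
in the independent choices. -/
theorem branch_forall_iff (ω : List α → α) (l : List α) :
    (∀ i < l.length, l[i]? = some (ω (branch ω i))) ↔
      ∀ i < l.length, l[i]? = some (ω (l.take i)) := by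
  have key : ∀ n ≤ l.length, ((∀ i < n, l[i]? = some (ω (branch ω i))) ∨
      ∀ i < n, l[i]? = some (ω (l.take i))) → branch ω n = l.take n := by
    intro n
    induction n with
    | zero => simp [branch]
    | succ n ih =>
      intro hn h
      have h1 : branch ω n = l.take n := ih (by omega)
        (h.imp (fun h i hi => h i (by omega)) fun h i hi => h i (by omega))
      have h2 : l[n]? = some (ω (l.take n)) := by
        rcases h with h | h
        · rw [← h1]; exact h n (by omega)
        · exact h n (by omega)
      rw [branch, h1, List.take_add_one, h2]
      rfl
  constructor
  · intro h i hi
    rw [← key i hi.le (Or.inl fun i' hi' => h i' (by omega))]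
    exact h i hi
  · intro h i hi
    rw [key i hi.le (Or.inr fun i' hi' => h i' (by omega))]
    exact h i hi

variable [Fintype α] [MeasurableSpace α] [MeasurableSingletonClass α]

theorem measurable_branch_choice (n : ℕ) : Measurable fun ω : List α → α => ω (branch ω n) := by
  have hset : ∀ (l : List α) (s : Set α), MeasurableSet {ω : List α → α | ω l ∈ s} := fun l s =>
    measurable_pi_apply l s.toFinite.measurableSet
  have hb : ∀ n (l : List α), MeasurableSet {ω : List α → α | branch ω n = l} := by
    intro n
    induction n with
    | zero => exact fun l => MeasurableSet.const ([] = l)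
    | succ n ih =>
      intro l
      have : {ω : List α → α | branch ω (n + 1) = l} =
          ⋃ l' : List α, {ω | branch ω n = l'} ∩ {ω | ω l' ∈ {a | l' ++ [a] = l}} := by
        ext ω
        simp [branch]
      rw [this]
      exact MeasurableSet.iUnion fun l' => (ih l').inter (hset l' _)
  refine measurable_to_countable' fun a => ?_
  have : (fun ω : List α → α => ω (branch ω n)) ⁻¹' {a} =
      ⋃ l' : List α, {ω | branch ω n = l'} ∩ {ω | ω l' ∈ ({a} : Set α)} := by
    ext ω
    simp
  rw [this]
  exact MeasurableSet.iUnion fun l' => (hb n l').inter (hset l' _)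

/-- A consistent family of masses of the nodes of a regular tree extends to a probability measure
on the boundary of the tree. -/
theorem exists_measure_of_consistent [Nonempty α] (π : List α → ℝ) (h1 : π [] = 1)
    (h0 : ∀ l, 0 ≤ π l) (hsum : ∀ l, ∑ a, π (l ++ [a]) = π l) :
    ∃ P : Measure (ℕ → α), IsProbabilityMeasure P ∧
      ∀ l : List α, P {z | ∀ i < l.length, l[i]? = some (z i)} = ENNReal.ofReal (π l) := by
  classical
  have hκ : ∀ l, ∃ κ : Measure α, IsProbabilityMeasure κ ∧
      ∀ a, ENNReal.ofReal (π l) * κ {a} = ENNReal.ofReal (π (l ++ [a])) := by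
    intro l
    rcases (h0 l).eq_or_lt with h | h
    -- Below a node of mass 0 every descendant has mass 0, so any transition law serves.
    · refine ⟨Measure.dirac (Classical.arbitrary α), inferInstance, fun a => ?_⟩
      have : π (l ++ [a]) = 0 :=
        (Finset.sum_eq_zero_iff_of_nonneg fun a _ => h0 (l ++ [a])).1 ((hsum l).trans h.symm) a
          (Finset.mem_univ a)
      simp [← h, this]
    · refine ⟨(PMF.ofFintype (fun a => ENNReal.ofReal (π (l ++ [a]) / π l)) ?_).toMeasure,
        inferInstance, fun a => ?_⟩
      · rw [← ENNReal.ofReal_sum_of_nonneg fun a _ => div_nonneg (h0 _) (h0 _), ← Finset.sum_div,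
          hsum, div_self h.ne', ENNReal.ofReal_one]
      · rw [PMF.toMeasure_apply_singleton _ _ (measurableSet_singleton a), PMF.ofFintype_apply,
          ← ENNReal.ofReal_mul (h0 l), mul_div_cancel₀ _ h.ne']
  choose κ hκp hκ using hκ
  have hZ : Measurable fun (ω : List α → α) (n : ℕ) => ω (branch ω n) :=
    measurable_pi_lambda _ measurable_branch_choice
  refine ⟨(Measure.infinitePi κ).map fun ω n => ω (branch ω n),
    Measure.isProbabilityMeasure_map hZ.aemeasurable, fun l => ?_⟩
  have hmeas : MeasurableSet {z : ℕ → α | ∀ i < l.length, l[i]? = some (z i)} := by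
    have : {z : ℕ → α | ∀ i < l.length, l[i]? = some (z i)} =
        ⋂ i : ℕ, ⋂ _ : i < l.length, (fun z : ℕ → α => z i) ⁻¹' {a | l[i]? = some a} := by
      ext z
      simp
    rw [this]
    exact MeasurableSet.iInter fun i => MeasurableSet.iInter fun _ =>
      measurable_pi_apply i (Set.toFinite _).measurableSet
  rw [Measure.map_apply hZ hmeas]
  have hbox : (fun (ω : List α → α) (n : ℕ) => ω (branch ω n)) ⁻¹'
      {z | ∀ i < l.length, l[i]? = some (z i)} =
      Set.pi ((Finset.range l.length).image l.take) fun s => {a | l[s.length]? = some a} := by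
    ext ω
    rw [mem_preimage, mem_ofPred_eq, branch_forall_iff]
    simp only [Set.mem_pi, Finset.coe_image, Finset.coe_range, mem_image, mem_Iio,
      forall_exists_index, and_imp, forall_apply_eq_imp_iff₂, mem_ofPred_eq, List.length_take]
    refine forall₂_congr fun i hi => ?_
    rw [min_eq_left hi.le]
  rw [hbox, Measure.infinitePi_pi _ fun _ _ => (Set.toFinite _).measurableSet,
    Finset.prod_image ?_]
  · have hprod : ∏ i ∈ Finset.range l.length, κ (l.take i) {a | l[(l.take i).length]? = some a} =
        ∏ i ∈ Finset.range l.length, κ (l.take i) {a | l[i]? = some a} := by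
      refine Finset.prod_congr rfl fun i hi => ?_
      rw [List.length_take, min_eq_left (Finset.mem_range.1 hi).le]
    rw [hprod]
    clear hprod hbox hmeas
    induction l using List.reverseRecOn with
    | nil => simp [h1]
    | append_singleton l a ih =>
      rw [List.length_append, List.length_singleton, Finset.prod_range_succ, ← hκ]
      congr 1
      · rw [← ih]
        refine Finset.prod_congr rfl fun i hi => ?_
        have hi' := Finset.mem_range.1 hi
        rw [List.take_append_of_le_length hi'.le, List.getElem?_append_left hi']
      · rw [List.take_left]
        congr 1
        ext b
        simp [eq_comm]
  -- Different proper prefixes are different nodes because they have different lengths; hence the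
  -- product over nodes is a product over lengths.
  · intro i hi i' hi' h
    have := congrArg List.length h
    simp only [List.length_take, Finset.coe_range, mem_Iio] at this hi hi'
    omega

end TreeMeasure

/-! ### From consistent masses of words to the measure μ -/

namespace MultCarpet

variable {m₁ m₂ q j : ℕ}

/-- One step of the chain of words: first the second coordinates `y_1, …, y_j` are added, then in
each step a second coordinate and a first coordinate. -/
def wordStep (j : ℕ) (u : Word m₁ m₂) (a : Fin m₁ × Fin m₂) : Word m₁ m₂ :=
  if u.2.length < j then (u.1, u.2 ++ [a.2]) else fillX (u.1, u.2 ++ [a.2]) a.1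

theorem length_foldl_wordStep (l : List (Fin m₁ × Fin m₂)) :
    (l.foldl (wordStep j) ([], [])).2.length = min l.length j ∧
      (l.foldl (wordStep j) ([], [])).1.length = l.length - j := by
  induction l using List.reverseRecOn with
  | nil => simp
  | append_singleton l a ih =>
    rw [List.foldl_append, List.foldl_cons, List.foldl_nil, wordStep]
    split_ifs with h
    · simp only [List.length_append, List.length_singleton]
      omega
    · rw [(fillX_snoc_length _ _ _).1, (fillX_snoc_length _ _ _).2, List.length_append,
        List.length_singleton]
      omega

/-- The letters that lead to the words `pre k j z`; the first coordinates of the first `j` letters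
are irrelevant, and chosen to be `x₀`. -/
def chainLetters (j : ℕ) (x₀ : Fin m₁) (z : Symb m₁ m₂) (n : ℕ) : List (Fin m₁ × Fin m₂) :=
  (List.range n).map fun i => (if i < j then x₀ else (z (i - j)).1, (z i).2)

theorem foldl_chainLetters (x₀ : Fin m₁) (z : Symb m₁ m₂) (n : ℕ) :
    (chainLetters j x₀ z n).foldl (wordStep j) ([], []) = pre (n - j) (min n j) z := by
  induction n with
  | zero => simp [chainLetters, pre]
  | succ n ih =>
    have : chainLetters j x₀ z (n + 1) = chainLetters j x₀ z n ++
        [(if n < j then x₀ else (z (n - j)).1, (z n).2)] := by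
      simp [chainLetters, List.range_succ]
    rw [this, List.foldl_append, ih, List.foldl_cons, List.foldl_nil, wordStep, length_pre_snd]
    rcases lt_or_ge n j with h | h
    · rw [min_eq_left h.le, min_eq_left (by omega), Nat.sub_eq_zero_of_le h.le,
        Nat.sub_eq_zero_of_le (by omega), if_pos h, ← pre_append, zero_add]
    · rw [min_eq_right h, min_eq_right (by omega), if_neg (lt_irrefl _), if_neg (not_lt.2 h)]
      have h2 := pre_append (n - j) j z
      rw [Nat.sub_add_cancel h] at h2
      rw [h2, fillX_pre, Nat.sub_add_comm h]

/-- A consistent family of masses of the words `(x_1,y_1) ⋯ (x_k,y_k) y_{k+1} ⋯ y_{k+j}` extends to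
a probability measure. -/
theorem exists_measure_cyl_pre [Nonempty (Symb m₁ m₂)] (M : Word m₁ m₂ → ℝ)
    (h1 : M ([], []) = 1) (h0 : ∀ u, 0 ≤ M u)
    (hy : ∀ w : List (Fin m₂), w.length < j → ∑ y, M ([], w ++ [y]) = M ([], w))
    (hxy : ∀ u : Word m₁ m₂, u.2.length = j →
      ∑ y, ∑ x, M (fillX (u.1, u.2 ++ [y]) x) = M u) :
    ∃ μ : Measure (Symb m₁ m₂), IsProbabilityMeasure μ ∧
      ∀ k z, μ (cyl (pre k j z)) = ENNReal.ofReal (M (pre k j z)) := by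
  classical
  obtain ⟨z₀⟩ := ‹Nonempty (Symb m₁ m₂)›
  have : Nonempty (Fin m₁ × Fin m₂) := ⟨z₀ 0⟩
  set x₀ := (z₀ 0).1
  -- The tree has pairs as letters, but its first j steps only add second coordinates. The
  -- superfluous first coordinates are pinned to `x₀`, so the regular tree theorem applies without
  -- overcounting.
  let good : List (Fin m₁ × Fin m₂) → Prop := fun l => ∀ i < j, ∀ a, l[i]? = some a → a.1 = x₀
  let π : List (Fin m₁ × Fin m₂) → ℝ :=
    fun l => if good l then M (l.foldl (wordStep j) ([], [])) else 0
  have hsum : ∀ l, ∑ a, π (l ++ [a]) = π l := by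
    intro l
    obtain ⟨hl2, hl1⟩ := length_foldl_wordStep (j := j) l
    simp only [π, List.foldl_append, List.foldl_cons, List.foldl_nil]
    rcases lt_or_ge l.length j with h | h
    · have hg : ∀ a, good (l ++ [a]) ↔ good l ∧ a.1 = x₀ := by
        intro a
        constructor
        · intro hg
          refine ⟨fun i hi b hb => hg i hi b ?_, hg l.length h a (by simp)⟩
          rw [List.getElem?_append_left (List.getElem?_eq_some_iff.1 hb).1]
          exact hb
        · rintro ⟨hg, ha⟩ i hi b hb
          rw [List.getElem?_append] at hb
          split_ifs at hb with h'
          · exact hg i hi b hb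
          · rw [List.getElem?_singleton] at hb
            split_ifs at hb
            rw [← Option.some.inj hb, ha]
      simp only [hg]
      by_cases hgl : good l
      · simp only [hgl, true_and, if_true]
        set u := l.foldl (wordStep j) ([], []) with hu
        have hu1 : u.1 = [] := List.eq_nil_of_length_eq_zero (by omega)
        have hu' : u = ([], u.2) := Prod.ext hu1 rfl
        have hlt : u.2.length < j := by omega
        rw [Fintype.sum_prod_type, Finset.sum_eq_single x₀]
        · simp only [if_true, wordStep, hlt, hu1]
          rw [hy _ hlt, ← hu']
        · intro x _ hx
          simp [hx]
        · simp
      · simp [hgl]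
    · have hg : ∀ a, good (l ++ [a]) ↔ good l := by
        intro a
        refine forall₂_congr fun i hi => ?_
        rw [List.getElem?_append_left (by omega)]
      simp only [hg]
      split_ifs
      · set u := l.foldl (wordStep j) ([], []) with hu
        have hlt : u.2.length = j := by omega
        rw [Fintype.sum_prod_type_right, ← hxy u hlt]
        simp only [wordStep, hlt, lt_irrefl, if_false]
      · simp
  obtain ⟨P, hP, hPl⟩ := exists_measure_of_consistent π (by simp [π, good, h1])
    (fun l => by simp only [π]; split_ifs; exacts [h0 _, le_rfl]) hsum
  -- First coordinates are generated j steps later than second coordinates; `Θ` undoes the delay.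
  let Θ : (ℕ → Fin m₁ × Fin m₂) → Symb m₁ m₂ := fun ζ k => ((ζ (k + j)).1, (ζ k).2)
  have hΘ : Measurable Θ := measurable_pi_lambda _ fun k =>
    (measurable_fst.comp (measurable_pi_apply _)).prodMk
      (measurable_snd.comp (measurable_pi_apply _))
  refine ⟨P.map Θ, Measure.isProbabilityMeasure_map hΘ.aemeasurable, fun k z => ?_⟩
  have hnull : P {ζ | ∃ i < j, (ζ i).1 ≠ x₀} = 0 := by
    have hsub : {ζ : ℕ → Fin m₁ × Fin m₂ | ∃ i < j, (ζ i).1 ≠ x₀} ⊆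
        ⋃ l : {l // π l = 0}, {ζ | ∀ i < l.1.length, l.1[i]? = some (ζ i)} := by
      rintro ζ ⟨i, hi, hζ⟩
      refine mem_iUnion.2 ⟨⟨(List.range j).map ζ, if_neg fun h => hζ ?_⟩, ?_⟩
      · exact h i hi _ (by simp [hi])
      · intro i' hi'
        simp only [List.length_map, List.length_range] at hi'
        simp [hi']
    refine measure_mono_null hsub (measure_iUnion_null fun l => ?_)
    rw [hPl, l.2, ENNReal.ofReal_zero]
  have hgood : good (chainLetters j x₀ z (k + j)) := by
    intro i hi a ha
    have hi' : i < k + j := by omega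
    simp only [chainLetters, List.getElem?_map, List.getElem?_range hi', Option.map_some, hi,
      if_true, Option.some.injEq] at ha
    rw [← ha]
  have hπ : π (chainLetters j x₀ z (k + j)) = M (pre k j z) := by
    simp only [π, hgood, if_true, foldl_chainLetters]
    rw [Nat.add_sub_cancel, min_eq_right (by omega)]
  have hmem : ∀ ζ : ℕ → Fin m₁ × Fin m₂, (∀ i < (chainLetters j x₀ z (k + j)).length,
      (chainLetters j x₀ z (k + j))[i]? = some (ζ i)) ↔
      ∀ i < k + j, (if i < j then x₀ else (z (i - j)).1, (z i).2) = ζ i := by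
    intro ζ
    simp only [chainLetters, List.length_map, List.length_range]
    refine forall₂_congr fun i hi => ?_
    simp [List.getElem?_range hi]
  rw [cyl_pre, Measure.map_apply hΘ (measurableSet_cell _ _ _), ← hπ, ← hPl]
  refine le_antisymm ?_ (measure_mono ?_)
  · rw [← add_zero (P {ζ | _}), ← hnull]
    refine (measure_mono ?_).trans (measure_union_le _ _)
    intro ζ hζ
    by_cases hbad : ∃ i < j, (ζ i).1 ≠ x₀
    · exact Or.inr hbad
    · push Not at hbad
      refine Or.inl ((hmem ζ).2 fun i hi => Prod.ext ?_ (hζ.2 i hi).symm)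
      dsimp only
      split_ifs with hij
      · exact (hbad i hij).symm
      · have := congrArg Prod.fst (hζ.1 (i - j) (by omega))
        simp only [Θ, Nat.sub_add_cancel (not_lt.1 hij)] at this
        exact this.symm
  · intro ζ hζ
    have h := (hmem ζ).1 hζ
    have h2 : ∀ i < k + j, (ζ i).2 = (z i).2 := fun i hi => by rw [← h i hi]
    refine ⟨fun r hr => Prod.ext ?_ (h2 r (by omega)), h2⟩
    simp only [Θ, ← h (r + j) (by omega)]
    simp

/-- Realizing a word and its next letters by a single sequence reduces identities about words to
identities about `pre`. The point `z₀` only provides a default letter. -/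
theorem exists_pre (z₀ : Symb m₁ m₂) (v : Word m₁ m₂) (y : Fin m₂) (x : Fin m₁) :
    ∃ z, v = pre v.1.length v.2.length z ∧ (z (v.1.length + v.2.length)).2 = y ∧
      (z v.1.length).1 = x := by
  refine ⟨fun i => if h : i < v.1.length then v.1[i] else
    (x, ((v.2 ++ [y])[i - v.1.length]?).getD (z₀ 0).2), ?_, ?_, ?_⟩
  · symm
    rw [← mem_cyl_iff]
    constructor
    · intro i hi
      simp [hi]
    · intro i hi
      simp [List.getElem?_append_left hi, List.getElem?_eq_getElem hi]
  · simp
  · simp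

theorem fillX_snoc_pre (k l : ℕ) (z : Symb m₁ m₂) :
    fillX ((pre k l z).1, (pre k l z).2 ++ [(z (k + l)).2]) (z k).1 = pre (k + 1) l z := by
  rw [pre_append, fillX_pre]

theorem ys_pre (k l : ℕ) (z : Symb m₁ m₂) : ys (pre k l z) = (pre 0 (k + l) z).2 := by
  simp [ys, pre, List.range_add, Function.comp_def]

theorem take_pre_snd {s l : ℕ} (h : s ≤ l) (p : ℕ) (z : Symb m₁ m₂) :
    (pre p l z).2.take s = (pre p s z).2 := by
  simp [pre, ← List.map_take, List.take_range, h]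

theorem trunc_pre {p l k i : ℕ} (hp : p ≤ k) (hl : p + l ≤ k + i) (z : Symb m₁ m₂) :
    trunc p l (pre k i z) = pre p l z := by
  refine Prod.ext ?_ ?_
  · simp [trunc, pre, ← List.map_take, List.take_range, hp]
  · simp only [trunc, ys_pre]
    refine List.ext_getElem (by simp; omega) fun i h1 h2 => ?_
    simp [pre]

/-- The mass of `y_1 ⋯ y_s`, `s ≤ j`. -/
noncomputable def yMass (q j : ℕ) (Ω : Set (Symb m₁ m₂)) (t : Word m₁ m₂ → ℝ)
    (w : List (Fin m₂)) : ℝ :=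
  nested q j Ω t (j - w.length) w * (∏ i ∈ Finset.range w.length,
    nested q j Ω t (j - (i + 1)) (w.take (i + 1)) ^ ((1 - (q : ℝ)) / q)) / tRoot q j Ω t

open Classical in
/-- The mass of the words `(x_1,y_1) ⋯ (x_k,y_k) y_{k+1} ⋯ y_{k+j}`, `k ≥ 0`. -/
noncomputable def mass (q j : ℕ) (Ω : Set (Symb m₁ m₂)) (t : Word m₁ m₂ → ℝ)
    (u : Word m₁ m₂) : ℝ :=
  if u ∈ Pref u.1.length u.2.length Ω then
    if u.1 = [] then yMass q j Ω t u.2 else weight q j Ω t u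
  else 0

/-- The normalizing factor of the followers of a word. -/
noncomputable def normFactor (q j : ℕ) (Ω : Set (Symb m₁ m₂)) (t : Word m₁ m₂ → ℝ)
    (u : Word m₁ m₂) : ℝ :=
  if u.1 = [] then nested q j Ω t 0 u.2 else t u ^ ((q : ℝ) ^ (j + 1) * gam m₁ m₂)

/-- All factors of the weight except the last depend only on truncations that both words share. -/
theorem weight_pre_succ {Ω : Set (Symb m₁ m₂)} (t : Word m₁ m₂ → ℝ) {k : ℕ} (hk : k ≠ 0)
    (z : Symb m₁ m₂) : weight q j Ω t (pre (k + 1) j z) = weight q j Ω t (pre k j z) *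
      (t (pre (k + 1) j z) * xSum j Ω t (pre k (j + 1) z) ^ ((q : ℝ) ^ j * gam m₁ m₂ - 1)
        / t (pre k j z) ^ ((q : ℝ) ^ (j + 1) * gam m₁ m₂)) := by
  unfold weight
  rw [length_pre_fst, length_pre_fst, Finset.prod_Icc_succ_top (by omega), ← mul_assoc]
  congr 1
  · congr 1
    · congr 1
      · rw [trunc_pre (by omega) (by omega), trunc_pre (by omega) (by omega),
          trunc_pre (by omega) (by omega), trunc_pre (by omega) (by omega)]
      · refine Finset.prod_congr rfl fun p _ => ?_
        rw [ys_pre, ys_pre, take_pre_snd (by omega), take_pre_snd (by omega)]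
    · refine Finset.prod_congr rfl fun p hp => ?_
      have := Finset.mem_Icc.1 hp
      rw [trunc_pre (by omega) (by omega), trunc_pre (by omega) (by omega),
        trunc_pre (by omega) (by omega), trunc_pre (by omega) (by omega),
        trunc_pre (by omega) (by omega), trunc_pre (by omega) (by omega)]
  · rw [trunc_pre (by omega) (by omega), trunc_pre (by omega) (by omega),
      trunc_pre (by omega) (by omega), Nat.add_sub_cancel]

theorem yMass_pre {Ω : Set (Symb m₁ m₂)} (t : Word m₁ m₂ → ℝ) (s : ℕ) (z : Symb m₁ m₂) :
    yMass q j Ω t (pre 0 s z).2 = nested q j Ω t (j - s) (pre 0 s z).2 *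
      (∏ i ∈ Finset.range s, nested q j Ω t (j - (i + 1)) (pre 0 (i + 1) z).2
        ^ ((1 - (q : ℝ)) / q)) / tRoot q j Ω t := by
  rw [yMass, length_pre_snd]
  congr 2
  refine Finset.prod_congr rfl fun i hi => ?_
  have := Finset.mem_range.1 hi
  rw [take_pre_snd (by omega)]

theorem weight_pre_one {Ω : Set (Symb m₁ m₂)} (t : Word m₁ m₂ → ℝ) {z : Symb m₁ m₂}
    (hN : nested q j Ω t 0 (pre 0 j z).2 ≠ 0) :
    weight q j Ω t (pre 1 j z) = yMass q j Ω t (pre 0 j z).2 *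
      (t (pre 1 j z) * xSum j Ω t (pre 0 (j + 1) z) ^ ((q : ℝ) ^ j * gam m₁ m₂ - 1)
        / nested q j Ω t 0 (pre 0 j z).2) := by
  unfold weight
  rw [length_pre_fst, Finset.Icc_eq_empty (by omega), Finset.prod_empty, mul_one, yMass_pre,
    Nat.sub_self, trunc_pre (by omega) (by omega), trunc_pre (by omega) (by omega)]
  have : ∏ p ∈ Finset.range j, nested q j Ω t p ((ys (pre 1 j z)).take (j - p))
      ^ ((1 - (q : ℝ)) / q) = ∏ i ∈ Finset.range j,
      nested q j Ω t (j - (i + 1)) (pre 0 (i + 1) z).2 ^ ((1 - (q : ℝ)) / q) := by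
    rw [← Finset.prod_range_reflect]
    refine Finset.prod_congr rfl fun i hi => ?_
    have := Finset.mem_range.1 hi
    rw [ys_pre, take_pre_snd (by omega), show j - (j - 1 - i) = i + 1 by omega,
      show j - 1 - i = j - (i + 1) by omega]
  rw [this]
  field_simp

theorem mem_Pref_of_fillX {Ω : Set (Symb m₁ m₂)} {v : Word m₁ m₂} {y : Fin m₂} {x : Fin m₁}
    (h : fillX (v.1, v.2 ++ [y]) x ∈ Pref (v.1.length + 1) v.2.length Ω) :
    v ∈ Pref v.1.length v.2.length Ω := by
  obtain ⟨-, -, ω, hω, hcyl⟩ := h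
  refine ⟨rfl, rfl, ω, hω, ?_⟩
  obtain ⟨z, hv, hy, hx⟩ := exists_pre ω v y x
  set k := v.1.length
  set l := v.2.length
  rw [hv, ← hy, ← hx, fillX_snoc_pre, cyl_pre] at hcyl
  rw [hv, cyl_pre]
  exact cell_anti (by omega) (by omega) z hcyl

/-- Outside the tree every inner sum is empty, and the exponents are positive, so zeros propagate
outwards. Sums over all letters thus agree with sums over admissible ones. -/
theorem nested_eq_zero (H : Params m₁ m₂ q j) {Ω : Set (Symb m₁ m₂)} {t : Word m₁ m₂ → ℝ}
    (p : ℕ) (w : List (Fin m₂)) (hpw : p + w.length = j)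
    (hw : (([], w) : Word m₁ m₂) ∉ Pref 0 w.length Ω) : nested q j Ω t p w = 0 := by
  induction p generalizing w with
  | zero =>
    refine Finset.sum_eq_zero fun y _ => ?_
    have : xSum j Ω t ([], w ++ [y]) = 0 := by
      classical
      refine Finset.sum_eq_zero fun x hx => absurd ?_ hw
      have hx' := (Finset.mem_filter.1 hx).2
      rw [← hpw, zero_add] at hx'
      exact mem_Pref_of_fillX (v := ([], w)) hx'
    rw [this, Real.zero_rpow H.a_pos.ne']
  | succ p ih =>
    refine Finset.sum_eq_zero fun y _ => ?_
    rw [ih (w ++ [y]) (by simp; omega) ?_, Real.zero_rpow (one_div_pos.2 H.q_pos).ne']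
    rintro ⟨-, -, ω, hω, h1, h2⟩
    refine hw ⟨rfl, rfl, ω, hω, h1, fun i hi => ?_⟩
    dsimp only at hi
    have := h2 i (by simp only [List.length_append, List.length_singleton]; omega)
    simpa [List.getElem_append_left hi] using this

/-- The case x = 0 is included: the factor x kills whatever value a possibly negative power of 0
takes. -/
theorem mul_rpow_sub_one {x a : ℝ} (hx : 0 ≤ x) (ha : a ≠ 0) : x * x ^ (a - 1) = x ^ a := by
  rcases hx.eq_or_lt with rfl | h
  · rw [zero_mul, Real.zero_rpow ha]
  · rw [Real.rpow_sub_one h.ne']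
    field_simp

theorem mul_rpow_inv (H : Params m₁ m₂ q j) {x : ℝ} (hx : 0 ≤ x) :
    x * x ^ ((1 - (q : ℝ)) / q) = x ^ (1 / (q : ℝ)) := by
  have := H.q_pos.ne'
  rw [show (1 - (q : ℝ)) / q = 1 / q - 1 by field_simp]
  exact mul_rpow_sub_one hx (one_div_pos.2 H.q_pos).ne'

section Mass

variable {Ω : Set (Symb m₁ m₂)} {t : Word m₁ m₂ → ℝ}

theorem IsSolution.nonneg (ht : IsSolution q j Ω t) (v : Word m₁ m₂) : 0 ≤ t v :=
  zero_le_one.trans (ht.one_le v)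

theorem yMass_nonneg (ht : IsSolution q j Ω t) (w : List (Fin m₂)) : 0 ≤ yMass q j Ω t w :=
  div_nonneg (mul_nonneg (nested_nonneg ht.nonneg _ _)
    (Finset.prod_nonneg fun _ _ => Real.rpow_nonneg (nested_nonneg ht.nonneg _ _) _))
    (nested_nonneg ht.nonneg _ _)

theorem weight_nonneg (ht : IsSolution q j Ω t) (u : Word m₁ m₂) : 0 ≤ weight q j Ω t u := by
  refine mul_nonneg (mul_nonneg (div_nonneg (mul_nonneg (ht.nonneg _) ?_) ?_) ?_) ?_
  · exact Real.rpow_nonneg (xSum_nonneg ht.nonneg _) _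
  · exact nested_nonneg ht.nonneg _ _
  · exact Finset.prod_nonneg fun _ _ => Real.rpow_nonneg (nested_nonneg ht.nonneg _ _) _
  · exact Finset.prod_nonneg fun _ _ => div_nonneg (mul_nonneg (ht.nonneg _)
      (Real.rpow_nonneg (xSum_nonneg ht.nonneg _) _)) (Real.rpow_nonneg (ht.nonneg _) _)

theorem mass_nonneg (ht : IsSolution q j Ω t) (u : Word m₁ m₂) : 0 ≤ mass q j Ω t u := by
  unfold mass
  split_ifs
  exacts [yMass_nonneg ht _, weight_nonneg ht _, le_rfl]

/-- The new factor N · N^((1-q)/q) equals N^(1/q), and these powers sum to the N of the shorter word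
by its definition. -/
theorem sum_yMass (H : Params m₁ m₂ q j) (ht : IsSolution q j Ω t) (w : List (Fin m₂))
    (hw : w.length < j) : ∑ y, yMass q j Ω t (w ++ [y]) = yMass q j Ω t w := by
  have h : ∀ y : Fin m₂, yMass q j Ω t (w ++ [y]) =
      nested q j Ω t (j - (w.length + 1)) (w ++ [y]) ^ (1 / (q : ℝ)) *
      ((∏ i ∈ Finset.range w.length, nested q j Ω t (j - (i + 1)) (w.take (i + 1))
        ^ ((1 - (q : ℝ)) / q)) / tRoot q j Ω t) := by
    intro y
    rw [yMass, List.length_append, List.length_singleton, Finset.prod_range_succ,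
      List.take_of_length_le (by simp), ← mul_rpow_inv H (nested_nonneg ht.nonneg _ _)]
    have : ∏ i ∈ Finset.range w.length, nested q j Ω t (j - (i + 1)) ((w ++ [y]).take (i + 1))
        ^ ((1 - (q : ℝ)) / q) = ∏ i ∈ Finset.range w.length,
        nested q j Ω t (j - (i + 1)) (w.take (i + 1)) ^ ((1 - (q : ℝ)) / q) := by
      refine Finset.prod_congr rfl fun i hi => ?_
      have := Finset.mem_range.1 hi
      rw [List.take_append_of_le_length (by omega)]
    rw [this]
    ring
  simp only [h]
  rw [← Finset.sum_mul, yMass, mul_div_assoc]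
  congr 1
  rw [show j - w.length = j - (w.length + 1) + 1 by omega]
  rfl

theorem yMass_nil (H : Params m₁ m₂ q j) (ht : IsSolution q j Ω t) (hne : Ω.Nonempty) :
    yMass q j Ω t [] = 1 := by
  have := one_le_tRoot H ht.one_le hne
  rw [yMass]
  simp only [List.length_nil, Nat.sub_zero, Finset.range_zero, Finset.prod_empty, mul_one]
  exact div_self (by rw [tRoot] at this; linarith)

theorem mass_nil (H : Params m₁ m₂ q j) (w : List (Fin m₂)) (hw : w.length ≤ j) :
    mass q j Ω t ([], w) = yMass q j Ω t w := by
  unfold mass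
  rw [if_pos rfl]
  split_ifs with h
  · rfl
  · rw [yMass, nested_eq_zero H _ _ (Nat.sub_add_cancel hw) h, zero_mul, zero_div]

theorem normFactor_eq_sum {u : Word m₁ m₂} (ht : IsSolution q j Ω t)
    (hu : u ∈ Pref u.1.length j Ω) :
    normFactor q j Ω t u =
      ∑ y : Fin m₂, xSum j Ω t (u.1, u.2 ++ [y]) ^ ((q : ℝ) ^ j * gam m₁ m₂) := by
  unfold normFactor
  split_ifs with h
  · rw [h]
    rfl
  · exact ht.eqn _ u hu

theorem one_le_normFactor (H : Params m₁ m₂ q j) {u : Word m₁ m₂} (ht : IsSolution q j Ω t)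
    (hu : u ∈ Pref u.1.length j Ω) : 1 ≤ normFactor q j Ω t u := by
  rw [normFactor_eq_sum ht hu]
  exact one_le_sum_xSum H ht.one_le hu

/-- With `normFactor`, the first step out of the words without full letters and all later steps obey
one transition rule. -/
theorem mass_pre_succ (H : Params m₁ m₂ q j) (ht : IsSolution q j Ω t) {k : ℕ} {z : Symb m₁ m₂}
    (h : pre (k + 1) j z ∈ Pref (k + 1) j Ω) (h' : pre k j z ∈ Pref k j Ω) :
    mass q j Ω t (pre (k + 1) j z) = mass q j Ω t (pre k j z) / normFactor q j Ω t (pre k j z) *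
      (t (pre (k + 1) j z) * xSum j Ω t (pre k (j + 1) z) ^ ((q : ℝ) ^ j * gam m₁ m₂ - 1)) := by
  have hn := one_le_normFactor H ht (u := pre k j z) (by rwa [length_pre_fst])
  have hnil : ∀ k', (pre k' j z).1 = [] ↔ k' = 0 := by
    intro k'
    simp [pre]
  rw [mass, mass, length_pre_fst, length_pre_fst, length_pre_snd, length_pre_snd, if_pos h,
    if_pos h', if_neg (by simp [hnil])]
  rcases eq_or_ne k 0 with rfl | hk
  · have h0 : (pre 0 j z).1 = [] := (hnil 0).2 rfl
    rw [normFactor, if_pos h0] at hn ⊢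
    rw [if_pos h0, zero_add, weight_pre_one t (by linarith)]
    ring
  · have h0 : (pre k j z).1 ≠ [] := fun h => hk ((hnil k).1 h)
    rw [normFactor, if_neg h0] at hn ⊢
    rw [if_neg h0, weight_pre_succ t hk]
    ring

/-- If S is the sum of t over first coordinates, the transition weights t · S^(q^j γ - 1) add up to
S^(q^j γ). Summing over y then gives `normFactor`, by the system or by the definition of N_j. -/
theorem sum_mass_fillX (H : Params m₁ m₂ q j) (ht : IsSolution q j Ω t) {u : Word m₁ m₂}
    (hu : u ∈ Pref u.1.length j Ω) (y : Fin m₂) :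
    ∑ x, mass q j Ω t (fillX (u.1, u.2 ++ [y]) x) = mass q j Ω t u / normFactor q j Ω t u *
      xSum j Ω t (u.1, u.2 ++ [y]) ^ ((q : ℝ) ^ j * gam m₁ m₂) := by
  classical
  obtain ⟨ω, hω, -⟩ := exists_of_mem_Pref hu
  rw [← mul_rpow_sub_one (xSum_nonneg ht.nonneg _) H.a_pos.ne']
  generalize hS : xSum j Ω t (u.1, u.2 ++ [y]) ^ ((q : ℝ) ^ j * gam m₁ m₂ - 1) = S
  rw [xSum, Finset.sum_mul, Finset.mul_sum, Finset.sum_filter]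
  refine Finset.sum_congr rfl fun x _ => ?_
  obtain ⟨z, hv, hy, hx⟩ := exists_pre ω u y x
  have hk : u.2.length = j := hu.2.1
  set k := u.1.length
  rw [hk] at hv hy
  have hfill : fillX (u.1, u.2 ++ [y]) x = pre (k + 1) j z := by
    rw [hv, ← hy, ← hx, fillX_snoc_pre]
  have hc : ((u.1, u.2 ++ [y]) : Word m₁ m₂) = pre k (j + 1) z := by
    rw [hv, ← hy, pre_append]
  rw [hc] at hS
  rw [hfill]
  split_ifs with h
  · rw [mass_pre_succ H ht h (hv ▸ hu), ← hv, hS]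
  · rw [mass, length_pre_fst, length_pre_snd, if_neg h]

theorem sum_sum_mass_fillX (H : Params m₁ m₂ q j) (ht : IsSolution q j Ω t) (u : Word m₁ m₂)
    (hu : u.2.length = j) : ∑ y, ∑ x, mass q j Ω t (fillX (u.1, u.2 ++ [y]) x) =
      mass q j Ω t u := by
  by_cases h : u ∈ Pref u.1.length j Ω
  · have hn := one_le_normFactor H ht h
    simp only [sum_mass_fillX H ht h]
    rw [← Finset.mul_sum, ← normFactor_eq_sum ht h]
    exact div_mul_cancel₀ _ (by linarith)
  · rw [mass, hu, if_neg h]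
    refine Finset.sum_eq_zero fun y _ => Finset.sum_eq_zero fun x _ => ?_
    rw [mass, if_neg]
    rw [(fillX_snoc_length u x y).1, (fillX_snoc_length u x y).2]
    intro h'
    exact h (hu ▸ mem_Pref_of_fillX h')

/-- A probability measure on `Ω` with the prescribed masses exists. -/
theorem exists_hasWeights (H : Params m₁ m₂ q j) (ht : IsSolution q j Ω t) (hΩ : IsClosed Ω)
    (hne : Ω.Nonempty) : ∃ μ : Measure (Symb m₁ m₂), HasWeights q j Ω t μ := by
  have : Nonempty (Symb m₁ m₂) := hne.to_type
  obtain ⟨μ, hμ, hcyl⟩ := exists_measure_cyl_pre (j := j) (mass q j Ω t)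
    (by rw [mass_nil H _ (Nat.zero_le _), yMass_nil H ht hne]) (mass_nonneg ht)
    (fun w hw => by
      rw [mass_nil H _ hw.le, ← sum_yMass H ht w hw]
      exact Finset.sum_congr rfl fun y _ => mass_nil H _ (by simp; omega))
    (fun u hu => sum_sum_mass_fillX H ht u hu)
  have hbad : ∀ u : Word m₁ m₂, u.2.length = j → u ∉ Pref u.1.length j Ω → μ (cyl u) = 0 := by
    intro u hu hu'
    rcases (cyl u).eq_empty_or_nonempty with h | ⟨z, hz⟩
    · rw [h, measure_empty]
    · rw [mem_cyl_iff, hu] at hz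
      rw [← hz, hcyl, mass, length_pre_fst, length_pre_snd, hz, if_neg hu', ENNReal.ofReal_zero]
  refine ⟨μ, ⟨hμ, ?_⟩, ?_⟩
  · have hsub : Ωᶜ ⊆ ⋃ u : {u : Word m₁ m₂ // u.2.length = j ∧ u ∉ Pref u.1.length j Ω},
        cyl u.1 := by
      intro z hz
      obtain ⟨n, hn⟩ : ∃ n, Disjoint Ω (PiNat.cylinder z n) :=
        PiNat.exists_disjoint_cylinder hΩ hz
      refine mem_iUnion.2 ⟨⟨pre n j z, length_pre_snd _ _ _, fun h => ?_⟩, mem_cyl_pre_self _ _ _⟩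
      obtain ⟨-, -, ω, hω, hωz⟩ := h
      rw [cyl_pre] at hωz
      exact Set.disjoint_left.1 hn hω fun i hi => hωz.1 i hi
    exact measure_mono_null hsub (measure_iUnion_null fun u => hbad u.1 u.2.1 u.2.2)
  · intro k hk u hu
    obtain ⟨ω, hω, rfl⟩ := exists_of_mem_Pref hu
    have : (pre k j ω).1 ≠ [] := fun h => by
      have := congrArg List.length h
      rw [length_pre_fst] at this
      simp at this
      omega
    rw [measureReal_def, hcyl, mass, length_pre_fst, length_pre_snd, if_pos hu, if_neg this,
      ENNReal.toReal_ofReal (weight_nonneg ht _)]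

end Mass

/-- Cells of level (k, k + j) determine the first k letters, so each finite-dimensional cylinder is
a finite union of them for large k, and cylinders form a generating π-system. -/
theorem measure_eq_of_cell {μ ν : Measure (Symb m₁ m₂)} [IsProbabilityMeasure μ]
    [IsProbabilityMeasure ν]
    (h : ∀ k, 1 ≤ k → ∀ z, μ.real (cell k (k + j) z) = ν.real (cell k (k + j) z)) : μ = ν := by
  have hmap : ∀ k, 1 ≤ k → μ.map (lev k (k + j)) = ν.map (lev k (k + j)) := by
    intro k hk
    refine Measure.ext_of_singleton fun b => ?_
    rw [Measure.map_apply (measurable_lev _ _) (measurableSet_singleton _),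
      Measure.map_apply (measurable_lev _ _) (measurableSet_singleton _)]
    rcases (lev k (k + j) ⁻¹' {b}).eq_empty_or_nonempty with he | ⟨z, hz⟩
    · rw [he, measure_empty, measure_empty]
    · rw [mem_preimage, mem_singleton_iff] at hz
      rw [← hz, ← cell_eq]
      exact (measureReal_eq_measureReal_iff (measure_ne_top _ _) (measure_ne_top _ _)).1 (h k hk z)
  refine ext_of_generate_finite (measurableCylinders fun _ : ℕ => Fin m₁ × Fin m₂)
    generateFrom_measurableCylinders.symm isPiSystem_measurableCylinders ?_ (by simp)
  intro A hA
  obtain ⟨s, S, -, rfl⟩ := (mem_measurableCylinders A).1 hA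
  obtain ⟨n, hn⟩ : ∃ n, ∀ i ∈ s, i < n + 1 := by
    obtain ⟨n, hn⟩ := s.bddAbove
    exact ⟨n, fun i hi => Nat.lt_succ_of_le (hn hi)⟩
  have hA' : cylinder s S = lev (n + 1) (n + 1 + j) ⁻¹' (lev (n + 1) (n + 1 + j) '' cylinder s S) := by
    refine subset_antisymm (subset_preimage_image _ _) ?_
    rintro w ⟨ω, hω, hw⟩
    rw [mem_cylinder] at hω ⊢
    have : s.restrict w = s.restrict ω := by
      funext i
      exact ((lev_eq_iff.1 hw).1 i (hn i i.2)).symm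
    rwa [this]
  rw [hA', ← Measure.map_apply (measurable_lev _ _) (Set.toFinite _).measurableSet,
    ← Measure.map_apply (measurable_lev _ _) (Set.toFinite _).measurableSet,
    hmap _ (by omega)]

theorem measureReal_eq_sum_inter {X β : Type*} [MeasurableSpace X] [Fintype β] [MeasurableSpace β]
    [MeasurableSingletonClass β] (μ : Measure X) [IsFiniteMeasure μ] {f : X → β}
    (hf : Measurable f) (A : Set X) :
    μ.real A = ∑ b, μ.real (A ∩ f ⁻¹' {b}) := by
  have h := sum_measureReal_preimage_singleton (μ := μ.restrict A) (f := f) Finset.univ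
    fun b _ => hf (measurableSet_singleton b)
  rw [Finset.coe_univ, preimage_univ, measureReal_restrict_apply MeasurableSet.univ,
    univ_inter] at h
  rw [← h]
  refine Finset.sum_congr rfl fun b _ => ?_
  rw [measureReal_restrict_apply (hf (measurableSet_singleton b)), inter_comm]

theorem cyl_snoc (v : Word m₁ m₂) (y : Fin m₂) :
    cyl (v.1, v.2 ++ [y]) = cyl v ∩ (fun z => (z (v.1.length + v.2.length)).2) ⁻¹' {y} := by
  ext z
  rw [mem_inter_iff, mem_cyl_iff, mem_cyl_iff, mem_preimage, mem_singleton_iff,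
    List.length_append, List.length_singleton, ← pre_append]
  simp [Prod.ext_iff, and_assoc]

theorem cyl_fillX (c : Word m₁ m₂) (hc : c.2 ≠ []) (x : Fin m₁) :
    cyl (fillX c x) = cyl c ∩ (fun z => (z c.1.length).1) ⁻¹' {x} := by
  obtain ⟨l, w⟩ := c
  obtain ⟨y, w, rfl⟩ := List.exists_cons_of_ne_nil hc
  ext z
  have h : ∀ k i, (pre k (i + 1) z).2 = (z k).2 :: (pre (k + 1) i z).2 := by
    intro k i
    simp [pre, List.range_succ_eq_map, Function.comp_def, Nat.add_assoc, Nat.add_comm 1]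
  have h' : ∀ k i i', (pre (k + 1) i z).1 = (pre k i' z).1 ++ [z k] := by
    intro k i i'
    simp [pre, List.range_succ]
  rw [mem_inter_iff, mem_cyl_iff, mem_cyl_iff, mem_preimage, mem_singleton_iff, Prod.ext_iff,
    Prod.ext_iff]
  simp only [fillX, List.length_append, List.length_nil, List.length_cons, zero_add]
  rw [h, h' l.length w.length (w.length + 1), List.append_singleton_inj, List.cons.injEq,
    Prod.ext_iff]
  tauto

/-! ### Information of cells along a point of Ω -/

section HasWeights

variable {Ω : Set (Symb m₁ m₂)} {t : Word m₁ m₂ → ℝ} {μ : Measure (Symb m₁ m₂)}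

theorem HasWeights.measure_cyl_pre (hμ : HasWeights q j Ω t μ) {k : ℕ} (hk : 1 ≤ k)
    (z : Symb m₁ m₂) : μ.real (cyl (pre k j z)) = mass q j Ω t (pre k j z) := by
  rw [mass, length_pre_fst, length_pre_snd]
  split_ifs with h h'
  · have := congrArg List.length h'
    rw [length_pre_fst] at this
    simp at this
    omega
  · exact hμ.2 k hk _ h
  · have : cyl (pre k j z) ⊆ Ωᶜ := fun ω hω hωΩ =>
      h ⟨length_pre_fst _ _ _, length_pre_snd _ _ _, ω, hωΩ, hω⟩
    rw [measureReal_def, measure_mono_null this hμ.1.2, ENNReal.toReal_zero]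

theorem HasWeights.unique {ν : Measure (Symb m₁ m₂)} (hμ : HasWeights q j Ω t μ)
    (hν : HasWeights q j Ω t ν) : ν = μ := by
  have := hμ.1.1
  have := hν.1.1
  refine measure_eq_of_cell (j := j) fun k hk z => ?_
  rw [← cyl_pre, hμ.measure_cyl_pre hk, hν.measure_cyl_pre hk]

theorem HasWeights.measure_cyl_fillX (hμ : HasWeights q j Ω t μ) (z₀ : Symb m₁ m₂)
    {u : Word m₁ m₂} (hu : u.2.length = j) (y : Fin m₂) (x : Fin m₁) :
    μ.real (cyl (fillX (u.1, u.2 ++ [y]) x)) = mass q j Ω t (fillX (u.1, u.2 ++ [y]) x) := by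
  obtain ⟨z, hv, hy, hx⟩ := exists_pre z₀ u y x
  have hfill : fillX (u.1, u.2 ++ [y]) x = pre (u.1.length + 1) j z := by
    conv_lhs => rw [hv, ← hy, ← hx, fillX_snoc_pre, hu]
  rw [hfill]
  exact hμ.measure_cyl_pre (by omega) z

theorem measure_cyl_eq_sum_snoc (μ : Measure (Symb m₁ m₂)) [IsFiniteMeasure μ] (v : Word m₁ m₂) :
    μ.real (cyl v) = ∑ y, μ.real (cyl (v.1, v.2 ++ [y])) := by
  rw [measureReal_eq_sum_inter μ (f := fun z => (z (v.1.length + v.2.length)).2)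
    (measurable_snd.comp (measurable_pi_apply _)) (cyl v)]
  simp only [cyl_snoc]

theorem measure_cyl_eq_sum_fillX (μ : Measure (Symb m₁ m₂)) [IsFiniteMeasure μ]
    (c : Word m₁ m₂) (hc : c.2 ≠ []) : μ.real (cyl c) = ∑ x, μ.real (cyl (fillX c x)) := by
  rw [measureReal_eq_sum_inter μ (f := fun z => (z c.1.length).1)
    (measurable_fst.comp (measurable_pi_apply _)) (cyl c)]
  simp only [cyl_fillX c hc]

theorem HasWeights.measure_cyl (H : Params m₁ m₂ q j) (ht : IsSolution q j Ω t)
    (hμ : HasWeights q j Ω t μ) (z₀ : Symb m₁ m₂) {u : Word m₁ m₂} (hu : u.2.length = j) :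
    μ.real (cyl u) = mass q j Ω t u := by
  have := hμ.1.1
  rw [measure_cyl_eq_sum_snoc, ← sum_sum_mass_fillX H ht u hu]
  refine Finset.sum_congr rfl fun y _ => ?_
  rw [measure_cyl_eq_sum_fillX μ _ (by simp)]
  exact Finset.sum_congr rfl fun x _ => hμ.measure_cyl_fillX z₀ hu y x

/-- Masses are prescribed only for k ≥ 1. Those of pure y-words follow by summing over followers,
here by induction on the number d of missing second coordinates. -/
theorem HasWeights.measure_cyl_nil (H : Params m₁ m₂ q j) (ht : IsSolution q j Ω t)
    (hμ : HasWeights q j Ω t μ) (z₀ : Symb m₁ m₂) (d : ℕ) (w : List (Fin m₂))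
    (hw : w.length + d = j) : μ.real (cyl ([], w)) = yMass q j Ω t w := by
  have := hμ.1.1
  induction d generalizing w with
  | zero => rw [hμ.measure_cyl H ht z₀ hw, mass_nil H _ (by omega)]
  | succ d ih =>
    rw [measure_cyl_eq_sum_snoc, ← sum_yMass H ht w (by omega)]
    exact Finset.sum_congr rfl fun y _ => ih _ (by simp; omega)

/-- The logarithms of the numbers `N_l`, for `l ≤ j`, and of the powers of `t` on the left of the
system, for `l > j`, along `ω`. -/
noncomputable def logVal (q j : ℕ) (Ω : Set (Symb m₁ m₂)) (t : Word m₁ m₂ → ℝ) (l : ℕ)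
    (ω : Symb m₁ m₂) : ℝ :=
  if l ≤ j then Real.log (nested q j Ω t (j - l) (pre 0 l ω).2)
  else (q : ℝ) ^ (j + 1) * gam m₁ m₂ * Real.log (t (pre (l - j) j ω))

/-- The logarithms of the sums over first coordinates along `ω`. -/
noncomputable def logXSum (j : ℕ) (Ω : Set (Symb m₁ m₂)) (t : Word m₁ m₂ → ℝ) (p : ℕ)
    (ω : Symb m₁ m₂) : ℝ :=
  Real.log (xSum j Ω t (pre p (j + 1) ω))

/-- The information of the second coordinate number `r + 1`. -/
noncomputable def yInfo (q j : ℕ) (Ω : Set (Symb m₁ m₂)) (t : Word m₁ m₂ → ℝ) (r : ℕ)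
    (ω : Symb m₁ m₂) : ℝ :=
  if r < j then logVal q j Ω t r ω - logVal q j Ω t (r + 1) ω / q
  else logVal q j Ω t r ω - (q : ℝ) ^ j * gam m₁ m₂ * logXSum j Ω t (r - j) ω

/-- The information of the first coordinate number `r + 1`. -/
noncomputable def xInfo (q j : ℕ) (Ω : Set (Symb m₁ m₂)) (t : Word m₁ m₂ → ℝ) (r : ℕ)
    (ω : Symb m₁ m₂) : ℝ :=
  logXSum j Ω t r ω - logVal q j Ω t (r + j + 1) ω / ((q : ℝ) ^ (j + 1) * gam m₁ m₂)

theorem exp_logVal (H : Params m₁ m₂ q j) (ht : IsSolution q j Ω t) {ω : Symb m₁ m₂}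
    (hω : ω ∈ Ω) {l : ℕ} (hl : l ≤ j) :
    Real.exp (logVal q j Ω t l ω) = nested q j Ω t (j - l) (pre 0 l ω).2 := by
  rw [logVal, if_pos hl, Real.exp_log]
  exact one_pos.trans_le (one_le_nested_pre H ht.one_le hω _ _ (by omega))

theorem normFactor_pre (H : Params m₁ m₂ q j) (ht : IsSolution q j Ω t) {ω : Symb m₁ m₂}
    (hω : ω ∈ Ω) (p : ℕ) :
    normFactor q j Ω t (pre p j ω) = Real.exp (logVal q j Ω t (p + j) ω) := by
  have hnil : (pre p j ω).1 = [] ↔ p = 0 := by simp [pre]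
  rcases eq_or_ne p 0 with rfl | hp
  · rw [normFactor, if_pos (hnil.2 rfl), zero_add, exp_logVal H ht hω le_rfl, Nat.sub_self]
  · rw [normFactor, if_neg (fun h => hp (hnil.1 h)), logVal, if_neg (by omega),
      Nat.add_sub_cancel, Real.rpow_def_of_pos (one_pos.trans_le (ht.one_le _)), mul_comm]

theorem exp_logXSum (ht : IsSolution q j Ω t) {ω : Symb m₁ m₂} (hω : ω ∈ Ω) (p : ℕ) :
    Real.exp (logXSum j Ω t p ω) = xSum j Ω t (pre p (j + 1) ω) :=
  Real.exp_log (one_pos.trans_le (one_le_xSum_pre ht.one_le hω p))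

/-- Passing from s to s + 1 replaces a factor N_s by N_(s+1)^(1/q), whose logarithm is the increment
`yInfo`. -/
theorem HasWeights.measure_cell_zero (H : Params m₁ m₂ q j) (ht : IsSolution q j Ω t)
    (hμ : HasWeights q j Ω t μ) {ω : Symb m₁ m₂} (hω : ω ∈ Ω) (s : ℕ) (hs : s ≤ j) :
    μ.real (cell 0 s ω) = Real.exp (-∑ r ∈ Finset.range s, yInfo q j Ω t r ω) := by
  have hcyl : ∀ s ≤ j, μ.real (cell 0 s ω) = yMass q j Ω t (pre 0 s ω).2 := by
    intro s hs
    have := cyl_pre 0 s ω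
    rw [zero_add] at this
    rw [← this, ← hμ.measure_cyl_nil H ht ω (j - s) _ (by rw [length_pre_snd]; omega)]
    rfl
  induction s with
  | zero =>
    rw [hcyl 0 hs]
    have := yMass_nil H ht ⟨ω, hω⟩
    simpa [pre] using this
  | succ s ih =>
    have ih' := ih (by omega)
    rw [hcyl _ (by omega)] at ih'
    rw [hcyl _ hs, Finset.sum_range_succ, neg_add, Real.exp_add, ← ih', yMass_pre, yMass_pre,
      Finset.prod_range_succ, yInfo, if_pos (by omega), neg_sub, Real.exp_sub,
      exp_logVal H ht hω (by omega)]
    have h1 : Real.exp (logVal q j Ω t (s + 1) ω / q) =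
        nested q j Ω t (j - (s + 1)) (pre 0 (s + 1) ω).2 ^ (1 / (q : ℝ)) := by
      rw [← exp_logVal H ht hω hs, ← Real.exp_mul, mul_one_div]
    have h2 := one_le_nested_pre H ht.one_le hω (j - s) s (by omega)
    rw [h1, ← mul_rpow_inv H (nested_nonneg ht.nonneg _ _)]
    have h3 : nested q j Ω t (j - s) (pre 0 s ω).2 ≠ 0 := by linarith
    field_simp

/-- The level is raised alternately: a second coordinate first, costing `yInfo`, and then the first
coordinate j places behind it, costing `xInfo`. -/
theorem HasWeights.measure_cell_full (H : Params m₁ m₂ q j) (ht : IsSolution q j Ω t)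
    (hμ : HasWeights q j Ω t μ) {ω : Symb m₁ m₂} (hω : ω ∈ Ω) (p : ℕ) :
    μ.real (cell p (p + j) ω) = Real.exp (-(∑ r ∈ Finset.range (p + j), yInfo q j Ω t r ω +
      ∑ r ∈ Finset.range p, xInfo q j Ω t r ω)) ∧
    μ.real (cell p (p + j + 1) ω) = Real.exp (-(∑ r ∈ Finset.range (p + j + 1), yInfo q j Ω t r ω +
      ∑ r ∈ Finset.range p, xInfo q j Ω t r ω)) := by
  have := hμ.1.1
  have hcyl : ∀ p, μ.real (cell p (p + j) ω) = mass q j Ω t (pre p j ω) := by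
    intro p
    rw [← cyl_pre, hμ.measure_cyl H ht ω (length_pre_snd _ _ _)]
  have hstep1 : ∀ p, μ.real (cell p (p + j + 1) ω) = μ.real (cell p (p + j) ω) *
      Real.exp (-yInfo q j Ω t (p + j) ω) := by
    intro p
    have hP : pre p j ω ∈ Pref (pre p j ω).1.length j Ω := by
      rw [length_pre_fst]
      exact pre_mem_Pref _ _ hω
    rw [add_assoc, ← cyl_pre, measure_cyl_eq_sum_fillX μ _ (by simp [pre]), hcyl, ← pre_append,
      Finset.sum_congr rfl fun x _ => hμ.measure_cyl_fillX ω (length_pre_snd _ _ _) _ x,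
      sum_mass_fillX H ht hP, pre_append, normFactor_pre H ht hω, yInfo, if_neg (by omega),
      Nat.add_sub_cancel, neg_sub, Real.exp_sub, mul_comm ((q : ℝ) ^ j * gam m₁ m₂),
      Real.exp_mul, exp_logXSum ht hω]
    ring
  have hstep2 : ∀ p, μ.real (cell (p + 1) (p + 1 + j) ω) = μ.real (cell p (p + j + 1) ω) *
      Real.exp (-xInfo q j Ω t p ω) := by
    intro p
    rw [hstep1, hcyl, hcyl, mass_pre_succ H ht (pre_mem_Pref _ _ hω) (pre_mem_Pref _ _ hω),
      normFactor_pre H ht hω, yInfo, if_neg (by omega), Nat.add_sub_cancel, xInfo, neg_sub, neg_sub,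
      Real.exp_sub, Real.exp_sub, show logVal q j Ω t (p + j + 1) ω = _ from if_neg (by omega),
      mul_div_cancel_left₀ _ H.b_pos.ne', show p + j + 1 - j = p + 1 by omega,
      Real.exp_log (one_pos.trans_le (ht.one_le _)), mul_comm ((q : ℝ) ^ j * gam m₁ m₂),
      Real.exp_mul, exp_logXSum ht hω, Real.rpow_sub_one]
    · field_simp
    · exact (one_pos.trans_le (one_le_xSum_pre ht.one_le hω p)).ne'
  have h1 : ∀ p, μ.real (cell p (p + j) ω) =
      Real.exp (-(∑ r ∈ Finset.range (p + j), yInfo q j Ω t r ω +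
        ∑ r ∈ Finset.range p, xInfo q j Ω t r ω)) := by
    intro p
    induction p with
    | zero =>
      rw [zero_add, hμ.measure_cell_zero H ht hω j le_rfl]
      simp
    | succ p ih =>
      rw [hstep2, hstep1, ih, ← Real.exp_add, ← Real.exp_add, show p + 1 + j = p + j + 1 by omega,
        Finset.sum_range_succ, Finset.sum_range_succ]
      congr 1
      ring
  refine ⟨h1 p, ?_⟩
  rw [hstep1, h1, ← Real.exp_add, Finset.sum_range_succ]
  congr 1
  ring

/-- The levels `(p, s)` of the cells of the subsequences that are determined by a ball. -/
def IsLevel (j p s : ℕ) : Prop := (p + j ≤ s ∧ s ≤ p + j + 1) ∨ (p = 0 ∧ s ≤ j)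

theorem HasWeights.measure_cell (H : Params m₁ m₂ q j) (ht : IsSolution q j Ω t)
    (hμ : HasWeights q j Ω t μ) {ω : Symb m₁ m₂} (hω : ω ∈ Ω) {p s : ℕ} (h : IsLevel j p s) :
    μ.real (cell p s ω) = Real.exp (-(∑ r ∈ Finset.range s, yInfo q j Ω t r ω +
      ∑ r ∈ Finset.range p, xInfo q j Ω t r ω)) := by
  rcases h with ⟨h1, h2⟩ | ⟨rfl, h⟩
  · rcases Nat.lt_or_ge s (p + j + 1) with h3 | h3
    · obtain rfl : s = p + j := by omega
      exact (hμ.measure_cell_full H ht hω p).1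
    · obtain rfl : s = p + j + 1 := by omega
      exact (hμ.measure_cell_full H ht hω p).2
  · rw [hμ.measure_cell_zero H ht hω s h]
    simp

theorem exists_info_bound (H : Params m₁ m₂ q j) (ht : IsSolution q j Ω t) :
    ∃ B : ℝ, 0 ≤ B ∧ ∀ ω ∈ Ω, ∀ r, |logVal q j Ω t r ω| ≤ B ∧ |logXSum j Ω t r ω| ≤ B ∧
      |yInfo q j Ω t r ω| ≤ B ∧ |xInfo q j Ω t r ω| ≤ B := by
  obtain ⟨K, hK⟩ := exists_nested_le H ht
  set a := (q : ℝ) ^ j * gam m₁ m₂ with ha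
  set b := (q : ℝ) ^ (j + 1) * gam m₁ m₂ with hb
  have ha0 : 0 < a := H.a_pos
  have hb0 : 0 < b := H.b_pos
  set B₁ := max |Real.log K| (b * Real.log (tBound m₁ m₂ q)) with hB₁
  set B₂ := |Real.log (m₁ * tBound m₁ m₂ q)| with hB₂
  have h1 : ∀ ω ∈ Ω, ∀ r, |logVal q j Ω t r ω| ≤ B₁ := by
    intro ω hω r
    unfold logVal
    split_ifs with h
    · have h1 := one_le_nested_pre H ht.one_le hω (j - r) r (by omega)
      rw [abs_of_nonneg (Real.log_nonneg h1)]
      exact (Real.log_le_log (by linarith) (hK _ (by omega) _)).trans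
        ((le_abs_self _).trans (le_max_left _ _))
    · have h1 := ht.one_le (pre (r - j) j ω)
      rw [abs_of_nonneg (mul_nonneg hb0.le (Real.log_nonneg h1))]
      exact (mul_le_mul_of_nonneg_left (Real.log_le_log (by linarith) (ht.le_bound _)) hb0.le).trans
        (le_max_right _ _)
  have h2 : ∀ ω ∈ Ω, ∀ r, |logXSum j Ω t r ω| ≤ B₂ := by
    intro ω hω r
    have h1 := one_le_xSum_pre (j := j) ht.one_le hω r
    rw [logXSum, abs_of_nonneg (Real.log_nonneg h1)]
    exact (Real.log_le_log (by linarith) (xSum_le ht.nonneg ht.le_bound _)).trans (le_abs_self _)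
  have hB₁0 : 0 ≤ B₁ := (abs_nonneg _).trans (le_max_left _ _)
  have hB₂0 : 0 ≤ B₂ := abs_nonneg _
  have hq := H.one_lt_q
  refine ⟨B₁ + B₁ + B₂ + a * B₂ + B₁ / b, by positivity, fun ω hω r => ⟨?_, ?_, ?_, ?_⟩⟩
  · have := h1 ω hω r
    have : 0 ≤ a * B₂ + B₁ / b := by positivity
    linarith
  · have := h2 ω hω r
    have : 0 ≤ a * B₂ + B₁ / b := by positivity
    linarith
  · have : 0 ≤ a * B₂ := by positivity
    have : 0 ≤ B₁ / b := by positivity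
    unfold yInfo
    split_ifs with h
    · refine (abs_sub _ _).trans ?_
      have e : |logVal q j Ω t (r + 1) ω / q| ≤ B₁ := by
        rw [abs_div, Nat.abs_cast]
        exact (div_le_self (abs_nonneg _) hq.le).trans (h1 ω hω _)
      linarith [h1 ω hω r]
    · refine (abs_sub _ _).trans ?_
      rw [abs_mul, abs_of_pos ha0]
      linarith [h1 ω hω r, mul_le_mul_of_nonneg_left (h2 ω hω (r - j)) ha0.le]
  · have : 0 ≤ a * B₂ := by positivity
    refine (abs_sub _ _).trans ?_
    rw [abs_div, abs_of_pos hb0]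
    linarith [h2 ω hω r, div_le_div_of_nonneg_right (h1 ω hω (r + j + 1)) hb0.le]

end HasWeights

/-! ### Counting indices and levels -/

/-- The number of `r ≥ 0` with `i * q ^ r ≤ n`. -/
def cnt (q n i : ℕ) : ℕ := Nat.clog q (n / i + 1)

theorem lt_cnt_iff (hq : 2 ≤ q) {i : ℕ} (hi : 0 < i) (n r : ℕ) :
    r < cnt q n i ↔ i * q ^ r ≤ n := by
  rw [cnt, Nat.lt_clog_iff_pow_lt (by omega), Nat.lt_succ_iff, Nat.le_div_iff_mul_le hi, mul_comm]

/-- The integers in `[1, N]` that are not divisible by `q`. -/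
def idx (q N : ℕ) : Finset ℕ := (Finset.Icc 1 N).filter fun i => ¬ q ∣ i

theorem mem_idx {N i : ℕ} : i ∈ idx q N ↔ (1 ≤ i ∧ i ≤ N) ∧ ¬ q ∣ i := by
  rw [idx, Finset.mem_filter, Finset.mem_Icc]

theorem card_idx_add (q N : ℕ) : (idx q N).card + N / q = N := by
  have h1 : ((Finset.Icc 1 N).filter fun i => q ∣ i).card = N / q :=
    Nat.Ioc_filter_dvd_card_eq_div N q
  have h2 := Finset.card_filter_add_card_filter_not (s := Finset.Icc 1 N) (fun i => q ∣ i)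
  rw [h1, Nat.card_Icc] at h2
  rw [idx]
  omega

/-- Two roundings, of L/q^r and of its quotient by q, cost at most 2; the error bound does not
depend on r. -/
theorem card_idx_div_bounds (hq : 2 ≤ q) (L r : ℕ) :
    |((idx q (L / q ^ r)).card : ℝ) - (1 - 1 / q) * (L / (q : ℝ) ^ r)| ≤ 2 := by
  have hq0 : (0 : ℝ) < q := by positivity
  have hq1 : 1 / (q : ℝ) ≤ 1 := by
    rw [div_le_one hq0]
    norm_cast
    omega
  have hq2 : 0 ≤ 1 / (q : ℝ) := by positivity
  set N := L / q ^ r with hN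
  have h1 : ((idx q N).card : ℝ) + (N / q : ℕ) = N := by exact_mod_cast card_idx_add q N
  have h2 := Nat.cast_div_le (α := ℝ) (m := N) (n := q)
  have h3 := Nat.lt_floor_add_one ((N : ℝ) / q)
  rw [Nat.floor_div_natCast, Nat.floor_natCast] at h3
  have h4 : (N : ℝ) ≤ L / (q : ℝ) ^ r := by
    have := Nat.cast_div_le (α := ℝ) (m := L) (n := q ^ r)
    push_cast at this
    exact this
  have h5 := Nat.lt_floor_add_one ((L : ℝ) / (q : ℝ) ^ r)
  rw [← Nat.cast_pow, Nat.floor_div_natCast, Nat.floor_natCast, ← hN] at h5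
  push_cast at h5
  set x := (L : ℝ) / (q : ℝ) ^ r
  have h6 : (N : ℝ) / q = 1 / q * N := by ring
  rw [h6] at h2 h3
  have h7 : (1 - 1 / (q : ℝ)) * (x - N) ≤ 1 := by
    refine mul_le_one₀ (by linarith) (by linarith) (by linarith)
  have h8 : 0 ≤ (1 - 1 / (q : ℝ)) * (x - N) := mul_nonneg (by linarith) (by linarith)
  rw [abs_le]
  constructor <;> nlinarith

/-- Both sides sum over pairs (i, r) with i q^r ≤ n, in different orders. The series is finite since
n/q^r vanishes for large r. -/
theorem sum_idx_sum_cnt (hq : 2 ≤ q) {n L : ℕ} (hnL : n ≤ L) (c : ℕ → ℝ) :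
    ∑ i ∈ idx q L, ∑ r ∈ Finset.range (cnt q n i), c r =
      ∑' r, c r * (idx q (n / q ^ r)).card := by
  have hpow : ∀ r, 0 < q ^ r := fun r => Nat.pow_pos (by omega)
  have hlt : ∀ r, r < q ^ r := fun r => Nat.lt_pow_self (by omega)
  rw [tsum_eq_sum (s := Finset.range (n + 1))]
  · have h1 : ∀ i ∈ idx q L, ∑ r ∈ Finset.range (cnt q n i), c r =
        ∑ r ∈ Finset.range (n + 1), if i * q ^ r ≤ n then c r else 0 := by
      intro i hi
      have hi0 : 0 < i := (mem_idx.1 hi).1.1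
      rw [← Finset.sum_filter]
      refine Finset.sum_congr ?_ fun _ _ => rfl
      ext r
      rw [Finset.mem_range, Finset.mem_filter, Finset.mem_range, lt_cnt_iff hq hi0]
      refine ⟨fun h => ⟨?_, h⟩, fun h => h.2⟩
      have := Nat.le_mul_of_pos_left (q ^ r) hi0
      have := hlt r
      omega
    rw [Finset.sum_congr rfl h1, Finset.sum_comm]
    refine Finset.sum_congr rfl fun r _ => ?_
    rw [← Finset.sum_filter, Finset.sum_const, nsmul_eq_mul, mul_comm]
    congr 3
    ext i
    rw [Finset.mem_filter, mem_idx, mem_idx, Nat.le_div_iff_mul_le (hpow r)]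
    constructor
    · rintro ⟨⟨⟨h1, _⟩, h2⟩, h3⟩
      exact ⟨⟨h1, h3⟩, h2⟩
    · rintro ⟨⟨h1, h3⟩, h2⟩
      have := Nat.le_mul_of_pos_right i (hpow r)
      exact ⟨⟨⟨h1, by omega⟩, h2⟩, h3⟩
  · intro r hr
    rw [Finset.mem_range, not_lt] at hr
    have h0 : n / q ^ r = 0 := Nat.div_eq_of_lt (by have := hlt r; omega)
    rw [h0]
    simp [idx]

theorem tendsto_card_idx (hq : 2 ≤ q) {L : ℕ → ℕ} {κ : ℝ}
    (hL : Tendsto (fun n : ℕ => (L n : ℝ) / n) atTop (𝓝 κ)) (r : ℕ) :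
    Tendsto (fun n : ℕ => ((idx q (L n / q ^ r)).card : ℝ) / n) atTop
      (𝓝 ((1 - 1 / q) * κ / (q : ℝ) ^ r)) := by
  have h1 : Tendsto (fun n : ℕ => (((idx q (L n / q ^ r)).card : ℝ) -
      (1 - 1 / q) * (L n / (q : ℝ) ^ r)) / n) atTop (𝓝 0) := by
    refine squeeze_zero_norm (fun n => ?_) (tendsto_const_div_atTop_nhds_zero_nat 2)
    rw [Real.norm_eq_abs, abs_div, Nat.abs_cast]
    exact div_le_div_of_nonneg_right (card_idx_div_bounds hq _ _) (Nat.cast_nonneg _)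
  have h2 := h1.add (hL.const_mul ((1 - 1 / (q : ℝ)) / (q : ℝ) ^ r))
  rw [zero_add] at h2
  convert h2 using 2
  · ring
  · ring

theorem summable_mul_inv_pow (hq : 2 ≤ q) {c : ℕ → ℝ} {B : ℝ} (hc : ∀ r, |c r| ≤ B) :
    Summable fun r => c r / (q : ℝ) ^ r := by
  have hq0 : (0 : ℝ) < q := by positivity
  have hq1 : 1 / (q : ℝ) < 1 := by
    rw [div_lt_one hq0]
    norm_cast
  refine Summable.of_norm_bounded
    ((summable_geometric_of_lt_one (by positivity : 0 ≤ 1 / (q : ℝ)) hq1).mul_left B) fun r => ?_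
  rw [Real.norm_eq_abs, abs_div, abs_of_pos (pow_pos hq0 r), one_div_pow, mul_one_div]
  exact div_le_div_of_nonneg_right (hc r) (by positivity)

/-- Place r is reached by about (1 - 1/q) κ n/q^r indices. The count divided by n is eventually
dominated by a geometric sequence, which allows the limit inside the series. -/
theorem tendsto_sum_idx_sum_cnt (hq : 2 ≤ q) {c : ℕ → ℝ} {B : ℝ} (hc : ∀ r, |c r| ≤ B)
    {L L' : ℕ → ℕ} (hLL' : ∀ n, L n ≤ L' n) {κ : ℝ}
    (hL : Tendsto (fun n : ℕ => (L n : ℝ) / n) atTop (𝓝 κ)) :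
    Tendsto (fun n : ℕ => (∑ i ∈ idx q (L' n), ∑ r ∈ Finset.range (cnt q (L n) i), c r) / n) atTop
      (𝓝 ((1 - 1 / q) * κ * ∑' r, c r / (q : ℝ) ^ r)) := by
  have hq0 : (0 : ℝ) < q := by positivity
  have hq1 : 1 / (q : ℝ) < 1 := by
    rw [div_lt_one hq0]
    norm_cast
  have hB : 0 ≤ B := (abs_nonneg _).trans (hc 0)
  have hbd : ∀ᶠ n : ℕ in atTop, (L n : ℝ) / n ≤ κ + 1 :=
    hL.eventually_le_const (by linarith)
  have h : Tendsto (fun n : ℕ => ∑' r, c r * (((idx q (L n / q ^ r)).card : ℝ) / n)) atTop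
      (𝓝 (∑' r, c r * ((1 - 1 / q) * κ / (q : ℝ) ^ r))) := by
    refine tendsto_tsum_of_dominated_convergence
      (bound := fun r => B * (κ + 1) * (1 / (q : ℝ)) ^ r)
      ((summable_geometric_of_lt_one (by positivity) hq1).mul_left _)
      (fun r => (tendsto_card_idx hq hL r).const_mul (c r)) (hbd.mono fun n hn r => ?_)
    rw [Real.norm_eq_abs, abs_mul, abs_of_nonneg (by positivity :
      0 ≤ ((idx q (L n / q ^ r)).card : ℝ) / n), mul_assoc]
    refine mul_le_mul (hc r) ?_ (by positivity) hB
    have h1 : ((idx q (L n / q ^ r)).card : ℝ) ≤ L n / (q : ℝ) ^ r := by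
      have h1 : (idx q (L n / q ^ r)).card ≤ L n / q ^ r :=
        Nat.le.intro (card_idx_add q (L n / q ^ r))
      have h2 := Nat.cast_div_le (α := ℝ) (m := L n) (n := q ^ r)
      push_cast at h2
      exact (Nat.cast_le.2 h1).trans h2
    calc ((idx q (L n / q ^ r)).card : ℝ) / n ≤ L n / (q : ℝ) ^ r / n :=
          div_le_div_of_nonneg_right h1 (Nat.cast_nonneg _)
      _ = L n / n * (1 / (q : ℝ)) ^ r := by rw [one_div_pow]; ring
      _ ≤ _ := mul_le_mul_of_nonneg_right hn (by positivity)
  have hlim : ∑' r, c r * ((1 - 1 / q) * κ / (q : ℝ) ^ r) =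
      (1 - 1 / q) * κ * ∑' r, c r / (q : ℝ) ^ r := by
    rw [← tsum_mul_left]
    exact tsum_congr fun r => by ring
  rw [hlim] at h
  refine h.congr fun n => ?_
  rw [sum_idx_sum_cnt hq (hLL' n), ← tsum_div_const]
  exact tsum_congr fun r => by ring

theorem Params.one_le_inv_gam (H : Params m₁ m₂ q j) : 1 ≤ 1 / gam m₁ m₂ :=
  (one_le_pow₀ H.one_lt_q.le).trans H.pow_le

theorem le_ylen (H : Params m₁ m₂ q j) (n : ℕ) : n ≤ ylen m₁ m₂ n := by
  have h : (n : ℝ) ≤ n / gam m₁ m₂ := by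
    rw [div_eq_mul_one_div]
    exact le_mul_of_one_le_right (Nat.cast_nonneg _) H.one_le_inv_gam
  exact_mod_cast h.trans (Nat.le_ceil _)

theorem tendsto_ylen (H : Params m₁ m₂ q j) :
    Tendsto (fun n : ℕ => (ylen m₁ m₂ n : ℝ) / n) atTop (𝓝 (1 / gam m₁ m₂)) := by
  have h := (tendsto_nat_ceil_mul_div_atTop (one_div_nonneg.2 H.gam_pos.le)).comp
    (tendsto_natCast_atTop_atTop (R := ℝ))
  refine h.congr fun n => ?_
  simp only [Function.comp, ylen]
  rw [one_div_mul_eq_div]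

/-- Multiplying an index position by q^j keeps it within n/γ, while multiplying the first position
beyond n by q^(j+1) leaves the range. This is where the choice of j enters. -/
theorem isLevel_cnt (H : Params m₁ m₂ q j) (n : ℕ) {i : ℕ} (hi : 0 < i) :
    IsLevel j (cnt q n i) (cnt q (ylen m₁ m₂ n) i) := by
  have hq := H.two_le_q
  set p := cnt q n i with hp
  set s := cnt q (ylen m₁ m₂ n) i with hs
  have h1 : s ≤ p + j + 1 := by
    by_contra! hlt
    rw [hs, lt_cnt_iff hq hi] at hlt
    have h2 : ¬ i * q ^ p ≤ n := by
      rw [← lt_cnt_iff hq hi, ← hp]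
      exact lt_irrefl _
    -- Here i q^p is at least n + 1. Since 1/γ ≥ 1, the extra 1 absorbs the rounding in ⌈n/γ⌉ < n/γ
    -- + 1.
    have h3 : (n + 1) * q ^ (j + 1) ≤ ylen m₁ m₂ n := by
      refine le_trans ?_ hlt
      calc (n + 1) * q ^ (j + 1) ≤ i * q ^ p * q ^ (j + 1) := Nat.mul_le_mul_right _ (by omega)
        _ = i * q ^ (p + j + 1) := by ring
    have h4 : (ylen m₁ m₂ n : ℝ) < n / gam m₁ m₂ + 1 :=
      Nat.ceil_lt_add_one (div_nonneg (Nat.cast_nonneg _) H.gam_pos.le)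
    have h5 : ((n : ℝ) + 1) * (q : ℝ) ^ (j + 1) ≤ ylen m₁ m₂ n := by exact_mod_cast h3
    have h6 : ((n : ℝ) + 1) * (1 / gam m₁ m₂) < (n + 1) * (q : ℝ) ^ (j + 1) :=
      mul_lt_mul_of_pos_left H.lt_pow (by positivity)
    have h7 := H.one_le_inv_gam
    rw [div_eq_mul_one_div] at h4
    nlinarith
  rcases Nat.eq_zero_or_pos p with h0 | h0
  · rcases Nat.lt_or_ge s (j + 1) with h | h
    · exact Or.inr ⟨h0, by omega⟩
    · exact Or.inl ⟨by omega, h1⟩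
  · refine Or.inl ⟨?_, h1⟩
    have h2 : i * q ^ (p - 1) ≤ n := by
      rw [← lt_cnt_iff hq hi]
      omega
    have h3 : p - 1 + j < s := by
      rw [hs, lt_cnt_iff hq hi]
      have h4 : ((i * q ^ (p - 1 + j) : ℕ) : ℝ) ≤ n / gam m₁ m₂ := by
        have h5 : ((i * q ^ (p - 1) : ℕ) : ℝ) ≤ n := by exact_mod_cast h2
        push_cast at h5 ⊢
        rw [pow_add, ← mul_assoc, div_eq_mul_one_div]
        exact mul_le_mul h5 H.pow_le (pow_nonneg H.q_pos.le _) (Nat.cast_nonneg _)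
      exact_mod_cast h4.trans (Nat.le_ceil _)
    omega

/-- If i q^(p-1) ≤ n and i q^(p+j) exceeds the second length, then p and p + j are the only counts
compatible with `IsLevel`. -/
theorem le_card_level (H : Params m₁ m₂ q j) (n : ℕ) {p : ℕ} (hp : 1 ≤ p) :
    (idx q (n / q ^ (p - 1))).card - (idx q (ylen m₁ m₂ n / q ^ (p + j))).card ≤
      ((idx q (ylen m₁ m₂ n)).filter fun i =>
        cnt q n i = p ∧ cnt q (ylen m₁ m₂ n) i = p + j).card := by
  have hq := H.two_le_q
  have hpow : ∀ r, 0 < q ^ r := fun r => Nat.pow_pos (by omega)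
  refine (Finset.le_card_sdiff _ _).trans (Finset.card_le_card fun i hi => ?_)
  rw [Finset.mem_sdiff, mem_idx, mem_idx, Nat.le_div_iff_mul_le (hpow _),
    Nat.le_div_iff_mul_le (hpow _)] at hi
  obtain ⟨⟨⟨h1, h2⟩, h3⟩, h4⟩ := hi
  have h5 : ¬ i * q ^ (p + j) ≤ ylen m₁ m₂ n := fun h => h4 ⟨⟨h1, h⟩, h3⟩
  rw [← lt_cnt_iff hq h1] at h2 h5
  have h6 := isLevel_cnt H n h1
  have h7 : i ≤ ylen m₁ m₂ n := by
    have := Nat.le_mul_of_pos_right i (hpow (p - 1))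
    have := le_ylen H n
    rw [lt_cnt_iff hq h1] at h2
    omega
  rw [Finset.mem_filter, mem_idx]
  unfold IsLevel at h6
  exact ⟨⟨⟨h1, h7⟩, h3⟩, by omega, by omega⟩

/-- The limiting density is at least (1 - 1/q) (q^(-(p-1)) - q^(-(p+j))/γ), which is positive
because 1/γ < q^(j+1). -/
theorem exists_card_level_ge (H : Params m₁ m₂ q j) {p : ℕ} (hp : 1 ≤ p) :
    ∃ c : ℝ, 0 < c ∧ ∀ᶠ n : ℕ in atTop, c * n ≤
      ((idx q (ylen m₁ m₂ n)).filter fun i =>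
        cnt q n i = p ∧ cnt q (ylen m₁ m₂ n) i = p + j).card := by
  have hq := H.two_le_q
  have hq0 := H.q_pos
  have h1 : Tendsto (fun n : ℕ => (n : ℝ) / n) atTop (𝓝 1) :=
    tendsto_const_nhds.congr' ((eventually_gt_atTop 0).mono fun n hn =>
      (div_self (Nat.cast_ne_zero.2 hn.ne')).symm)
  have h2 := (tendsto_card_idx hq (L := fun n => n) h1 (p - 1)).sub
    (tendsto_card_idx hq (tendsto_ylen H) (p + j))
  set κ := (1 - 1 / (q : ℝ)) * 1 / (q : ℝ) ^ (p - 1) -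
    (1 - 1 / (q : ℝ)) * (1 / gam m₁ m₂) / (q : ℝ) ^ (p + j) with hκ
  have hκ0 : 0 < κ := by
    have h3 : 0 < 1 - 1 / (q : ℝ) := by
      rw [sub_pos, div_lt_one hq0]
      exact H.one_lt_q
    rw [hκ, sub_pos, div_lt_div_iff₀ (pow_pos hq0 _) (pow_pos hq0 _),
      show p + j = (j + 1) + (p - 1) by omega, pow_add _ (j + 1)]
    have := mul_lt_mul_of_pos_right (mul_lt_mul_of_pos_left H.lt_pow h3) (pow_pos hq0 (p - 1))
    linarith
  refine ⟨κ / 2, half_pos hκ0, ?_⟩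
  filter_upwards [h2.eventually_const_le (half_lt_self hκ0), eventually_gt_atTop 0] with n hn hn0
  have hn0' : (0 : ℝ) < n := Nat.cast_pos.2 hn0
  rw [← sub_div, le_div_iff₀ hn0'] at hn
  refine hn.trans ?_
  have h4 := le_card_level H n hp
  rw [tsub_le_iff_right] at h4
  have h5 : ((idx q (n / q ^ (p - 1))).card : ℝ) ≤
      ((idx q (ylen m₁ m₂ n)).filter fun i =>
        cnt q n i = p ∧ cnt q (ylen m₁ m₂ n) i = p + j).card +
        (idx q (ylen m₁ m₂ n / q ^ (p + j))).card := by exact_mod_cast h4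
  linarith

/-! ### Pointwise and mean information of balls -/

section Mean

variable {Ω : Set (Symb m₁ m₂)} {t : Word m₁ m₂ → ℝ} {μ ν : Measure (Symb m₁ m₂)}

/-- The sum of the information contents of the cells of `ω` at the levels that occur in a ball of
radius `m₁ ^ (-n)`. -/
noncomputable def infoSum (q : ℕ) (ρ : Measure (Symb m₁ m₂)) (n : ℕ) (ω : Symb m₁ m₂) : ℝ :=
  ∑ i ∈ idx q (ylen m₁ m₂ n),
    -Real.log (ρ.real (cell (cnt q n i) (cnt q (ylen m₁ m₂ n) i) ω))

theorem measurable_infoSum (ρ : Measure (Symb m₁ m₂)) (n : ℕ) : Measurable (infoSum q ρ n) :=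
  Finset.measurable_fun_sum _ fun _ _ => (Real.measurable_log.comp (measurable_measure_cell ρ _ _)).neg

theorem HasWeights.infoSum_eq (H : Params m₁ m₂ q j) (ht : IsSolution q j Ω t)
    (hμ : HasWeights q j Ω t μ) {ω : Symb m₁ m₂} (hω : ω ∈ Ω) (n : ℕ) :
    infoSum q μ n ω =
      (∑ i ∈ idx q (ylen m₁ m₂ n), ∑ r ∈ Finset.range (cnt q (ylen m₁ m₂ n) i),
        yInfo q j Ω t r ω) +
      ∑ i ∈ idx q (ylen m₁ m₂ n), ∑ r ∈ Finset.range (cnt q n i), xInfo q j Ω t r ω := by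
  rw [infoSum, ← Finset.sum_add_distrib]
  refine Finset.sum_congr rfl fun i hi => ?_
  rw [hμ.measure_cell H ht hω (isLevel_cnt H n (mem_idx.1 hi).1.1), Real.log_exp, neg_neg]

/-- Put R_r = `logVal` at r divided by q^r. The first j terms of the y-series telescope to R_0 -
R_j, the `logXSum` contributions of the y- and x-series cancel, and the remaining tails of R cancel
except for R_0 = log t_∅. -/
theorem tsum_info (H : Params m₁ m₂ q j) (ht : IsSolution q j Ω t) {ω : Symb m₁ m₂}
    (hω : ω ∈ Ω) :
    1 / gam m₁ m₂ * ∑' r, yInfo q j Ω t r ω / (q : ℝ) ^ r +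
      ∑' r, xInfo q j Ω t r ω / (q : ℝ) ^ r = Real.log (tRoot q j Ω t) / gam m₁ m₂ := by
  obtain ⟨B, hB0, hB⟩ := exists_info_bound H ht
  have hq := H.two_le_q
  have hq0 := H.q_pos
  have hg := H.gam_pos
  have hS := summable_mul_inv_pow hq fun r => (hB ω hω r).2.1
  have hR := summable_mul_inv_pow hq fun r => (hB ω hω r).1
  have hY := summable_mul_inv_pow hq fun r => (hB ω hω r).2.2.1
  set R : ℕ → ℝ := fun r => logVal q j Ω t r ω / (q : ℝ) ^ r with hRdef
  have hRj : Summable fun r => R (r + j) := (summable_nat_add_iff j).2 hR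
  have hRj1 : Summable fun r => R (r + 1 + j) := (summable_nat_add_iff 1).2 hRj
  have h1 : ∑ r ∈ Finset.range j, yInfo q j Ω t r ω / (q : ℝ) ^ r = R 0 - R j := by
    rw [← Finset.sum_range_sub']
    refine Finset.sum_congr rfl fun r hr => ?_
    rw [yInfo, if_pos (Finset.mem_range.1 hr)]
    simp only [hRdef]
    rw [pow_succ]
    field_simp
  have h2 : ∑' r, yInfo q j Ω t (r + j) ω / (q : ℝ) ^ (r + j) =
      ∑' r, R (r + j) - gam m₁ m₂ * ∑' r, logXSum j Ω t r ω / (q : ℝ) ^ r := by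
    rw [← tsum_mul_left, ← (hRj.tsum_sub (hS.mul_left _))]
    refine tsum_congr fun r => ?_
    rw [yInfo, if_neg (by omega), Nat.add_sub_cancel]
    simp only [hRdef]
    rw [pow_add]
    field_simp
  have h3 : ∑' r, xInfo q j Ω t r ω / (q : ℝ) ^ r =
      ∑' r, logXSum j Ω t r ω / (q : ℝ) ^ r - 1 / gam m₁ m₂ * ∑' r, R (r + 1 + j) := by
    rw [← tsum_mul_left, ← hS.tsum_sub (hRj1.mul_left _)]
    refine tsum_congr fun r => ?_
    rw [xInfo]
    simp only [hRdef]
    rw [show r + 1 + j = r + j + 1 by omega, show r + j + 1 = r + (j + 1) by omega,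
      pow_add _ r (j + 1)]
    field_simp
  have h4 := hRj.tsum_eq_zero_add
  rw [zero_add] at h4
  have h5 : R 0 = Real.log (tRoot q j Ω t) := by
    simp only [hRdef]
    rw [logVal, if_pos (Nat.zero_le _), pow_zero, div_one]
    rfl
  rw [← hY.sum_add_tsum_nat_add j, h1, h2, h3, h4, ← h5]
  field_simp
  ring

/-- The limit holds at every point of Ω, not merely almost everywhere, and does not depend on the
point. Comparison with arbitrary measures on Ω rests on this. -/
theorem HasWeights.tendsto_infoSum (H : Params m₁ m₂ q j) (ht : IsSolution q j Ω t)
    (hμ : HasWeights q j Ω t μ) {ω : Symb m₁ m₂} (hω : ω ∈ Ω) :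
    Tendsto (fun n : ℕ => infoSum q μ n ω / n) atTop
      (𝓝 ((1 - 1 / q) * (Real.log (tRoot q j Ω t) / gam m₁ m₂))) := by
  obtain ⟨B, hB0, hB⟩ := exists_info_bound H ht
  have hq := H.two_le_q
  have h1 : Tendsto (fun n : ℕ => (n : ℝ) / n) atTop (𝓝 1) :=
    tendsto_const_nhds.congr' ((eventually_gt_atTop 0).mono fun n hn =>
      (div_self (Nat.cast_ne_zero.2 hn.ne')).symm)
  have h2 := (tendsto_sum_idx_sum_cnt hq (fun r => (hB ω hω r).2.2.1) (fun n => le_refl _)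
    (tendsto_ylen H)).add (tendsto_sum_idx_sum_cnt hq (fun r => (hB ω hω r).2.2.2)
    (le_ylen H) h1)
  rw [mul_one, mul_assoc, ← mul_add, tsum_info H ht hω] at h2
  refine h2.congr fun n => ?_
  rw [hμ.infoSum_eq H ht hω, add_div]

/-- The counting limit for the constant sequence B dominates all points of Ω at once; this is the
bound needed for dominated convergence. -/
theorem HasWeights.exists_infoSum_le (H : Params m₁ m₂ q j) (ht : IsSolution q j Ω t)
    (hμ : HasWeights q j Ω t μ) :
    ∃ K : ℝ, ∀ ω ∈ Ω, ∀ n : ℕ, |infoSum q μ n ω / n| ≤ K := by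
  obtain ⟨B, hB0, hB⟩ := exists_info_bound H ht
  have hq := H.two_le_q
  have hc : ∀ r : ℕ, |(fun _ : ℕ => B) r| ≤ B := fun _ => (abs_of_nonneg hB0).le
  have h1 : Tendsto (fun n : ℕ => (n : ℝ) / n) atTop (𝓝 1) :=
    tendsto_const_nhds.congr' ((eventually_gt_atTop 0).mono fun n hn =>
      (div_self (Nat.cast_ne_zero.2 hn.ne')).symm)
  have h2 := (tendsto_sum_idx_sum_cnt hq hc (fun n => le_refl _)
    (tendsto_ylen H)).add (tendsto_sum_idx_sum_cnt hq hc (le_ylen H) h1)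
  obtain ⟨K, hK⟩ := h2.bddAbove_range
  refine ⟨K, fun ω hω n => le_trans ?_ (hK ⟨n, rfl⟩)⟩
  dsimp only
  rw [hμ.infoSum_eq H ht hω, abs_div, Nat.abs_cast, ← add_div]
  refine div_le_div_of_nonneg_right ((abs_add_le _ _).trans (add_le_add ?_ ?_)) (Nat.cast_nonneg _)
  · refine (Finset.abs_sum_le_sum_abs _ _).trans (Finset.sum_le_sum fun i _ => ?_)
    exact (Finset.abs_sum_le_sum_abs _ _).trans (Finset.sum_le_sum fun r _ => (hB ω hω r).2.2.1)
  · refine (Finset.abs_sum_le_sum_abs _ _).trans (Finset.sum_le_sum fun i _ => ?_)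
    exact (Finset.abs_sum_le_sum_abs _ _).trans (Finset.sum_le_sum fun r _ => (hB ω hω r).2.2.2)

theorem HasWeights.tendsto_integral_infoSum (H : Params m₁ m₂ q j) (ht : IsSolution q j Ω t)
    (hμ : HasWeights q j Ω t μ) (hν : IsProbOn Ω ν) :
    Tendsto (fun n : ℕ => (∫ ω, infoSum q μ n ω ∂ν) / n) atTop
      (𝓝 ((1 - 1 / q) * (Real.log (tRoot q j Ω t) / gam m₁ m₂))) := by
  have := hν.1
  have hae : ∀ᵐ ω ∂ν, ω ∈ Ω := by
    rw [ae_iff]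
    exact hν.2
  obtain ⟨K, hK⟩ := hμ.exists_infoSum_le H ht
  have h := tendsto_integral_of_dominated_convergence (μ := ν)
    (F := fun (n : ℕ) ω => infoSum q μ n ω / n)
    (f := fun _ => (1 - 1 / q) * (Real.log (tRoot q j Ω t) / gam m₁ m₂)) (fun _ => K)
    (fun n => ((measurable_infoSum μ n).div_const _).aestronglyMeasurable) (integrable_const K)
    (fun n => hae.mono fun ω hω => hK ω hω n)
    (hae.mono fun ω hω => hμ.tendsto_infoSum H ht hω)
  simp only [integral_const, probReal_univ, one_smul, integral_div] at h
  exact h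

end Mean

end MultCarpet

/-! ### Law of large numbers -/

/-- A law of large numbers for triangular arrays of bounded functions of independent and
identically distributed random variables. -/
theorem ae_tendsto_sum_sub_integral_div {S : Type*} [MeasurableSpace S] (ν : Measure S)
    [IsProbabilityMeasure ν] (f : ℕ → ℕ → S → ℝ) (hf : ∀ k i, Measurable (f k i))
    (I : ℕ → Finset ℕ) (b a : ℕ → ℝ) (ha : ∀ k, 0 < a k)
    (hb : ∀ k, ∀ i ∈ I k, ∀ᵐ ω ∂ν, |f k i ω| ≤ b k)
    (hsum : Summable fun k => (I k).card * b k ^ 2 / a k ^ 2) :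
    ∀ᵐ w ∂(Measure.infinitePi fun _ : ℕ => ν),
      Tendsto (fun k => (∑ i ∈ I k, f k i (w i) - ∑ i ∈ I k, ∫ ω, f k i ω ∂ν) / a k)
        atTop (𝓝 0) := by
  set P := Measure.infinitePi fun _ : ℕ => ν with hP
  have heval : ∀ i, MeasurePreserving (Function.eval i) P ν :=
    measurePreserving_eval_infinitePi fun _ => ν
  have hmeas : ∀ k i, Measurable fun w : ℕ → S => f k i (w i) := fun k i =>
    (hf k i).comp (measurable_pi_apply i)
  have hbd : ∀ k, ∀ i ∈ I k, ∀ᵐ w ∂P, |f k i (w i)| ≤ b k := fun k i hi =>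
    (heval i).quasiMeasurePreserving.ae (hb k i hi)
  have hL2 : ∀ k, ∀ i ∈ I k, MemLp (fun w : ℕ → S => f k i (w i)) 2 P := fun k i hi =>
    MemLp.of_bound (hmeas k i).aestronglyMeasurable (b k) (hbd k i hi)
  have hmean : ∀ k, ∫ v, (∑ i ∈ I k, fun w : ℕ → S => f k i (w i)) v ∂P =
      ∑ i ∈ I k, ∫ ω, f k i ω ∂ν := by
    intro k
    simp only [Finset.sum_apply]
    rw [integral_finsetSum _ fun i hi => (hL2 k i hi).integrable (by norm_num)]
    refine Finset.sum_congr rfl fun i _ => ?_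
    rw [← (heval i).map_eq, integral_map (measurable_pi_apply i).aemeasurable
      (hf k i).aestronglyMeasurable]
  have hvar : ∀ k, ProbabilityTheory.variance (∑ i ∈ I k, fun w : ℕ → S => f k i (w i)) P ≤
      (I k).card * b k ^ 2 := by
    intro k
    rw [ProbabilityTheory.IndepFun.variance_sum (hL2 k) fun i _ i' _ hii' =>
      (ProbabilityTheory.iIndepFun_infinitePi (P := fun _ : ℕ => ν) (X := fun i => f k i)
        (hf k)).indepFun hii', ← nsmul_eq_mul, ← Finset.sum_const]
    refine Finset.sum_le_sum fun i hi => ?_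
    refine (ProbabilityTheory.variance_le_expectation_sq
      (hmeas k i).aestronglyMeasurable).trans ?_
    calc ∫ w, ((fun w : ℕ → S => f k i (w i)) ^ 2) w ∂P ≤ ∫ _, b k ^ 2 ∂P := by
          refine integral_mono_ae (hL2 k i hi).integrable_sq (integrable_const _) ?_
          filter_upwards [hbd k i hi] with w hw
          exact sq_le_sq.2 (hw.trans (le_abs_self _))
      _ = b k ^ 2 := by simp
  -- Chebyshev's inequality with the variance bound and Borel–Cantelli, for the countably many
  -- tolerances 1/(m + 1).
  have hdev : ∀ m : ℕ, ∀ᵐ w ∂P, ∀ᶠ k in atTop,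
      |(∑ i ∈ I k, f k i (w i) - ∑ i ∈ I k, ∫ ω, f k i ω ∂ν) / a k| < 1 / ((m : ℝ) + 1) := by
    intro m
    set ε : ℝ := 1 / ((m : ℝ) + 1) with hε
    have hε0 : 0 < ε := by positivity
    have h := ae_eventually_notMem (μ := P) (s := fun k => {w | ε * a k ≤
      |(∑ i ∈ I k, fun w : ℕ → S => f k i (w i)) w -
        ∫ v, (∑ i ∈ I k, fun w : ℕ → S => f k i (w i)) v ∂P|}) ?_
    · filter_upwards [h] with w hw
      filter_upwards [hw] with k hk
      rw [not_le, hmean, Finset.sum_apply] at hk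
      rw [abs_div, abs_of_pos (ha k), div_lt_iff₀ (ha k)]
      exact hk
    · have hle : ∀ k, P {w | ε * a k ≤ |(∑ i ∈ I k, fun w : ℕ → S => f k i (w i)) w -
          ∫ v, (∑ i ∈ I k, fun w : ℕ → S => f k i (w i)) v ∂P|} ≤
          ENNReal.ofReal ((I k).card * b k ^ 2 / a k ^ 2 / ε ^ 2) := by
        intro k
        refine (ProbabilityTheory.meas_ge_le_variance_div_sq (memLp_finsetSum' _ (hL2 k))
          (mul_pos hε0 (ha k))).trans (ENNReal.ofReal_le_ofReal ?_)
        rw [mul_pow, mul_comm (ε ^ 2), ← div_div]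
        exact div_le_div_of_nonneg_right (div_le_div_of_nonneg_right (hvar k) (sq_nonneg _))
          (sq_nonneg _)
      refine ne_top_of_le_ne_top ?_ (ENNReal.tsum_le_tsum hle)
      rw [← ENNReal.ofReal_tsum_of_nonneg (fun k => by positivity) (hsum.div_const _)]
      exact ENNReal.ofReal_ne_top
  filter_upwards [ae_all_iff.2 hdev] with w hw
  rw [Metric.tendsto_atTop']
  intro δ hδ
  obtain ⟨m, hm⟩ := exists_nat_one_div_lt hδ
  obtain ⟨N, hN⟩ := eventually_atTop.1 (hw m)
  refine ⟨N, fun k hk => ?_⟩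
  rw [Real.dist_eq, sub_zero]
  exact (hN k hk.le).trans hm

/-! ### Almost sure masses of balls -/

namespace MultCarpet

variable {m₁ m₂ q j : ℕ}

/-- Entry number i q^r constrains only place r of the i-th factor, and each entry number has exactly
one such form with q ∤ i. Hence the preimage of a cell is a box. -/
theorem measure_cell_interleave (hq : 2 ≤ q) (ρ : Measure (Symb m₁ m₂)) [IsProbabilityMeasure ρ]
    {n L : ℕ} (hnL : n ≤ L) (w : ℕ → Symb m₁ m₂) :
    prodMeasure q ρ (cell n L (interleave q w)) =
      ∏ i ∈ idx q L, ρ (cell (cnt q n i) (cnt q L i) (w i)) := by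
  rw [prodMeasure, Measure.map_apply (measurable_interleave q) (measurableSet_cell _ _ _),
    ← Measure.infinitePi_pi (fun _ : ℕ => ρ)
      (t := fun i => cell (cnt q n i) (cnt q L i) (w i)) (fun i _ => measurableSet_cell _ _ _)]
  congr 1
  ext v
  simp only [mem_preimage, Set.mem_pi, Finset.mem_coe, mem_idx]
  constructor
  · rintro ⟨h1, h2⟩ i ⟨⟨hi1, -⟩, hi⟩
    refine ⟨fun r hr => ?_, fun r hr => ?_⟩
    · rw [lt_cnt_iff hq hi1] at hr
      have hpos : 0 < i * q ^ r := Nat.mul_pos hi1 (Nat.pow_pos (by omega))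
      rw [← interleave_apply hq v hi r, ← interleave_apply hq w hi r]
      exact h1 _ (by omega)
    · rw [lt_cnt_iff hq hi1] at hr
      have hpos : 0 < i * q ^ r := Nat.mul_pos hi1 (Nat.pow_pos (by omega))
      rw [← interleave_apply hq v hi r, ← interleave_apply hq w hi r]
      exact h2 _ (by omega)
  · intro h
    have key : ∀ k < L, ∃ i r, i * q ^ r = k + 1 ∧ 0 < i ∧ ¬ q ∣ i ∧
        v i ∈ cell (cnt q n i) (cnt q L i) (w i) := by
      intro k hk
      have hfin : FiniteMultiplicity q (k + 1) :=
        Nat.finiteMultiplicity_iff.2 ⟨by omega, by omega⟩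
      obtain ⟨i, hki, hi⟩ := hfin.exists_eq_pow_mul_and_not_dvd
      have hi0 : 0 < i := Nat.pos_of_ne_zero fun h0 => hi (h0 ▸ dvd_zero q)
      have hk1 : i * q ^ multiplicity q (k + 1) = k + 1 :=
        (mul_comm _ _).trans hki.symm
      have := Nat.le_mul_of_pos_right i (Nat.pow_pos (n := multiplicity q (k + 1))
        (by omega : 0 < q))
      exact ⟨i, _, hk1, hi0, hi, h i ⟨⟨hi0, by omega⟩, hi⟩⟩
    refine ⟨fun k hk => ?_, fun k hk => ?_⟩
    · obtain ⟨i, r, hk1, hi0, hi, hc, -⟩ := key k (by omega)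
      have hv := interleave_apply hq v hi r
      have hw := interleave_apply hq w hi r
      rw [hk1, Nat.add_sub_cancel] at hv hw
      rw [hv, hw]
      exact hc r ((lt_cnt_iff hq hi0 _ _).2 (by omega))
    · obtain ⟨i, r, hk1, hi0, hi, -, hc⟩ := key k hk
      have hv := interleave_apply hq v hi r
      have hw := interleave_apply hq w hi r
      rw [hk1, Nat.add_sub_cancel] at hv hw
      rw [hv, hw]
      exact hc r ((lt_cnt_iff hq hi0 _ _).2 (by omega))

theorem isProbabilityMeasure_prodMeasure (q : ℕ) (ρ : Measure (Symb m₁ m₂))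
    [IsProbabilityMeasure ρ] : IsProbabilityMeasure (prodMeasure q ρ) :=
  Measure.isProbabilityMeasure_map (measurable_interleave q).aemeasurable

theorem ylen_le_mul (m₁ m₂ n : ℕ) :
    ylen m₁ m₂ n ≤ ⌈1 / gam m₁ m₂⌉₊ * n := by
  refine Nat.ceil_le.2 ?_
  push_cast
  rw [div_eq_mul_one_div, mul_comm]
  exact mul_le_mul_of_nonneg_right (Nat.le_ceil _) (Nat.cast_nonneg _)

/-- Counts grow logarithmically, so along fourth powers k^4 a linear bound in k is ample; it only
uses K < 2^K and k < 2^k. -/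
theorem cnt_le (hq : 2 ≤ q) {i : ℕ} (hi : 0 < i) {K L k : ℕ} (hL : L ≤ K * k ^ 4) :
    cnt q L i ≤ K + 4 * k := by
  by_contra! h
  rw [lt_cnt_iff hq hi] at h
  have h1 : q ^ (K + 4 * k) ≤ K * k ^ 4 := (Nat.le_mul_of_pos_left _ hi).trans (h.trans hL)
  have h2 : 2 ^ K * (2 ^ k) ^ 4 ≤ q ^ (K + 4 * k) := by
    rw [← pow_mul, mul_comm k, ← pow_add]
    exact Nat.pow_le_pow_left hq _
  have h3 : K * k ^ 4 < 2 ^ K * (2 ^ k) ^ 4 :=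
    Nat.mul_lt_mul_of_lt_of_le Nat.lt_two_pow_self
      (Nat.pow_le_pow_left Nat.lt_two_pow_self.le 4) (by positivity)
  omega

/-- The scales along which the law of large numbers is used. -/
def scale (k : ℕ) : ℕ := (k + 1) ^ 4

/-- By the product formula the information of a ball is a sum of independent terms under ℙ_ν. The
measure ρ may differ from ν; the exponential lower bound on Ω makes the terms at scale k of size
O(k). -/
theorem ae_tendsto_log_prodMeasure (H : Params m₁ m₂ q j) {Ω : Set (Symb m₁ m₂)}
    {ν ρ : Measure (Symb m₁ m₂)} [IsProbabilityMeasure ρ] (hν : IsProbOn Ω ν) {C : ℝ}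
    (hC : 0 ≤ C) (hρ : ∀ ω ∈ Ω, ∀ p s, IsLevel j p s →
      Real.exp (-(C * (s + 1))) ≤ ρ.real (cell p s ω)) :
    ∀ᵐ z ∂(prodMeasure q ν),
      (∀ k, 0 < (prodMeasure q ρ).real (cell (scale k) (ylen m₁ m₂ (scale k)) z)) ∧
      Tendsto (fun k : ℕ => (-Real.log ((prodMeasure q ρ).real (cell (scale k) (ylen m₁ m₂ (scale k)) z)) -
        ∫ ω, infoSum q ρ (scale k) ω ∂ν) / scale k) atTop (𝓝 0) := by
  have := hν.1
  have hq := H.two_le_q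
  have hae : ∀ᵐ ω ∂ν, ω ∈ Ω := by
    rw [ae_iff]
    exact hν.2
  rw [show prodMeasure q ν = (Measure.infinitePi fun _ : ℕ => ν).map (interleave q) from rfl,
    ae_map_iff (measurable_interleave q).aemeasurable]
  swap
  · refine MeasurableSet.inter ?_ (measurableSet_tendsto _ fun k => ?_)
    · exact measurableSet_setOfPred.2 (Measurable.forall fun k => measurableSet_setOfPred.1
        (measurableSet_lt measurable_const (measurable_measure_cell _ _ _)))
    exact (((Real.measurable_log.comp (measurable_measure_cell _ _ _)).neg).sub_const _).div_const _
  set K := ⌈1 / gam m₁ m₂⌉₊ with hK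
  let f : ℕ → ℕ → Symb m₁ m₂ → ℝ := fun k i ω =>
    -Real.log (ρ.real (cell (cnt q (scale k) i) (cnt q (ylen m₁ m₂ (scale k)) i) ω))
  have hf : ∀ k i, Measurable (f k i) := fun k i =>
    (Real.measurable_log.comp (measurable_measure_cell ρ _ _)).neg
  have hfb : ∀ k, ∀ i ∈ idx q (ylen m₁ m₂ (scale k)), ∀ ω ∈ Ω,
      |f k i ω| ≤ C * (K + 5) * (k + 1) := by
    intro k i hi ω hω
    have hi0 := (mem_idx.1 hi).1.1
    have h1 := hρ ω hω _ _ (isLevel_cnt H (scale k) hi0)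
    have h2 := Real.log_le_log (Real.exp_pos _) h1
    rw [Real.log_exp] at h2
    have h3 : Real.log (ρ.real (cell (cnt q (scale k) i) (cnt q (ylen m₁ m₂ (scale k)) i) ω)) ≤ 0 :=
      Real.log_nonpos measureReal_nonneg measureReal_le_one
    have h4 : cnt q (ylen m₁ m₂ (scale k)) i ≤ K + 4 * (k + 1) :=
      cnt_le hq hi0 (ylen_le_mul _ _ _)
    have h5 : (cnt q (ylen m₁ m₂ (scale k)) i : ℝ) ≤ K + 4 * (k + 1) := by exact_mod_cast h4
    simp only [f]
    rw [abs_neg, abs_of_nonpos h3]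
    have hk0 : (0 : ℝ) ≤ k := Nat.cast_nonneg k
    have hK0 : (0 : ℝ) ≤ K := Nat.cast_nonneg K
    have h6 : (cnt q (ylen m₁ m₂ (scale k)) i : ℝ) + 1 ≤ (K + 5) * (k + 1) := by nlinarith
    calc _ ≤ C * (cnt q (ylen m₁ m₂ (scale k)) i + 1) := by linarith
      _ ≤ C * ((K + 5) * (k + 1)) := mul_le_mul_of_nonneg_left h6 hC
      _ = _ := by ring
  have hint : ∀ k, ∫ ω, infoSum q ρ (scale k) ω ∂ν =
      ∑ i ∈ idx q (ylen m₁ m₂ (scale k)), ∫ ω, f k i ω ∂ν := fun k =>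
    integral_finsetSum _ fun i hi => Integrable.of_bound (hf k i).aestronglyMeasurable _
      (hae.mono fun ω hω => hfb k i hi ω hω)
  have hlln := ae_tendsto_sum_sub_integral_div ν f hf (fun k => idx q (ylen m₁ m₂ (scale k)))
    (fun k => C * (K + 5) * (k + 1)) (fun k => scale k)
    (fun k => by simp only [scale]; positivity)
    (fun k i hi => hae.mono fun ω hω => hfb k i hi ω hω) ?_
  · have hΩ : ∀ᵐ w ∂(Measure.infinitePi fun _ : ℕ => ν), ∀ i, w i ∈ Ω :=
      ae_all_iff.2 fun i => (measurePreserving_eval_infinitePi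
        (fun _ : ℕ => ν) i).quasiMeasurePreserving.ae hae
    filter_upwards [hlln, hΩ] with w hw hwΩ
    have hpos : ∀ k, ∀ i ∈ idx q (ylen m₁ m₂ (scale k)),
        0 < ρ.real (cell (cnt q (scale k) i) (cnt q (ylen m₁ m₂ (scale k)) i) (w i)) :=
      fun k i hi => (Real.exp_pos _).trans_le (hρ _ (hwΩ i) _ _
        (isLevel_cnt H (scale k) (mem_idx.1 hi).1.1))
    have hprod : ∀ k, (prodMeasure q ρ).real
        (cell (scale k) (ylen m₁ m₂ (scale k)) (interleave q w)) =
        ∏ i ∈ idx q (ylen m₁ m₂ (scale k)),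
          ρ.real (cell (cnt q (scale k) i) (cnt q (ylen m₁ m₂ (scale k)) i) (w i)) := by
      intro k
      rw [measureReal_def, measure_cell_interleave hq ρ (le_ylen H _), ENNReal.toReal_prod]
      rfl
    refine ⟨fun k => hprod k ▸ Finset.prod_pos (hpos k), hw.congr fun k => ?_⟩
    rw [hprod, hint, Real.log_prod fun i hi => (hpos k i hi).ne', Finset.sum_neg_distrib]
  -- At scale (k+1)^4 there are O(k^4) terms of size O(k). Dividing by the squared scale, of order
  -- k^8, leaves O(k^(-2)), which is summable.
  · have hcard : ∀ k, ((idx q (ylen m₁ m₂ (scale k))).card : ℝ) ≤ K * (k + 1) ^ 4 := by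
      intro k
      have h1 : (idx q (ylen m₁ m₂ (scale k))).card ≤ ylen m₁ m₂ (scale k) :=
        Nat.le.intro (card_idx_add q _)
      have h2 := h1.trans (ylen_le_mul m₁ m₂ (scale k))
      rw [scale] at h2
      exact_mod_cast h2
    have hs : Summable fun k : ℕ => K * (C * (K + 5)) ^ 2 * (1 / ((k + 1 : ℕ) : ℝ) ^ 2) :=
      ((summable_nat_add_iff 1).2 (Real.summable_one_div_nat_pow.2 one_lt_two)).mul_left _
    refine Summable.of_nonneg_of_le (fun k => by positivity) (fun k => ?_) hs
    have hk : (0 : ℝ) < (k : ℝ) + 1 := by positivity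
    rw [show ((scale k : ℕ) : ℝ) = ((k : ℝ) + 1) ^ 4 by simp [scale], div_le_iff₀ (by positivity)]
    refine (mul_le_mul_of_nonneg_right (hcard k) (sq_nonneg _)).trans (le_of_eq ?_)
    push_cast
    field_simp

theorem exists_scale_le {K n : ℕ} (hn : scale K ≤ n) :
    ∃ k, K ≤ k ∧ scale k ≤ n ∧ n < scale (k + 1) := by
  have hlt : ∀ k, scale k < scale (k + 1) := fun k => Nat.pow_lt_pow_left (by omega) (by omega)
  induction n, hn using Nat.le_induction with
  | base => exact ⟨K, le_rfl, le_rfl, hlt K⟩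
  | succ n _ ih =>
    obtain ⟨k, h1, h2, h3⟩ := ih
    rcases Nat.lt_or_ge (n + 1) (scale (k + 1)) with h | h
    · exact ⟨k, h1, by omega, h⟩
    · have := hlt (k + 1)
      exact ⟨k + 1, by omega, h, by omega⟩

theorem tendsto_scale : Tendsto scale atTop atTop :=
  (tendsto_pow_atTop (by norm_num : (4 : ℕ) ≠ 0)).comp (tendsto_add_atTop_nat 1)

theorem scale_pos (k : ℕ) : (0 : ℝ) < scale k := by
  rw [scale]
  positivity

theorem tendsto_scale_div : Tendsto (fun k => (scale k : ℝ) / scale (k + 1)) atTop (𝓝 1) := by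
  have h1 : Tendsto (fun k : ℕ => ((k + 1 : ℕ) : ℝ) / ((k + 1 : ℕ) + 1)) atTop (𝓝 1) :=
    (tendsto_natCast_div_add_atTop (1 : ℝ)).comp (tendsto_add_atTop_nat 1)
  have h2 := h1.pow 4
  rw [one_pow] at h2
  refine h2.congr fun k => ?_
  simp only [scale]
  push_cast
  rw [div_pow]

theorem hdim_mono {s t : Set (Symb m₁ m₂)} (h : s ⊆ t) : hdim s ≤ hdim t := by
  let _ : MetricSpace (Symb m₁ m₂) := carpetMetric m₁ m₂
  exact dimH_mono h

/-- Removing a measurable hull of the exceptional null set yields a Borel set of full mass, so p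
need not be measurable. -/
theorem upperHdim_le_of_ae {ν : Measure (Symb m₁ m₂)} {p : Symb m₁ m₂ → Prop} {d : ℝ≥0∞}
    (hp : ∀ᵐ z ∂ν, p z) (h : hdim {z | p z} ≤ d) : upperHdim ν ≤ d := by
  refine (iInf₂_le_of_le (toMeasurable ν {z | ¬ p z})ᶜ (measurableSet_toMeasurable _ _).compl
    (iInf_le_of_le ?_ le_rfl)).trans (le_trans ?_ h)
  · rw [compl_compl, measure_toMeasurable]
    exact hp
  · refine hdim_mono fun z hz => ?_
    by_contra hz'
    exact hz (subset_toMeasurable _ _ hz')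

theorem lowerHdim_le_upperHdim (ν : Measure (Symb m₁ m₂)) [IsProbabilityMeasure ν] :
    lowerHdim ν ≤ upperHdim ν := by
  refine le_iInf₂ fun s hs => le_iInf fun hνs => iInf₂_le_of_le s hs (iInf_le_of_le ?_ le_rfl)
  rw [(prob_compl_eq_zero_iff hs).1 hνs]
  exact one_pos

/-! ### Dimensions of the measures ℙ_ν -/

section Dimension

variable {Ω : Set (Symb m₁ m₂)} {t : Word m₁ m₂ → ℝ} {μ ν ρ : Measure (Symb m₁ m₂)}

/-- For an upper bound, heavy balls at infinitely many radii suffice, so the sparse scales can be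
used directly. -/
theorem upperHdim_prodMeasure_le (H : Params m₁ m₂ q j) [IsProbabilityMeasure ρ]
    (hν : IsProbOn Ω ν) {C : ℝ} (hC : 0 ≤ C) (hρ : ∀ ω ∈ Ω, ∀ p s, IsLevel j p s →
      Real.exp (-(C * (s + 1))) ≤ ρ.real (cell p s ω)) {d e : ℝ}
    (he : ∀ᶠ n : ℕ in atTop, (∫ ω, infoSum q ρ n ω ∂ν) ≤ e * n) (hed : e < d * Real.log m₁) :
    upperHdim (prodMeasure q ν) ≤ ENNReal.ofReal d := by
  have := hν.1
  have := isProbabilityMeasure_prodMeasure q ρ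
  have hm₁ : (0 : ℝ) < m₁ := by have := H.two_le; have := H.lt; norm_cast; omega
  refine upperHdim_le_of_ae (ae_tendsto_log_prodMeasure H hν hC hρ)
    (hdim_le_of_frequently H.two_le H.lt (prodMeasure q ρ) ?_)
  rintro z ⟨hpos, hz⟩
  have h1 := hz.eventually_lt_const (sub_pos.2 hed)
  have h2 := tendsto_scale.eventually he
  refine tendsto_scale.frequently (Eventually.frequently ?_)
  filter_upwards [h1, h2] with k hk1 hk2
  have hs := scale_pos k
  rw [div_lt_iff₀ hs] at hk1
  have h3 : -(scale k * d) * Real.log m₁ ≤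
      Real.log ((prodMeasure q ρ).real (cell (scale k) (ylen m₁ m₂ (scale k)) z)) := by
    nlinarith
  rw [Real.rpow_def_of_pos hm₁, ← Real.le_log_iff_exp_le (hpos k), mul_comm]
  exact h3

/-- A lower bound needs all radii. A ball of level n lies in the one of level `scale k` with `scale
k` ≤ n < `scale (k + 1)`, and the loss is negligible since the ratio of consecutive scales tends to
1. -/
theorem le_lowerHdim_prodMeasure (H : Params m₁ m₂ q j) (hμ : IsProbOn Ω μ) {C : ℝ} (hC : 0 ≤ C)
    (hρ : ∀ ω ∈ Ω, ∀ p s, IsLevel j p s →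
      Real.exp (-(C * (s + 1))) ≤ μ.real (cell p s ω)) {d e : ℝ} (hd : 0 ≤ d)
    (he : Tendsto (fun n : ℕ => (∫ ω, infoSum q μ n ω ∂μ) / n) atTop (𝓝 e))
    (hed : d * Real.log m₁ < e) :
    ENNReal.ofReal d ≤ lowerHdim (prodMeasure q μ) := by
  have := hμ.1
  have := isProbabilityMeasure_prodMeasure q μ
  have hm₁ : (1 : ℝ) < m₁ := by have := H.two_le; have := H.lt; norm_cast; omega
  have hm₁0 : (0 : ℝ) < m₁ := one_pos.trans hm₁
  have hae := ae_tendsto_log_prodMeasure H hμ hC hρ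
  refine le_iInf₂ fun s hs => le_iInf fun hμs => ?_
  refine le_trans ?_ (hdim_mono (inter_subset_left : s ∩ {z |
    (∀ k, 0 < (prodMeasure q μ).real (cell (scale k) (ylen m₁ m₂ (scale k)) z)) ∧
    Tendsto (fun k : ℕ => (-Real.log
      ((prodMeasure q μ).real (cell (scale k) (ylen m₁ m₂ (scale k)) z)) -
        ∫ ω, infoSum q μ (scale k) ω ∂μ) / scale k) atTop (𝓝 0)} ⊆ s))
  refine le_hdim_of_eventually H.two_le H.lt (prodMeasure q μ) hd ?_ ?_
  · rw [inter_comm]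
    exact (Measure.measure_inter_eq_of_ae hae).trans_ne hμs.ne'
  rintro z ⟨-, hpos, hz⟩
  have h1 : Tendsto (fun k : ℕ => -Real.log ((prodMeasure q μ).real
      (cell (scale k) (ylen m₁ m₂ (scale k)) z)) / scale (k + 1)) atTop (𝓝 e) := by
    have h2 := ((hz.add (he.comp tendsto_scale)).mul tendsto_scale_div)
    rw [zero_add, mul_one] at h2
    refine h2.congr fun k => ?_
    have := (scale_pos k).ne'
    simp only [Function.comp]
    field_simp
    ring
  obtain ⟨K, hK⟩ := eventually_atTop.1 (h1.eventually_const_lt hed)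
  refine eventually_atTop.2 ⟨scale K, fun n hn => ?_⟩
  obtain ⟨k, hKk, hk1, hk2⟩ := exists_scale_le hn
  have h3 := hK k hKk
  rw [lt_div_iff₀ (scale_pos _)] at h3
  have hsub : cell n (ylen m₁ m₂ n) z ⊆ cell (scale k) (ylen m₁ m₂ (scale k)) z :=
    cell_anti hk1 (Nat.ceil_le_ceil (div_le_div_of_nonneg_right (Nat.cast_le.2 hk1)
      H.gam_pos.le)) z
  refine (measureReal_mono hsub).trans ?_
  rw [Real.rpow_def_of_pos hm₁0, ← Real.log_le_iff_le_exp (hpos k)]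
  have h4 : (n : ℝ) ≤ scale (k + 1) := by exact_mod_cast hk2.le
  have h5 : 0 ≤ d * Real.log m₁ := mul_nonneg hd (Real.log_pos hm₁).le
  nlinarith [mul_le_mul_of_nonneg_left h4 h5]

theorem HasWeights.exists_exp_le (H : Params m₁ m₂ q j) (ht : IsSolution q j Ω t)
    (hμ : HasWeights q j Ω t μ) :
    ∃ C : ℝ, 0 ≤ C ∧ ∀ ω ∈ Ω, ∀ p s, IsLevel j p s →
      Real.exp (-(C * (s + 1))) ≤ μ.real (cell p s ω) := by
  obtain ⟨B, hB0, hB⟩ := exists_info_bound H ht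
  refine ⟨2 * B, by positivity, fun ω hω p s h => ?_⟩
  rw [hμ.measure_cell H ht hω h, Real.exp_le_exp, neg_le_neg_iff]
  have hps : (p : ℝ) ≤ s := by
    unfold IsLevel at h
    norm_cast
    omega
  have h1 : ∑ r ∈ Finset.range s, yInfo q j Ω t r ω ≤ s * B := by
    refine (Finset.sum_le_card_nsmul _ _ B fun r _ => (le_abs_self _).trans
      (hB ω hω r).2.2.1).trans ?_
    rw [Finset.card_range, nsmul_eq_mul]
  have h2 : ∑ r ∈ Finset.range p, xInfo q j Ω t r ω ≤ p * B := by
    refine (Finset.sum_le_card_nsmul _ _ B fun r _ => (le_abs_self _).trans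
      (hB ω hω r).2.2.2).trans ?_
    rw [Finset.card_range, nsmul_eq_mul]
  nlinarith

theorem mul_log_eq_dimValue (H : Params m₁ m₂ q j) :
    (1 - 1 / (q : ℝ)) * (Real.log (tRoot q j Ω t) / gam m₁ m₂) =
      dimValue q j Ω t * Real.log m₁ := by
  have h1 : Real.log m₁ ≠ 0 :=
    (Real.log_pos (by have := H.two_le; have := H.lt; norm_cast; omega)).ne'
  have h2 := H.gam_pos.ne'
  have h3 := H.q_pos.ne'
  rw [dimValue, Real.logb, H.log_eq]
  field_simp

theorem dimValue_nonneg (H : Params m₁ m₂ q j) (ht : IsSolution q j Ω t) (hne : Ω.Nonempty) :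
    0 ≤ dimValue q j Ω t := by
  have h1 : (1 : ℝ) < m₂ := by have := H.two_le; norm_cast
  have h2 := H.one_lt_q
  exact mul_nonneg (div_nonneg (by linarith) H.q_pos.le)
    (Real.logb_nonneg h1 (one_le_tRoot H ht.one_le hne))

theorem HasWeights.le_lowerHdim (H : Params m₁ m₂ q j) (ht : IsSolution q j Ω t)
    (hμ : HasWeights q j Ω t μ) :
    ENNReal.ofReal (dimValue q j Ω t) ≤ lowerHdim (prodMeasure q μ) := by
  obtain ⟨C, hC, hμC⟩ := hμ.exists_exp_le H ht
  have hm₁ : 0 < Real.log m₁ :=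
    Real.log_pos (by have := H.two_le; have := H.lt; norm_cast; omega)
  have hlim := hμ.tendsto_integral_infoSum H ht hμ.1
  rw [mul_log_eq_dimValue H] at hlim
  have htend : Tendsto (fun n : ℕ => ENNReal.ofReal (dimValue q j Ω t - 1 / ((n : ℝ) + 1))) atTop
      (𝓝 (ENNReal.ofReal (dimValue q j Ω t))) := by
    have h := (tendsto_one_div_add_atTop_nhds_zero_nat (𝕜 := ℝ)).const_sub (dimValue q j Ω t)
    rw [sub_zero] at h
    exact ENNReal.tendsto_ofReal h
  refine le_of_tendsto' htend fun n => ?_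
  have hn : 0 < 1 / ((n : ℝ) + 1) := by positivity
  rcases le_total 0 (dimValue q j Ω t - 1 / ((n : ℝ) + 1)) with h | h
  · exact le_lowerHdim_prodMeasure H hμ.1 hC hμC h hlim (mul_lt_mul_of_pos_right (by linarith) hm₁)
  · rw [ENNReal.ofReal_of_nonpos h]
    exact zero_le

theorem HasWeights.upperHdim_le (H : Params m₁ m₂ q j) (ht : IsSolution q j Ω t)
    (hμ : HasWeights q j Ω t μ) :
    upperHdim (prodMeasure q μ) ≤ ENNReal.ofReal (dimValue q j Ω t) := by
  obtain ⟨C, hC, hμC⟩ := hμ.exists_exp_le H ht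
  have := hμ.1.1
  have hm₁ : 0 < Real.log m₁ :=
    Real.log_pos (by have := H.two_le; have := H.lt; norm_cast; omega)
  have hlim := hμ.tendsto_integral_infoSum H ht hμ.1
  rw [mul_log_eq_dimValue H] at hlim
  have htend : Tendsto (fun n : ℕ => ENNReal.ofReal (dimValue q j Ω t + 1 / ((n : ℝ) + 1))) atTop
      (𝓝 (ENNReal.ofReal (dimValue q j Ω t))) := by
    have h := (tendsto_one_div_add_atTop_nhds_zero_nat (𝕜 := ℝ)).const_add (dimValue q j Ω t)
    rw [add_zero] at h
    exact ENNReal.tendsto_ofReal h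
  refine ge_of_tendsto' htend fun n => ?_
  have hn : 0 < 1 / ((n : ℝ) + 1) := by positivity
  obtain ⟨e, he1, he2⟩ := exists_between (mul_lt_mul_of_pos_right
    (lt_add_of_pos_right (dimValue q j Ω t) hn) hm₁)
  refine upperHdim_prodMeasure_le H hμ.1 hC hμC (e := e) ?_ he2
  filter_upwards [hlim.eventually_le_const he1, eventually_gt_atTop 0] with n hn hn0
  rwa [div_le_iff₀ (Nat.cast_pos.2 hn0)] at hn

/-! ### Uniqueness of the maximizer -/

theorem integrable_comp_lev (ν : Measure (Symb m₁ m₂)) [IsProbabilityMeasure ν] {p s : ℕ}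
    (φ : (Fin p → Fin m₁ × Fin m₂) × (Fin s → Fin m₂) → ℝ) :
    Integrable (fun ω => φ (lev p s ω)) ν := by
  have := Measure.isProbabilityMeasure_map (μ := ν) (measurable_lev (m₁ := m₁) (m₂ := m₂) p s).aemeasurable
  exact (integrable_map_measure (measurable_of_finite φ).aestronglyMeasurable
    (measurable_lev p s).aemeasurable).1 Integrable.of_finite

theorem integral_comp_lev (ν : Measure (Symb m₁ m₂)) [IsProbabilityMeasure ν] {p s : ℕ}
    (φ : (Fin p → Fin m₁ × Fin m₂) × (Fin s → Fin m₂) → ℝ) :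
    ∫ ω, φ (lev p s ω) ∂ν = ∑ b, ν.real (lev p s ⁻¹' {b}) * φ b := by
  have := Measure.isProbabilityMeasure_map (μ := ν) (measurable_lev (m₁ := m₁) (m₂ := m₂) p s).aemeasurable
  rw [← integral_map (measurable_lev p s).aemeasurable
    (measurable_of_finite φ).aestronglyMeasurable, integral_fintype Integrable.of_finite]
  refine Finset.sum_congr rfl fun b _ => ?_
  rw [map_measureReal_apply (measurable_lev p s) (measurableSet_singleton b), smul_eq_mul]

theorem integrable_log_cell (ν ρ : Measure (Symb m₁ m₂)) [IsProbabilityMeasure ν] (p s : ℕ) :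
    Integrable (fun ω => -Real.log (ρ.real (cell p s ω))) ν := by
  simp only [cell_eq]
  exact integrable_comp_lev ν fun b => -Real.log (ρ.real (lev p s ⁻¹' {b}))

/-- A lower bound for the information that is lost by the use of `μ` instead of the mean of `μ` and
`ν` for the cells of level `(p, s)`. -/
noncomputable def levelGap (μ ν : Measure (Symb m₁ m₂)) (p s : ℕ) : ℝ :=
  ∑ b, (ν.real (lev p s ⁻¹' {b}) - μ.real (lev p s ⁻¹' {b})) ^ 2 /
    (2 * (ν.real (lev p s ⁻¹' {b}) + μ.real (lev p s ⁻¹' {b})))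

theorem levelGap_nonneg (μ ν : Measure (Symb m₁ m₂)) (p s : ℕ) : 0 ≤ levelGap μ ν p s :=
  Finset.sum_nonneg fun _ _ => by positivity

theorem levelGap_pos {p s : ℕ} {z : Symb m₁ m₂}
    (h : μ.real (cell p s z) ≠ ν.real (cell p s z)) : 0 < levelGap μ ν p s := by
  refine Finset.sum_pos' (fun _ _ => by positivity) ⟨lev p s z, Finset.mem_univ _, ?_⟩
  rw [← cell_eq]
  have h1 : 0 < (ν.real (cell p s z) - μ.real (cell p s z)) ^ 2 :=
    sq_pos_of_ne_zero (sub_ne_zero.2 h.symm)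
  have h2 : 0 < ν.real (cell p s z) + μ.real (cell p s z) := by
    have ha := measureReal_nonneg (μ := μ) (s := cell p s z)
    have hb := measureReal_nonneg (μ := ν) (s := cell p s z)
    rcases ha.eq_or_lt with ha' | ha'
    · rcases hb.eq_or_lt with hb' | hb'
      · exact absurd (ha'.symm.trans hb') h
      · linarith
    · linarith
  positivity

theorem sum_measureReal_lev (ν : Measure (Symb m₁ m₂)) [IsProbabilityMeasure ν] (p s : ℕ) :
    ∑ b, ν.real (lev p s ⁻¹' {b}) = 1 := by
  have := integral_comp_lev ν (p := p) (s := s) fun _ => 1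
  simpa using this.symm

/-- Integrate log(ρ/μ) ≥ 1 - μ/ρ against ν. -/
theorem levelGap_le (hμ : IsProbabilityMeasure μ) (hν : IsProbOn Ω ν) {p s : ℕ}
    (hpos : ∀ ω ∈ Ω, 0 < μ.real (cell p s ω))
    (hρ : ∀ A, ρ.real A = (μ.real A + ν.real A) / 2) :
    levelGap μ ν p s + ∫ ω, -Real.log (ρ.real (cell p s ω)) ∂ν ≤
      ∫ ω, -Real.log (μ.real (cell p s ω)) ∂ν := by
  have := hν.1
  let φ : (Fin p → Fin m₁ × Fin m₂) × (Fin s → Fin m₂) → ℝ := fun b =>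
    1 - μ.real (lev p s ⁻¹' {b}) / ρ.real (lev p s ⁻¹' {b})
  have h1 : ∫ ω, φ (lev p s ω) ∂ν = levelGap μ ν p s := by
    -- Subtracting this vanishing sum turns the terms ν(ν - μ)/(ν + μ) into the nonnegative terms (ν
    -- - μ)²/(2(ν + μ)).
    have h2 : ∑ b, (ν.real (lev p s ⁻¹' {b}) - μ.real (lev p s ⁻¹' {b})) / 2 = 0 := by
      rw [← Finset.sum_div, Finset.sum_sub_distrib, sum_measureReal_lev, sum_measureReal_lev]
      norm_num
    rw [integral_comp_lev, levelGap, ← sub_eq_zero, ← Finset.sum_sub_distrib, ← h2]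
    refine Finset.sum_congr rfl fun b _ => ?_
    simp only [φ, hρ]
    have ha := measureReal_nonneg (μ := μ) (s := lev p s ⁻¹' {b})
    have hb := measureReal_nonneg (μ := ν) (s := lev p s ⁻¹' {b})
    generalize μ.real (lev p s ⁻¹' {b}) = x at ha ⊢
    generalize ν.real (lev p s ⁻¹' {b}) = y at hb ⊢
    rcases eq_or_ne (x + y) 0 with h | h
    · obtain rfl : x = 0 := by linarith
      obtain rfl : y = 0 := by linarith
      simp
    · have h' : y + x ≠ 0 := by rwa [add_comm]
      field_simp
      ring
  rw [← h1, ← integral_add (integrable_comp_lev ν φ) (integrable_log_cell ν ρ p s)]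
  refine integral_mono_ae ((integrable_comp_lev ν φ).add (integrable_log_cell ν ρ p s))
    (integrable_log_cell ν μ p s) ?_
  have hae : ∀ᵐ ω ∂ν, ω ∈ Ω := by
    rw [ae_iff]
    exact hν.2
  filter_upwards [hae] with ω hω
  have h2 := hpos ω hω
  have h3 : 0 < ρ.real (cell p s ω) := by
    rw [hρ]
    linarith [measureReal_nonneg (μ := ν) (s := cell p s ω)]
  have h4 := Real.one_sub_inv_le_log_of_pos (div_pos h3 h2)
  rw [Real.log_div h3.ne' h2.ne', inv_div] at h4
  simp only [φ, ← cell_eq]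
  linarith

/-- The measures differ on a cell of some level (p, p + j), whose gap is gained for at least c n
indices i. At other levels the gap is only needed to be nonnegative. -/
theorem HasWeights.exists_integral_infoSum_le (H : Params m₁ m₂ q j) (ht : IsSolution q j Ω t)
    (hμ : HasWeights q j Ω t μ) (hν : IsProbOn Ω ν) (hne : ν ≠ μ)
    (hρ : ∀ A, ρ.real A = (μ.real A + ν.real A) / 2) :
    ∃ δ : ℝ, 0 < δ ∧ ∀ᶠ n : ℕ in atTop, (∫ ω, infoSum q ρ n ω ∂ν) ≤
      (dimValue q j Ω t * Real.log m₁ - δ) * n := by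
  have := hμ.1.1
  have := hν.1
  obtain ⟨C, hC, hμC⟩ := hμ.exists_exp_le H ht
  obtain ⟨p, hp, z, hz⟩ : ∃ p, 1 ≤ p ∧ ∃ z, μ.real (cell p (p + j) z) ≠ ν.real (cell p (p + j) z) := by
    by_contra! h
    exact hne (measure_eq_of_cell h).symm
  obtain ⟨c, hc, hcard⟩ := exists_card_level_ge H hp
  set g := levelGap μ ν p (p + j) with hg
  have hg0 : 0 < g := levelGap_pos hz
  have hlim := hμ.tendsto_integral_infoSum H ht hν
  rw [mul_log_eq_dimValue H] at hlim
  -- The gain is g c n; half of it absorbs the error in the limit of the mean μ-information.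
  refine ⟨g * c / 2, by positivity, ?_⟩
  have hdiff : ∀ n : ℕ, g * ((idx q (ylen m₁ m₂ n)).filter fun i =>
      cnt q n i = p ∧ cnt q (ylen m₁ m₂ n) i = p + j).card + ∫ ω, infoSum q ρ n ω ∂ν ≤
      ∫ ω, infoSum q μ n ω ∂ν := by
    intro n
    have hint : ∀ ρ : Measure (Symb m₁ m₂), ∫ ω, infoSum q ρ n ω ∂ν =
        ∑ i ∈ idx q (ylen m₁ m₂ n),
          ∫ ω, -Real.log (ρ.real (cell (cnt q n i) (cnt q (ylen m₁ m₂ n) i) ω)) ∂ν := fun ρ =>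
      integral_finsetSum _ fun i _ => integrable_log_cell ν ρ _ _
    have hsum : g * ((idx q (ylen m₁ m₂ n)).filter fun i =>
        cnt q n i = p ∧ cnt q (ylen m₁ m₂ n) i = p + j).card ≤
        ∑ i ∈ idx q (ylen m₁ m₂ n), levelGap μ ν (cnt q n i) (cnt q (ylen m₁ m₂ n) i) := by
      rw [mul_comm, ← nsmul_eq_mul, ← Finset.sum_const]
      refine le_trans (Finset.sum_le_sum fun i hi => ?_) (Finset.sum_le_sum_of_subset_of_nonneg
        (Finset.filter_subset _ _) fun i _ _ => levelGap_nonneg _ _ _ _)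
      obtain ⟨-, h1, h2⟩ := Finset.mem_filter.1 hi
      rw [h1, h2]
    refine (add_le_add_left hsum _).trans ?_
    rw [hint, hint, ← Finset.sum_add_distrib]
    refine Finset.sum_le_sum fun i hi => levelGap_le hμ.1.1 hν (fun ω hω => ?_) hρ
    exact (Real.exp_pos _).trans_le (hμC ω hω _ _ (isLevel_cnt H n (mem_idx.1 hi).1.1))
  filter_upwards [hcard, hlim.eventually_le_const (lt_add_of_pos_right _
    (by positivity : 0 < g * c / 2)), eventually_gt_atTop 0] with n h1 h2 h3
  rw [div_le_iff₀ (Nat.cast_pos.2 h3)] at h2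
  have h4 := hdiff n
  have h5 := mul_le_mul_of_nonneg_left h1 hg0.le
  nlinarith

theorem HasWeights.upperHdim_lt (H : Params m₁ m₂ q j) (ht : IsSolution q j Ω t)
    (hμ : HasWeights q j Ω t μ) (hν : IsProbOn Ω ν) (hne : ν ≠ μ) :
    upperHdim (prodMeasure q ν) < ENNReal.ofReal (dimValue q j Ω t) := by
  have := hμ.1.1
  have := hν.1
  have hm₁ : 0 < Real.log m₁ :=
    Real.log_pos (by have := H.two_le; have := H.lt; norm_cast; omega)
  set ρ : Measure (Symb m₁ m₂) := (2⁻¹ : ℝ≥0∞) • (μ + ν) with hρdef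
  have hρp : IsProbabilityMeasure ρ := by
    refine ⟨?_⟩
    rw [hρdef, Measure.smul_apply, Measure.add_apply, measure_univ, measure_univ, smul_eq_mul,
      one_add_one_eq_two, ENNReal.inv_mul_cancel two_ne_zero ENNReal.ofNat_ne_top]
  have hρ : ∀ A, ρ.real A = (μ.real A + ν.real A) / 2 := by
    intro A
    rw [hρdef, measureReal_ennreal_smul_apply, measureReal_add_apply, ENNReal.toReal_inv,
      ENNReal.toReal_ofNat]
    ring
  obtain ⟨C, hC, hμC⟩ := hμ.exists_exp_le H ht
  -- Since ρ ≥ μ/2, the bound for μ carries over; the factor 1/2 is absorbed by raising C to C + 1.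
  have hρC : ∀ ω ∈ Ω, ∀ p s, IsLevel j p s →
      Real.exp (-((C + 1) * (s + 1))) ≤ ρ.real (cell p s ω) := by
    intro ω hω p s h
    have h1 := hμC ω hω p s h
    have h2 : Real.exp (-((C + 1) * ((s : ℝ) + 1))) ≤ Real.exp (-(C * (s + 1))) / 2 := by
      have h3 : Real.exp (-((s : ℝ) + 1)) ≤ 1 / 2 := by
        rw [Real.exp_neg, one_div]
        refine inv_anti₀ two_pos ?_
        have := Real.add_one_le_exp ((s : ℝ) + 1)
        linarith [Nat.cast_nonneg (α := ℝ) s]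
      rw [show -((C + 1) * ((s : ℝ) + 1)) = -(C * (s + 1)) + -((s : ℝ) + 1) by ring, Real.exp_add]
      have := mul_le_mul_of_nonneg_left h3 (Real.exp_pos (-(C * ((s : ℝ) + 1)))).le
      linarith
    rw [hρ]
    linarith [measureReal_nonneg (μ := ν) (s := cell p s ω)]
  obtain ⟨δ, hδ, hle⟩ := hμ.exists_integral_infoSum_le H ht hν hne hρ
  -- `ENNReal.ofReal` is strictly monotone only towards positive values. If the value were not
  -- positive, a mean information would be negative.
  have hpos : 0 < dimValue q j Ω t := by
    by_contra! hD
    obtain ⟨n, hn, hn0⟩ := (hle.and (eventually_gt_atTop 0)).exists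
    have h0 : 0 ≤ ∫ ω, infoSum q ρ n ω ∂ν := integral_nonneg fun ω =>
      Finset.sum_nonneg fun i _ => neg_nonneg.2
        (Real.log_nonpos measureReal_nonneg measureReal_le_one)
    have hn0' : (0 : ℝ) < n := Nat.cast_pos.2 hn0
    have h1 : dimValue q j Ω t * Real.log m₁ ≤ 0 := mul_nonpos_of_nonpos_of_nonneg hD hm₁.le
    nlinarith
  refine lt_of_le_of_lt (upperHdim_prodMeasure_le H hν (by positivity) hρC
    (d := dimValue q j Ω t - δ / 2 / Real.log m₁) hle ?_) ?_
  · rw [sub_mul, div_mul_cancel₀ _ hm₁.ne']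
    linarith
  · rw [ENNReal.ofReal_lt_ofReal_iff hpos]
    have : 0 < δ / 2 / Real.log m₁ := by positivity
    linarith

/-- The set X_Ω is Borel because Ω is closed, and ℙ_μ gives it full mass since almost surely all the
independent sequences lie in Ω. -/
theorem lowerHdim_le_hdim_multSet (hq : 2 ≤ q) (hΩ : IsClosed Ω) (hμ : IsProbOn Ω μ) :
    lowerHdim (prodMeasure q μ) ≤ hdim (multSet q Ω) := by
  have := hμ.1
  have hmeas : MeasurableSet (multSet q Ω) := by
    have : multSet q Ω = ⋂ i : ℕ, ⋂ _ : ¬ q ∣ i, (fun (z : Symb m₁ m₂) (l : ℕ) =>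
        z (i * q ^ l - 1)) ⁻¹' Ω := by
      ext z
      simp [multSet]
    rw [this]
    exact MeasurableSet.iInter fun i => MeasurableSet.iInter fun _ =>
      (measurable_pi_lambda _ fun l => measurable_pi_apply _) hΩ.measurableSet
  have hae : ∀ᵐ w ∂(Measure.infinitePi fun _ : ℕ => μ), w ∈ interleave q ⁻¹' multSet q Ω := by
    have h : ∀ᵐ w ∂(Measure.infinitePi fun _ : ℕ => μ), ∀ i, w i ∈ Ω :=
      ae_all_iff.2 fun i => (measurePreserving_eval_infinitePi
        (fun _ : ℕ => μ) i).quasiMeasurePreserving.ae (by rw [ae_iff]; exact hμ.2)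
    filter_upwards [h] with w hw i hi
    simp only [interleave_apply hq w hi]
    exact hw i
  refine iInf₂_le_of_le _ hmeas (iInf_le_of_le ?_ le_rfl)
  rw [prodMeasure, Measure.map_apply (measurable_interleave q) hmeas,
    (prob_compl_eq_zero_iff (measurable_interleave q hmeas)).1 hae]
  exact one_pos

end Dimension

end MultCarpet

/-! ### Conclusion -/

theorem proposition2p5 (m₁ m₂ q j : ℕ) (hm₂ : 2 ≤ m₂) (hm : m₂ < m₁) (hq : 2 ≤ q)
    (hj : (q : ℝ) ^ j ≤ 1 / MultCarpet.gam m₁ m₂)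
    (hj' : 1 / MultCarpet.gam m₁ m₂ < (q : ℝ) ^ (j + 1))
    (Ω : Set (MultCarpet.Symb m₁ m₂)) (hΩ : IsClosed Ω) (hne : Ω.Nonempty) :
    ∃ t : MultCarpet.Word m₁ m₂ → ℝ,
      (∀ u ∈ MultCarpet.Pref 1 j Ω,
        MultCarpet.IsTreeVector q j Ω u t ∧
        ∀ s : MultCarpet.Word m₁ m₂ → ℝ, MultCarpet.IsTreeVector q j Ω u s →
          Set.EqOn s t (MultCarpet.treeVertices j Ω u)) ∧
      0 ≤ MultCarpet.dimValue q j Ω t ∧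
      ∃ μ : Measure (MultCarpet.Symb m₁ m₂),
        MultCarpet.HasWeights q j Ω t μ ∧
        (∀ ν : Measure (MultCarpet.Symb m₁ m₂), MultCarpet.HasWeights q j Ω t ν → ν = μ) ∧
        MultCarpet.lowerHdim (MultCarpet.prodMeasure q μ) =
          ENNReal.ofReal (MultCarpet.dimValue q j Ω t) ∧
        MultCarpet.upperHdim (MultCarpet.prodMeasure q μ) =
          ENNReal.ofReal (MultCarpet.dimValue q j Ω t) ∧
        (∀ ν : Measure (MultCarpet.Symb m₁ m₂), MultCarpet.IsProbOn Ω ν → ν ≠ μ →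
          MultCarpet.lowerHdim (MultCarpet.prodMeasure q ν) <
            MultCarpet.lowerHdim (MultCarpet.prodMeasure q μ) ∧
          MultCarpet.upperHdim (MultCarpet.prodMeasure q ν) <
            MultCarpet.upperHdim (MultCarpet.prodMeasure q μ)) ∧
        ENNReal.ofReal (MultCarpet.dimValue q j Ω t) ≤ MultCarpet.hdim (MultCarpet.multSet q Ω) := by
  have H : MultCarpet.Params m₁ m₂ q j := ⟨hm₂, hm, hq, hj, hj'⟩
  obtain ⟨t, ht⟩ := MultCarpet.exists_isSolution H Ω
  obtain ⟨μ, hμ⟩ := MultCarpet.exists_hasWeights H ht hΩ hne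
  have hprob := hμ.1.1
  have hprob' := MultCarpet.isProbabilityMeasure_prodMeasure q μ
  have hle := hμ.le_lowerHdim H ht
  have hge := hμ.upperHdim_le H ht
  have hlu := MultCarpet.lowerHdim_le_upperHdim (MultCarpet.prodMeasure q μ)
  have hlow := le_antisymm (hlu.trans hge) hle
  have hupp := le_antisymm hge (hle.trans hlu)
  refine ⟨t, fun u hu => ⟨ht.isTreeVector hu, fun s hs v hv => ?_⟩,
    MultCarpet.dimValue_nonneg H ht hne, μ, hμ, fun ν hν => hμ.unique hν, hlow, hupp,
    fun ν hν hνμ => ?_, hle.trans (MultCarpet.lowerHdim_le_hdim_multSet hq hΩ hμ.1)⟩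
  · exact le_antisymm (hs.le_of_isTreeVector H hu (ht.isTreeVector hu) v hv)
      ((ht.isTreeVector hu).le_of_isTreeVector H hu hs v hv)
  · have := hν.1
    have := MultCarpet.isProbabilityMeasure_prodMeasure q ν
    have hlt := hμ.upperHdim_lt H ht hν hνμ
    rw [hlow, hupp]
    -- Strictness for the upper dimension gives both claims, because the lower and upper dimensions
    -- of ℙ_μ coincide.
    exact ⟨(MultCarpet.lowerHdim_le_upperHdim _).trans_lt hlt, hlt⟩
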